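/- Let $\mathbb R_+=(0,+\infty)$, let $D_2=\{\zeta=(\zeta_1,\zeta_2)\in\mathbb C^2:\operatorname{Im}\zeta_2-|\zeta_1|^2>0\}$ with Lebesgue measure, and fix integers $j,k\ge 1$. For integers $p,q\ge 0$ let $\mathcal A^2_{p,q}\subset L^2(D_2)$ be the closed subspace of all $f\in L^2(D_2)$ with $$\Big(\frac{\partial}{\partial\bar\zeta_1}-2i\zeta_1\frac{\partial}{\partial\bar\zeta_2}\Big)^{p}f=0,\qquad \Big(\frac{\partial}{\partial\bar\zeta_2}\Big)^{q}f=0$$ (in the sense of distributions; the space is $\{0\}$ if $p=0$ or $q=0$), and let $\mathcal A^2_{(j,k)}=\mathcal A^2_{j,k}\ominus(\mathcal A^2_{j-1,k}+\mathcal A^2_{j,k-1})$ be the true-poly-Bergman type space, with orthogonal projection $B:L^2(D_2)\to\mathcal A^2_{(j,k)}$. Let $L^\infty_{\{0,+\infty\}}(\mathbb R_+)$ be the set of all $b\in L^\infty(\mathbb R_+)$ for which the limits $b_0=\lim_{y\to0^+}b(y)$ and $b_\infty=\lim_{y\to+\infty}b(y)$ exist (up to null sets). For such $b$, let $T_b$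 be the Toeplitz operator on $\mathcal A^2_{(j,k)}$ given by $T_bf=B\big(b(\operatorname{Im}\zeta_2-|\zeta_1|^2)f\big)$, and let $$\gamma^b(x)=\int_0^\infty b\Big(\frac{y}{2x}\Big)\,\ell_{k-1}(y)^2\,dy\quad(x>0),\qquad \ell_m(y)=(-1)^mL_m(y)e^{-y/2},\quad L_m(y)=\frac{e^y}{m!}\frac{d^m}{dy^m}\big(e^{-y}y^m\big).$$ Then: 1. For every $b\in L^\infty_{\{0,+\infty\}}(\mathbb R_+)$ the integrals defining $\gamma^b$ converge absolutely, and $\gamma^b$ extends to a continuous function on $[0,+\infty]$ with $\gamma^b(0)=b_\infty$ and $\gamma^b(+\infty)=b_0$. 2. The C*-algebra generated by all $\gamma^b$, $b\in L^\infty_{\{0,+\infty\}}(\mathbb R_+)$, in the algebra of bounded continuous functions on $\mathbb R_+$ is isometrically $*$-isomorphic to $C[0,+\infty]$, the isomorphism being the continuous extension of functions from $\mathbb R_+$ to $[0,+\infty]$. 3. The C*-algebra of bounded operators on $\mathcal A^2_{(j,k)}$ generated by all $T_b$, $b\in L^\infty_{\{0,+\infty\}}(\mathbb R_+)$, is isometrically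 $*$-isomorphic to $C[0,+\infty]$, by an isomorphism that maps each $T_b$ to (the continuous extension of) $\gamma^b$. -/

import Mathlib

open MeasureTheory Set Filter Topology
open scoped ENNReal ContDiff BoundedContinuousFunction

noncomputable section

namespace SiegelToeplitz

/-! ### The Siegel domain and its poly-Bergman type spaces -/

/-- The height function `Im ζ₂ - |ζ₁|²`. -/
def height (ζ : ℂ × ℂ) : ℝ := ζ.2.im - ‖ζ.1‖ ^ 2

/-- The two-dimensional Siegel domain `D₂ = {ζ : Im ζ₂ - |ζ₁|² > 0}`. -/
def siegel : Set (ℂ × ℂ) := {ζ | 0 < height ζ}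

/-- Lebesgue measure on `D₂`. -/
abbrev siegelMeasure : Measure (ℂ × ℂ) := volume.restrict siegel

/-- The Hilbert space `L²(D₂)`. -/
abbrev L2Siegel : Type := Lp ℂ 2 siegelMeasure

/-- The Wirtinger derivative `∂/∂ζ̄` in the complex direction `v`; for `v = (1, 0)` and `v = (0, 1)`
it is `∂/∂ζ̄₁` and `∂/∂ζ̄₂`. -/
def dbar (v : ℂ × ℂ) (φ : ℂ × ℂ → ℂ) (ζ : ℂ × ℂ) : ℂ :=
  (1 / 2 : ℂ) * (fderiv ℝ φ ζ v + Complex.I * fderiv ℝ φ ζ (Complex.I • v))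

/-- The operator `∂/∂ζ̄₁ - 2 i ζ₁ ∂/∂ζ̄₂`. -/
def dOne (φ : ℂ × ℂ → ℂ) (ζ : ℂ × ℂ) : ℂ :=
  dbar (1, 0) φ ζ - 2 * Complex.I * ζ.1 * dbar (0, 1) φ ζ

/-- The operator `∂/∂ζ̄₂`. -/
def dTwo (φ : ℂ × ℂ → ℂ) : ℂ × ℂ → ℂ := dbar (0, 1) φ

/-- Test functions: smooth, with compact support contained in `D₂`. -/
structure IsTest (φ : ℂ × ℂ → ℂ) : Prop where
  smooth : ContDiff ℝ ∞ φ
  compact : HasCompactSupport φ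
  support : tsupport φ ⊆ siegel

theorem IsTest.dbar {φ : ℂ × ℂ → ℂ} (h : IsTest φ) (v : ℂ × ℂ) : IsTest (dbar v φ) := by
  have hs : tsupport (SiegelToeplitz.dbar v φ) ⊆ tsupport φ := by
    refine closure_minimal ?_ (isClosed_tsupport φ)
    intro ζ hζ
    by_contra hn
    have h0 : fderiv ℝ φ ζ = 0 := by
      by_contra h1
      exact hn (support_fderiv_subset ℝ h1)
    exact hζ (by simp [SiegelToeplitz.dbar, h0])
  have hd : ContDiff ℝ ∞ (fderiv ℝ φ) := h.smooth.fderiv_right (by simp)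
  refine ⟨?_, h.compact.of_isClosed_subset (isClosed_tsupport _) hs, hs.trans h.support⟩
  unfold SiegelToeplitz.dbar
  fun_prop

theorem IsTest.dTwo {φ : ℂ × ℂ → ℂ} (h : IsTest φ) : IsTest (dTwo φ) := h.dbar _

theorem IsTest.dOne {φ : ℂ × ℂ → ℂ} (h : IsTest φ) : IsTest (dOne φ) := by
  have h1 := h.dbar (1, 0)
  have h2 := h.dbar (0, 1)
  have hs : tsupport (SiegelToeplitz.dOne φ) ⊆
      tsupport (SiegelToeplitz.dbar (1, 0) φ) ∪ tsupport (SiegelToeplitz.dbar (0, 1) φ) := by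
    refine closure_minimal ?_ ((isClosed_tsupport _).union (isClosed_tsupport _))
    intro ζ hζ
    by_contra hn
    rw [mem_union, not_or] at hn
    refine hζ ?_
    simp [SiegelToeplitz.dOne, image_eq_zero_of_notMem_tsupport hn.1,
      image_eq_zero_of_notMem_tsupport hn.2]
  refine ⟨?_, ?_, hs.trans (union_subset h1.support h2.support)⟩
  · have e1 := h1.smooth
    have e2 := h2.smooth
    unfold SiegelToeplitz.dOne
    fun_prop
  · exact (h1.compact.isCompact.union h2.compact.isCompact).of_isClosed_subset
      (isClosed_tsupport _) hs

theorem IsTest.dOne_iterate {φ : ℂ × ℂ → ℂ} (h : IsTest φ) (j : ℕ) :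
    IsTest (SiegelToeplitz.dOne^[j] φ) := by
  induction j with
  | zero => exact h
  | succ n ih => rw [Function.iterate_succ_apply']; exact ih.dOne

theorem IsTest.dTwo_iterate {φ : ℂ × ℂ → ℂ} (h : IsTest φ) (k : ℕ) :
    IsTest (SiegelToeplitz.dTwo^[k] φ) := by
  induction k with
  | zero => exact h
  | succ n ih => rw [Function.iterate_succ_apply']; exact ih.dTwo

theorem IsTest.memLp {φ : ℂ × ℂ → ℂ} (h : IsTest φ) : MemLp φ 2 siegelMeasure :=
  (h.smooth.continuous.memLp_of_hasCompactSupport h.compact).restrict _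

/-- The pairing of `L²(D₂)` with a test function is an inner product. -/
theorem IsTest.integral_eq_inner {φ : ℂ × ℂ → ℂ} (h : IsTest φ) (f : L2Siegel) :
    ∫ ζ in siegel, f ζ * φ ζ = inner ℂ (h.memLp.star.toLp (star φ)) f := by
  rw [L2.inner_def]
  refine integral_congr_ae ?_
  filter_upwards [h.memLp.star.coeFn_toLp] with ζ hζ
  rw [hζ]
  simp

/-- The poly-Bergman type space `𝒜²_L(D₂)`, `L = (j, k)`: all `f ∈ L²(D₂)` with
`(∂/∂ζ̄₁ - 2 i ζ₁ ∂/∂ζ̄₂)^j f = 0` and `(∂/∂ζ̄₂)^k f = 0`, in the sense of distributions.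
The formal transpose of `∂/∂ζ̄₁ - 2 i ζ₁ ∂/∂ζ̄₂` is its negative, and likewise for `∂/∂ζ̄₂`, so that
the signs `(-1)^j`, `(-1)^k` can be dropped.  (The system is elliptic, so its distributional
solutions are smooth functions.)  For `j = 0` or `k = 0` the space is zero. -/
def polyBergman (j k : ℕ) : Submodule ℂ L2Siegel where
  carrier := {f | ∀ φ : ℂ × ℂ → ℂ, IsTest φ →
    (∫ ζ in siegel, f ζ * (dOne^[j] φ) ζ = 0) ∧ (∫ ζ in siegel, f ζ * (dTwo^[k] φ) ζ = 0)}
  zero_mem' := by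
    intro φ h
    rw [(h.dOne_iterate j).integral_eq_inner, (h.dTwo_iterate k).integral_eq_inner]
    simp
  add_mem' := by
    intro f g hf hg φ h
    have h1 := hf φ h
    have h2 := hg φ h
    rw [(h.dOne_iterate j).integral_eq_inner, (h.dTwo_iterate k).integral_eq_inner] at *
    rw [inner_add_right, inner_add_right, h1.1, h1.2, h2.1, h2.2]
    simp
  smul_mem' := by
    intro c f hf φ h
    have h1 := hf φ h
    rw [(h.dOne_iterate j).integral_eq_inner, (h.dTwo_iterate k).integral_eq_inner] at *
    rw [inner_smul_right, inner_smul_right, h1.1, h1.2]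
    simp

theorem isClosed_polyBergman (j k : ℕ) : IsClosed (polyBergman j k : Set L2Siegel) := by
  have : (polyBergman j k : Set L2Siegel) = ⋂ (φ : ℂ × ℂ → ℂ) (h : IsTest φ),
      {f | inner ℂ ((h.dOne_iterate j).memLp.star.toLp (star (dOne^[j] φ))) f = 0 ∧
        inner ℂ ((h.dTwo_iterate k).memLp.star.toLp (star (dTwo^[k] φ))) f = 0} := by
    ext f
    simp only [mem_iInter]
    refine forall₂_congr fun φ h => ?_
    rw [(h.dOne_iterate j).integral_eq_inner, (h.dTwo_iterate k).integral_eq_inner]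
    rfl
  rw [this]
  refine isClosed_iInter fun φ => isClosed_iInter fun h => ?_
  exact (isClosed_eq (by fun_prop) continuous_const).inter
    (isClosed_eq (by fun_prop) continuous_const)

/-- The true-poly-Bergman type space
`𝒜²_(L)(D₂) = 𝒜²_L(D₂) ⊖ (𝒜²_{L-e₁}(D₂) + 𝒜²_{L-e₂}(D₂))`, for `L = (j, k)` with `j, k ≥ 1`. -/
def truePolyBergman (j k : ℕ) : Submodule ℂ L2Siegel :=
  polyBergman j k ⊓ (polyBergman (j - 1) k ⊔ polyBergman j (k - 1))ᗮ

instance (j k : ℕ) : CompleteSpace (truePolyBergman j k) :=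
  ((isClosed_polyBergman j k).inter (Submodule.isClosed_orthogonal _)).completeSpace_coe

/-- `𝒜²_(L)(D₂)` as a Hilbert space, with the norm and inner product of `L²(D₂)`. -/
def TrueSpace (j k : ℕ) : Type := truePolyBergman j k

instance (j k : ℕ) : NormedAddCommGroup (TrueSpace j k) :=
  inferInstanceAs (NormedAddCommGroup (truePolyBergman j k))

instance (j k : ℕ) : InnerProductSpace ℂ (TrueSpace j k) :=
  inferInstanceAs (InnerProductSpace ℂ (truePolyBergman j k))

instance (j k : ℕ) : CompleteSpace (TrueSpace j k) :=
  inferInstanceAs (CompleteSpace (truePolyBergman j k))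

/-- The inclusion of `𝒜²_(L)(D₂)` in `L²(D₂)`. -/
def incl (j k : ℕ) : TrueSpace j k →L[ℂ] L2Siegel := (truePolyBergman j k).subtypeL

/-- The orthogonal projection `B_(L)` of `L²(D₂)` onto `𝒜²_(L)(D₂)`. -/
def proj (j k : ℕ) : L2Siegel →L[ℂ] TrueSpace j k :=
  (truePolyBergman j k).orthogonalProjectionOnto

/-! ### Symbols and Toeplitz operators -/

/-- `L^∞(ℝ₊)`. -/
abbrev LInfty : Type := Lp ℂ ∞ (volume.restrict (Ioi (0 : ℝ)))

/-- `b` has the limit values `b₀` at `0` and `bInf` at `+∞` (up to null sets, as `b` is an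
equivalence class of functions). -/
def HasEndLimits (b : LInfty) (b₀ bInf : ℂ) : Prop :=
  Tendsto b (𝓝[>] (0 : ℝ) ⊓ ae volume) (𝓝 b₀) ∧ Tendsto b (atTop ⊓ ae volume) (𝓝 bInf)

/-- The space `L^∞_{0,+∞}(ℝ₊)` of all `b ∈ L^∞(ℝ₊)` having limit values at `0` and `+∞`. -/
def endLimitSymbols : Set LInfty := {b | ∃ b₀ bInf : ℂ, HasEndLimits b b₀ bInf}

theorem measurable_height : Measurable height := by
  unfold height
  fun_prop

/-- Null sets of `ℝ₊` pull back to null sets of `D₂` under the height function. -/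
theorem quasiMeasurePreserving_height :
    Measure.QuasiMeasurePreserving height siegelMeasure (volume.restrict (Ioi (0 : ℝ))) := by
  have him : Measure.QuasiMeasurePreserving Complex.im volume volume :=
    Measure.quasiMeasurePreserving_snd.comp
      Complex.volume_preserving_equiv_real_prod.quasiMeasurePreserving
  have hmain : Measure.QuasiMeasurePreserving height volume volume := by
    refine ⟨measurable_height, ?_⟩
    refine Measure.AbsolutelyContinuous.mk fun s hs h0 => ?_
    rw [Measure.map_apply measurable_height hs, Measure.volume_eq_prod,
      Measure.measure_prod_null (measurable_height hs)]
    refine Eventually.of_forall fun z => ?_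
    have hz : Measure.QuasiMeasurePreserving (fun w : ℂ => w.im - ‖z‖ ^ 2) volume volume :=
      (measurePreserving_sub_right volume (‖z‖ ^ 2)).quasiMeasurePreserving.comp him
    exact hz.preimage_null h0
  refine ⟨measurable_height, ?_⟩
  refine Measure.AbsolutelyContinuous.mk fun s hs h0 => ?_
  rw [Measure.restrict_apply hs] at h0
  rw [Measure.map_apply measurable_height hs, Measure.restrict_apply (measurable_height hs)]
  exact hmain.preimage_null h0

/-- `b(Im ζ₂ - |ζ₁|²)` is a bounded measurable function on `D₂`. -/
theorem memLp_comp_height (b : LInfty) : MemLp (b ∘ height) ∞ siegelMeasure := by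
  have hb := Lp.memLp b
  refine ⟨hb.1.comp_quasiMeasurePreserving quasiMeasurePreserving_height, ?_⟩
  have h2 := hb.2
  rw [eLpNorm_exponent_top] at h2 ⊢
  refine lt_of_le_of_lt ?_ h2
  refine eLpNormEssSup_le_of_ae_enorm_bound ?_
  exact quasiMeasurePreserving_height.tendsto_ae.eventually ae_le_eLpNormEssSup

/-- The nilpotent symbol `b(Im ζ₂ - |ζ₁|²)` as an element of `L^∞(D₂)`. -/
def nilpotentSymbol (b : LInfty) : Lp ℂ ∞ siegelMeasure := (memLp_comp_height b).toLp _

/-- The operator `f ↦ c f` of multiplication by `c ∈ L^∞(D₂)` on `L²(D₂)`. -/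
def mulOp (c : Lp ℂ ∞ siegelMeasure) : L2Siegel →L[ℂ] L2Siegel :=
  (ContinuousLinearMap.mul ℂ ℂ).holderL siegelMeasure ∞ 2 2 c

/-- The Toeplitz operator `T_b f = B_(L) (b(Im ζ₂ - |ζ₁|²) f)` on `𝒜²_(L)(D₂)`, `L = (j, k)`. -/
def toeplitz (j k : ℕ) (b : LInfty) : TrueSpace j k →L[ℂ] TrueSpace j k :=
  proj j k ∘L mulOp (nilpotentSymbol b) ∘L incl j k

/-- The C*-algebra generated by all `T_b`, `b ∈ L^∞_{0,+∞}(ℝ₊)`, in the bounded operators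
on `𝒜²_(L)(D₂)`. -/
def toeplitzAlgebra (j k : ℕ) : StarSubalgebra ℂ (TrueSpace j k →L[ℂ] TrueSpace j k) :=
  (StarAlgebra.adjoin ℂ (toeplitz j k '' endLimitSymbols)).topologicalClosure

theorem toeplitz_mem (j k : ℕ) {b : LInfty} (hb : b ∈ endLimitSymbols) :
    toeplitz j k b ∈ toeplitzAlgebra j k :=
  StarSubalgebra.le_topologicalClosure _
    (StarAlgebra.subset_adjoin ℂ _ (mem_image_of_mem _ hb))

/-! ### The spectral functions -/

/-- The Laguerre polynomial `L_m(y) = e^y / m! · d^m/dy^m (e^{-y} y^m)`. -/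
def laguerre (m : ℕ) (y : ℝ) : ℝ :=
  Real.exp y / (m.factorial : ℝ) * iteratedDeriv m (fun t : ℝ => Real.exp (-t) * t ^ m) y

/-- The Laguerre function `ℓ_m(y) = (-1)^m L_m(y) e^{-y/2}`. -/
def laguerreFun (m : ℕ) (y : ℝ) : ℝ := (-1) ^ m * laguerre m y * Real.exp (-y / 2)

/-- The spectral function `γ^b(x) = ∫_{ℝ₊} b(y / (2x)) ℓ_{k-1}(y)² dy`, for `x > 0`. -/
def spectralFun (k : ℕ) (b : LInfty) (x : ℝ) : ℂ :=
  ∫ y in Ioi (0 : ℝ), b (y / (2 * x)) * ((laguerreFun (k - 1) y ^ 2 : ℝ) : ℂ)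

/-- The C*-algebra generated by all spectral functions `γ^b`, `b ∈ L^∞_{0,+∞}(ℝ₊)`, in the bounded
continuous functions on `ℝ₊ = (0, +∞)`. -/
def spectralAlgebra (k : ℕ) : StarSubalgebra ℂ (Ioi (0 : ℝ) →ᵇ ℂ) :=
  (StarAlgebra.adjoin ℂ {f : Ioi (0 : ℝ) →ᵇ ℂ | ∃ b ∈ endLimitSymbols,
    ∀ x : Ioi (0 : ℝ), f x = spectralFun k b x}).topologicalClosure

end SiegelToeplitz

end

open SiegelToeplitz

/-!
The proof diagonalizes the Toeplitz operators. In the coordinates `ζ = (z, u + i (v + |z|²))` the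
domain `D₂` becomes `ℂ × ℝ × ℝ₊`, the height becomes `v`, and the two differential operators do
not depend on `u`. The Fourier transform in `u`, with frequency `ξ` and `c = 2πξ`, therefore splits
`L²(D₂)` over `ξ` (`siegelFourier`). Up to constants the defining equations become
`(∂/∂z̄ + c z)^j F = 0` and `(d/dv + c)^k F = 0` on almost every fibre `ℂ × ℝ₊`
(`mem_polyBergman_iff`). The weak solutions of the second equation in `L²(ℝ₊)` are the polynomials
of degree less than `k` times `e^{-cv}` (`exists_polynomial_of_weak`), so they vanish for `ξ ≤ 0`,
and for `ξ > 0` the rescaled Laguerre functions of orders `0, …, k - 1` are an orthonormal basis of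
the solution space. Orthogonality to `𝒜²_{j,k-1}` leaves only the last of them: the transform of a
function of the true-poly-Bergman type space has the form `a(ξ, z) e_ξ(v)`, with
`e_ξ(v) = √(2c) ℓ_{k-1}(2cv)` (`laguerreKernel`, `siegelFourier_eq_laguerreProj`).

The symbol `b(v)` does not involve `ξ`, so on such functions it has the same matrix elements as
multiplication by `∫ b(v) e_ξ(v)² dv = γ^b(2πξ)`. Multiplication by functions of `2πξ` preserves
the true-poly-Bergman type space and defines a representation `multiplierRep` of `C[0, +∞]` on it,
and `T_b` is the image of the extension of `γ^b` (`toeplitz_eq_multiplierRep`). This representation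
is faithful (`multiplierRep_injective`), because for `0 < s < t` the packet
`1_(s,t)(ξ) z̄^{j-1} e^{-c|z|²} e_ξ(v)` is the transform of an element of the space
(`siegelFourier_symm_packet_mem`). An injective *-homomorphism of C*-algebras is isometric, so the
algebra generated by the `T_b` is the isometric image of the one generated by the `γ^b`
(`exists_starAlgEquiv_of_injective`).

The functions `γ^b` extend continuously to `[0, +∞]` by dominated convergence
(`exists_extension_of_hasEndLimits`). For `b = 1_(0,1)` the function `γ^b` is strictly increasing
from `0` to `1`, so it separates points, and by the Stone–Weierstrass theorem the `γ^b` generate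
`C[0, +∞]` (`adjoin_extendedSpectralFunctions`).
-/

/-! ### Laguerre polynomials -/

/-- The operator `q ↦ q' - q`, which is differentiation conjugated by `e^{-y}`. -/
noncomputable def expDeriv (q : Polynomial ℝ) : Polynomial ℝ := Polynomial.derivative q - q

/-- The polynomial `(-1)^m L_m`. -/
noncomputable def laguerrePoly (m : ℕ) : Polynomial ℝ :=
  Polynomial.C ((-1) ^ m / (m.factorial : ℝ)) * expDeriv^[m] (Polynomial.X ^ m)

theorem hasDerivAt_exp_neg_mul_eval (q : Polynomial ℝ) (t : ℝ) :
    HasDerivAt (fun t => Real.exp (-t) * q.eval t) (Real.exp (-t) * (expDeriv q).eval t) t := by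
  have h1 : HasDerivAt (fun t : ℝ => Real.exp (-t)) (Real.exp (-t) * (-1)) t :=
    (hasDerivAt_neg t).exp
  refine (h1.mul (q.hasDerivAt t)).congr_deriv ?_
  simp [expDeriv]
  ring

theorem iteratedDeriv_exp_neg_mul_eval (q : Polynomial ℝ) (m : ℕ) :
    iteratedDeriv m (fun t => Real.exp (-t) * q.eval t) =
      fun t => Real.exp (-t) * (expDeriv^[m] q).eval t := by
  induction m generalizing q with
  | zero => simp
  | succ m ih =>
    rw [iteratedDeriv_succ']
    have : deriv (fun t => Real.exp (-t) * q.eval t) =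
        fun t => Real.exp (-t) * (expDeriv q).eval t :=
      funext fun t => (hasDerivAt_exp_neg_mul_eval q t).deriv
    rw [this, ih, Function.iterate_succ_apply]

theorem laguerreFun_eq (m : ℕ) (y : ℝ) :
    laguerreFun m y = (laguerrePoly m).eval y * Real.exp (-y / 2) := by
  have h := congrFun (iteratedDeriv_exp_neg_mul_eval (Polynomial.X ^ m) m) y
  simp only [Polynomial.eval_pow, Polynomial.eval_X] at h
  rw [laguerreFun, laguerre, h, laguerrePoly]
  simp only [Polynomial.eval_mul, Polynomial.eval_C]
  have : Real.exp y * Real.exp (-y) = 1 := by rw [← Real.exp_add]; simp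
  linear_combination ((-1) ^ m / (m.factorial : ℝ) *
    (Polynomial.eval y (expDeriv^[m] (Polynomial.X ^ m))) * Real.exp (-y / 2)) * this

theorem laguerreFun_sq (m : ℕ) (y : ℝ) :
    laguerreFun m y ^ 2 = Real.exp (-y) * (laguerrePoly m * laguerrePoly m).eval y := by
  rw [laguerreFun_eq, mul_pow, ← Real.exp_nat_mul, Polynomial.eval_mul]
  push_cast
  rw [show (2 : ℝ) * (-y / 2) = -y by ring]
  ring

theorem continuous_laguerreFun (m : ℕ) : Continuous (laguerreFun m) := by
  rw [funext (laguerreFun_eq m)]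
  fun_prop

theorem integrableOn_exp_neg_mul_eval (q : Polynomial ℝ) :
    IntegrableOn (fun t => Real.exp (-t) * q.eval t) (Ioi 0) := by
  induction q using Polynomial.induction_on' with
  | add p q hp hq =>
    simpa only [Polynomial.eval_add, mul_add] using! hp.add hq
  | monomial n a =>
    have h := (Real.GammaIntegral_convergent (s := n + 1) (by positivity)).const_mul a
    refine IntegrableOn.congr_fun h (fun t ht => ?_) measurableSet_Ioi
    simp only [Polynomial.eval_monomial, add_sub_cancel_right, Real.rpow_natCast]
    ring

theorem tendsto_exp_neg_mul_eval (q : Polynomial ℝ) :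
    Tendsto (fun t => Real.exp (-t) * q.eval t) atTop (𝓝 0) := by
  refine (Polynomial.tendsto_div_exp_atTop q).congr fun t => ?_
  rw [Real.exp_neg]
  ring

/-- Integration by parts against the weight `e^{-y}`. -/
theorem integral_exp_neg_mul_expDeriv (p q : Polynomial ℝ) :
    ∫ t in Ioi (0 : ℝ), Real.exp (-t) * (p * expDeriv q).eval t =
      -(p.eval 0 * q.eval 0) -
        ∫ t in Ioi (0 : ℝ), Real.exp (-t) * (Polynomial.derivative p * q).eval t := by
  have h := integral_Ioi_of_hasDerivAt_of_tendsto' (a := (0 : ℝ))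
    (fun t _ => hasDerivAt_exp_neg_mul_eval (p * q) t) (integrableOn_exp_neg_mul_eval _)
    (tendsto_exp_neg_mul_eval (p * q))
  have e : expDeriv (p * q) = p * expDeriv q + Polynomial.derivative p * q := by
    simp only [expDeriv, Polynomial.derivative_mul]
    ring
  simp only [e, Polynomial.eval_add, mul_add] at h
  rw [integral_add (integrableOn_exp_neg_mul_eval _) (integrableOn_exp_neg_mul_eval _)] at h
  simp only [neg_zero, Real.exp_zero, one_mul, zero_sub, Polynomial.eval_mul] at h ⊢
  linarith

theorem X_pow_dvd_iterate_expDeriv (m i : ℕ) (hi : i ≤ m) :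
    (Polynomial.X : Polynomial ℝ) ^ (m - i) ∣ expDeriv^[i] (Polynomial.X ^ m) := by
  induction i with
  | zero => simp
  | succ i ih =>
    obtain ⟨r, hr⟩ := ih (by omega)
    rw [Function.iterate_succ_apply', hr, expDeriv]
    obtain ⟨n, hn⟩ : ∃ n, m - i = n + 1 := ⟨m - i - 1, by omega⟩
    rw [show m - (i + 1) = n by omega, hn, Polynomial.derivative_mul, Polynomial.derivative_X_pow]
    refine ⟨Polynomial.C ((n + 1 : ℕ) : ℝ) * r + Polynomial.X * Polynomial.derivative r
      - Polynomial.X * r, ?_⟩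
    simp only [Nat.add_sub_cancel]
    ring

theorem integral_exp_neg_mul_iterate_expDeriv (m i : ℕ) (hi : i ≤ m) (p : Polynomial ℝ) :
    ∫ t in Ioi (0 : ℝ), Real.exp (-t) * (p * expDeriv^[i] (Polynomial.X ^ m)).eval t =
      (-1) ^ i * ∫ t in Ioi (0 : ℝ), Real.exp (-t) *
        (Polynomial.derivative^[i] p * Polynomial.X ^ m).eval t := by
  induction i generalizing p with
  | zero => simp
  | succ i ih =>
    rw [Function.iterate_succ_apply', integral_exp_neg_mul_expDeriv, ih (by omega)]
    have h0 : (expDeriv^[i] ((Polynomial.X : Polynomial ℝ) ^ m)).eval 0 = 0 := by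
      obtain ⟨r, hr⟩ := X_pow_dvd_iterate_expDeriv m i (by omega)
      rw [hr]
      simp [show m - i ≠ 0 by omega]
    rw [h0, ← Function.iterate_succ_apply]
    ring

theorem natDegree_iterate_expDeriv_le (m i : ℕ) :
    (expDeriv^[i] ((Polynomial.X : Polynomial ℝ) ^ m)).natDegree ≤ m ∧
      (expDeriv^[i] ((Polynomial.X : Polynomial ℝ) ^ m)).coeff m = (-1) ^ i := by
  induction i with
  | zero => simp
  | succ i ih =>
    rw [Function.iterate_succ_apply']
    constructor
    · refine (Polynomial.natDegree_sub_le _ _).trans (max_le ?_ ih.1)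
      exact (Polynomial.natDegree_derivative_le _).trans (by omega)
    · rw [expDeriv, Polynomial.coeff_sub, ih.2, Polynomial.coeff_derivative,
        Polynomial.coeff_eq_zero_of_natDegree_lt (by omega)]
      ring

theorem natDegree_laguerrePoly_le (m : ℕ) : (laguerrePoly m).natDegree ≤ m :=
  (Polynomial.natDegree_C_mul_le _ _).trans (natDegree_iterate_expDeriv_le m m).1

theorem coeff_laguerrePoly (m : ℕ) : (laguerrePoly m).coeff m = 1 / (m.factorial : ℝ) := by
  rw [laguerrePoly, Polynomial.coeff_C_mul, (natDegree_iterate_expDeriv_le m m).2,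
    div_mul_eq_mul_div, ← mul_pow]
  simp

theorem laguerrePoly_ne_zero (m : ℕ) : laguerrePoly m ≠ 0 := by
  intro h
  have := coeff_laguerrePoly m
  rw [h, Polynomial.coeff_zero] at this
  have h2 : (1 : ℝ) / (m.factorial : ℝ) ≠ 0 := by positivity
  exact h2 this.symm

theorem integral_laguerrePoly_mul (m : ℕ) (p : Polynomial ℝ) :
    ∫ t in Ioi (0 : ℝ), Real.exp (-t) * (p * laguerrePoly m).eval t =
      1 / (m.factorial : ℝ) * ∫ t in Ioi (0 : ℝ), Real.exp (-t) *
        (Polynomial.derivative^[m] p * Polynomial.X ^ m).eval t := by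
  have h := integral_exp_neg_mul_iterate_expDeriv m m le_rfl p
  have e : ∀ t : ℝ, Real.exp (-t) * (p * laguerrePoly m).eval t = ((-1) ^ m / (m.factorial : ℝ)) *
      (Real.exp (-t) * (p * expDeriv^[m] (Polynomial.X ^ m)).eval t) := fun t => by
    simp only [laguerrePoly, Polynomial.eval_mul, Polynomial.eval_C]
    ring
  simp_rw [e]
  rw [integral_const_mul, h, ← mul_assoc, div_mul_eq_mul_div, ← mul_pow]
  simp

/-- Rodrigues' formula makes `L_m` orthogonal to all polynomials of lower degree. -/
theorem integral_laguerrePoly_mul_eq_zero (m : ℕ) (p : Polynomial ℝ) (hp : p.natDegree < m) :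
    ∫ t in Ioi (0 : ℝ), Real.exp (-t) * (p * laguerrePoly m).eval t = 0 := by
  rw [integral_laguerrePoly_mul, Polynomial.iterate_derivative_eq_zero hp]
  simp

theorem integral_laguerrePoly_sq (m : ℕ) :
    ∫ t in Ioi (0 : ℝ), Real.exp (-t) * (laguerrePoly m * laguerrePoly m).eval t = 1 := by
  have h : Polynomial.derivative^[m] (laguerrePoly m) = 1 := by
    ext i
    rw [Polynomial.coeff_iterate_derivative]
    rcases Nat.eq_zero_or_pos i with rfl | hi
    · simp [coeff_laguerrePoly, Nat.descFactorial_self, Nat.factorial_ne_zero]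
    · rw [Polynomial.coeff_eq_zero_of_natDegree_lt
        (lt_of_le_of_lt (natDegree_laguerrePoly_le m) (by omega)), Polynomial.coeff_one]
      simp [hi.ne']
  rw [integral_laguerrePoly_mul, h]
  have hG : ∫ t in Ioi (0 : ℝ), Real.exp (-t) * t ^ m = m.factorial := by
    rw [← Real.Gamma_nat_eq_factorial, Real.Gamma_eq_integral (by positivity)]
    refine setIntegral_congr_fun measurableSet_Ioi fun t _ => ?_
    simp
  simp only [one_mul, Polynomial.eval_pow, Polynomial.eval_X, hG]
  field_simp

theorem integrableOn_laguerreFun_sq (m : ℕ) :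
    IntegrableOn (fun y => laguerreFun m y ^ 2) (Ioi 0) := by
  simp_rw [laguerreFun_sq]
  exact integrableOn_exp_neg_mul_eval _

theorem integral_laguerreFun_sq (m : ℕ) : ∫ y in Ioi (0 : ℝ), laguerreFun m y ^ 2 = 1 := by
  simp_rw [laguerreFun_sq]
  exact integral_laguerrePoly_sq m

theorem exists_abs_eval_le_exp (q : Polynomial ℝ) {a : ℝ} (ha : 0 < a) :
    ∃ C, 0 ≤ C ∧ ∀ t, 0 ≤ t → |q.eval t| ≤ C * Real.exp (a * t) := by
  induction q using Polynomial.induction_on' with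
  | add p q hp hq =>
    obtain ⟨C, hC, h⟩ := hp
    obtain ⟨C', hC', h'⟩ := hq
    refine ⟨C + C', by positivity, fun t ht => ?_⟩
    rw [Polynomial.eval_add, add_mul]
    exact (abs_add_le _ _).trans (add_le_add (h t ht) (h' t ht))
  | monomial n c =>
    refine ⟨|c| * (n.factorial / a ^ n), by positivity, fun t ht => ?_⟩
    have h := Real.pow_div_factorial_le_exp (a * t) (by positivity) n
    rw [div_le_iff₀ (by positivity), mul_pow] at h
    rw [Polynomial.eval_monomial, abs_mul, abs_of_nonneg (pow_nonneg ht n), mul_assoc]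
    refine mul_le_mul_of_nonneg_left ?_ (abs_nonneg c)
    rw [div_mul_eq_mul_div, le_div_iff₀ (by positivity)]
    linarith

theorem exists_abs_laguerreFun_le (m : ℕ) :
    ∃ C, 0 ≤ C ∧ ∀ t, 0 ≤ t → |laguerreFun m t| ≤ C * Real.exp (-t / 4) := by
  obtain ⟨C, hC, h⟩ := exists_abs_eval_le_exp (laguerrePoly m) (a := 1 / 4) (by norm_num)
  refine ⟨C, hC, fun t ht => ?_⟩
  rw [laguerreFun_eq, abs_mul, Real.abs_exp]
  calc |(laguerrePoly m).eval t| * Real.exp (-t / 2)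
      ≤ C * Real.exp (1 / 4 * t) * Real.exp (-t / 2) := by gcongr; exact h t ht
    _ = C * Real.exp (-t / 4) := by
      rw [mul_assoc, ← Real.exp_add]
      congr 2
      ring

/-! ### The spectral functions -/

/-- A limit modulo null sets is an honest limit off a suitable null set. -/
theorem exists_null_tendsto {l : Filter ℝ} {b : ℝ → ℂ} {c : ℂ}
    (h : Tendsto b (l ⊓ ae volume) (𝓝 c)) :
    ∃ N : Set ℝ, volume N = 0 ∧ Tendsto b (l ⊓ 𝓟 Nᶜ) (𝓝 c) := by
  have h1 : ∀ n : ℕ, ∃ s ∈ l, ∃ t ∈ ae volume, ∀ x ∈ s ∩ t, dist (b x) c < 1 / ((n : ℝ) + 1) := by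
    intro n
    have h2 : ∀ᶠ x in l ⊓ ae volume, dist (b x) c < 1 / ((n : ℝ) + 1) :=
      h (Metric.ball_mem_nhds c (by positivity))
    obtain ⟨s, hs, t, ht, hst⟩ := mem_inf_iff.1 h2
    exact ⟨s, hs, t, ht, fun x hx => (hst ▸ hx : x ∈ {x | dist (b x) c < 1 / ((n : ℝ) + 1)})⟩
  choose s hs t ht hst using h1
  refine ⟨⋃ n, (t n)ᶜ, measure_iUnion_null fun n => ht n, ?_⟩
  rw [Metric.tendsto_nhds]
  intro ε hε
  obtain ⟨n, hn⟩ := exists_nat_one_div_lt hε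
  rw [eventually_inf_principal]
  filter_upwards [hs n] with x hx hxN
  refine (hst n x ⟨hx, ?_⟩).trans hn
  by_contra hxt
  exact hxN (mem_iUnion.2 ⟨n, hxt⟩)

open Classical in
/-- A symbol with end limits has a bounded representative with honest limits. -/
theorem exists_repr_of_hasEndLimits {b : LInfty} {b₀ bInf : ℂ} (h : HasEndLimits b b₀ bInf) :
    ∃ b' : ℝ → ℂ, b' =ᵐ[volume.restrict (Ioi 0)] b ∧ Tendsto b' (𝓝[>] 0) (𝓝 b₀) ∧
      Tendsto b' atTop (𝓝 bInf) := by
  obtain ⟨N₁, h₁, ht₁⟩ := exists_null_tendsto h.1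
  obtain ⟨N₂, h₂, ht₂⟩ := exists_null_tendsto h.2
  have key : ∀ (l : Filter ℝ) (N M : Set ℝ) (c : ℂ) (d : ℝ → ℂ) [DecidablePred (· ∈ M)],
      Tendsto b (l ⊓ 𝓟 Nᶜ) (𝓝 c) →
      N ⊆ M → (∀ᶠ x in l, d x = c) →
      Tendsto (fun x => if x ∈ M then d x else b x) l (𝓝 c) := by
    intro l N M c d _ hb hNM hd
    refine Tendsto.if ?_ ?_
    · exact (tendsto_const_nhds.congr' (hd.mono fun x hx => hx.symm)).mono_left inf_le_left
    · refine hb.mono_left (inf_le_inf_left l (principal_mono.2 fun x hx hN => hx (hNM hN)))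
  refine ⟨fun x => if x ∈ N₁ ∪ N₂ then (if x < 1 then b₀ else bInf) else b x, ?_, ?_, ?_⟩
  · refine ae_restrict_of_ae ?_
    filter_upwards [measure_eq_zero_iff_ae_notMem.1 (measure_union_null h₁ h₂)] with x hx
    rw [if_neg hx]
  · refine key _ N₁ _ _ _ ht₁ subset_union_left ?_
    filter_upwards [nhdsWithin_le_nhds (Iio_mem_nhds (zero_lt_one (α := ℝ)))] with x hx
    exact if_pos hx
  · refine key _ N₂ _ _ _ ht₂ subset_union_right ?_
    filter_upwards [eventually_ge_atTop (1 : ℝ)] with x hx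
    exact if_neg (not_lt.2 hx)

theorem ae_norm_le_norm (b : LInfty) : ∀ᵐ y ∂(volume.restrict (Ioi (0 : ℝ))), ‖b y‖ ≤ ‖b‖ := by
  have h := ae_le_eLpNormEssSup (f := b) (μ := volume.restrict (Ioi (0 : ℝ)))
  filter_upwards [h] with y hy
  rw [Lp.norm_def, eLpNorm_exponent_top]
  have := ENNReal.toReal_mono
    (by simpa only [eLpNorm_exponent_top] using! (Lp.memLp b).2.ne) hy
  simpa using! this

theorem quasiMeasurePreserving_div {x : ℝ} (hx : 0 < x) :
    Measure.QuasiMeasurePreserving (fun y : ℝ => y / (2 * x)) (volume.restrict (Ioi 0))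
      (volume.restrict (Ioi 0)) := by
  refine ⟨by fun_prop, ?_⟩
  refine Measure.AbsolutelyContinuous.mk fun s hs h0 => ?_
  rw [Measure.restrict_apply hs] at h0
  rw [Measure.map_apply (by fun_prop) hs, Measure.restrict_apply (by measurability)]
  have e : (fun y : ℝ => y / (2 * x)) ⁻¹' s ∩ Ioi 0 = (fun y => y * (2 * x)⁻¹) ⁻¹' (s ∩ Ioi 0) := by
    ext y
    have : 0 < y * (2 * x)⁻¹ ↔ 0 < y := by
      rw [mul_pos_iff_of_pos_right (by positivity)]
    simp only [mem_inter_iff, mem_preimage, mem_Ioi, this, div_eq_mul_inv]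
  rw [e, Real.volume_preimage_mul_right (by positivity), h0, mul_zero]

section

variable (k : ℕ) (b : LInfty)

theorem integrableOn_spectralFun {x : ℝ} (hx : 0 < x) : IntegrableOn
    (fun y : ℝ => b (y / (2 * x)) * ((laguerreFun (k - 1) y ^ 2 : ℝ) : ℂ)) (Ioi 0) := by
  have hq := quasiMeasurePreserving_div hx
  refine Integrable.bdd_mul (c := ‖b‖) (integrableOn_laguerreFun_sq (k - 1)).ofReal
    ((Lp.aestronglyMeasurable b).comp_quasiMeasurePreserving hq) ?_
  exact hq.ae (ae_norm_le_norm b)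

theorem spectralFun_eq_of_ae_eq {b' : ℝ → ℂ} (hb : b' =ᵐ[volume.restrict (Ioi 0)] b) {x : ℝ}
    (hx : 0 < x) : spectralFun k b x =
      ∫ y in Ioi (0 : ℝ), b' (y / (2 * x)) * ((laguerreFun (k - 1) y ^ 2 : ℝ) : ℂ) := by
  refine integral_congr_ae ?_
  filter_upwards [(quasiMeasurePreserving_div hx).ae hb] with y hy
  rw [hy]

theorem spectralFun_eq_integral_mul {x : ℝ} (hx : 0 < x) : spectralFun k b x =
    ∫ v in Ioi (0 : ℝ), b v * ((2 * x * laguerreFun (k - 1) (2 * x * v) ^ 2 : ℝ) : ℂ) := by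
  have h := integral_comp_mul_left_Ioi
    (fun y => b (y / (2 * x)) * ((laguerreFun (k - 1) y ^ 2 : ℝ) : ℂ)) 0
    (show 0 < 2 * x by positivity)
  rw [mul_zero] at h
  have h2 : (2 * x) • (∫ v in Ioi (0 : ℝ), b (2 * x * v / (2 * x)) *
      ((laguerreFun (k - 1) (2 * x * v) ^ 2 : ℝ) : ℂ)) = spectralFun k b x := by
    rw [h, smul_inv_smul₀ (by positivity)]
    rfl
  rw [← h2, ← integral_smul]
  refine integral_congr_ae (Eventually.of_forall fun v => ?_)
  simp only [mul_div_cancel_left₀ v (show 2 * x ≠ 0 by positivity), Complex.real_smul]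
  push_cast
  ring

theorem continuousOn_spectralFun : ContinuousOn (spectralFun k b) (Ioi 0) := by
  have h : EqOn (spectralFun k b) (fun x => ∫ v in Ioi (0 : ℝ),
      b v * ((2 * x * laguerreFun (k - 1) (2 * x * v) ^ 2 : ℝ) : ℂ)) (Ioi 0) :=
    fun x hx => spectralFun_eq_integral_mul k b hx
  refine ContinuousOn.congr ?_ h
  intro x hx
  rw [mem_Ioi] at hx
  refine ContinuousAt.continuousWithinAt ?_
  obtain ⟨C, hC, hl⟩ := exists_abs_laguerreFun_le (k - 1)
  have hcont := continuous_laguerreFun (k - 1)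
  refine continuousAt_of_dominated (bound := fun v => ‖b‖ * (4 * x * (C ^ 2 * Real.exp (-(x / 2) * v))))
    (Eventually.of_forall fun y => ?_) ?_ ?_ (Eventually.of_forall fun v => ?_)
  · refine (Lp.aestronglyMeasurable b).mul (Continuous.aestronglyMeasurable ?_)
    fun_prop
  · have : Ioo (x / 2) (2 * x) ∈ 𝓝 x := Ioo_mem_nhds (by linarith) (by linarith)
    filter_upwards [this] with y hy
    filter_upwards [ae_norm_le_norm b, ae_restrict_mem measurableSet_Ioi] with v hv hv0
    rw [mem_Ioi] at hv0
    have hy0 : 0 < y := by linarith [hy.1]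
    have hl2 := hl (2 * y * v) (by positivity)
    rw [norm_mul, Complex.norm_real, Real.norm_eq_abs, abs_mul, abs_pow,
      abs_of_pos (show 0 < 2 * y by positivity)]
    have h3 : |laguerreFun (k - 1) (2 * y * v)| ^ 2 ≤ C ^ 2 * Real.exp (-(x / 2) * v) := by
      calc |laguerreFun (k - 1) (2 * y * v)| ^ 2 ≤ (C * Real.exp (-(2 * y * v) / 4)) ^ 2 := by
            gcongr
        _ = C ^ 2 * Real.exp (-y * v) := by
            rw [mul_pow, ← Real.exp_nat_mul]
            congr 2
            push_cast
            ring
        _ ≤ _ := by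
            gcongr
            exact hy.1.le
    have h4 : 2 * y ≤ 4 * x := by linarith [hy.2]
    gcongr
  · refine Integrable.const_mul (Integrable.const_mul (Integrable.const_mul ?_ _) _) _
    exact integrableOn_exp_mul_Ioi (by linarith) 0
  · fun_prop

end

theorem integral_laguerreFun_sq_mul_const (m : ℕ) (c : ℂ) :
    ∫ y in Ioi (0 : ℝ), c * ((laguerreFun m y ^ 2 : ℝ) : ℂ) = c := by
  rw [integral_const_mul, integral_complex_ofReal, integral_laguerreFun_sq]
  simp

theorem tendsto_spectralFun (k : ℕ) (b : LInfty) {b' : ℝ → ℂ} {c : ℂ} {l l' : Filter ℝ}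
    [l.IsCountablyGenerated] (hb : b' =ᵐ[volume.restrict (Ioi 0)] b) (hc : Tendsto b' l' (𝓝 c))
    (hpos : ∀ᶠ x in l, 0 < x) (hl : ∀ y > 0, Tendsto (fun x : ℝ => y / (2 * x)) l l') :
    Tendsto (spectralFun k b) l (𝓝 c) := by
  rw [← integral_laguerreFun_sq_mul_const (k - 1) c]
  have h : ∀ᶠ x in l, (∫ y in Ioi (0 : ℝ), b' (y / (2 * x)) *
      ((laguerreFun (k - 1) y ^ 2 : ℝ) : ℂ)) = spectralFun k b x := by
    filter_upwards [hpos] with x hx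
    rw [spectralFun_eq_of_ae_eq k b hb hx]
  refine Tendsto.congr' h ?_
  have hcont := continuous_laguerreFun (k - 1)
  refine tendsto_integral_filter_of_dominated_convergence
    (fun y => ‖b‖ * laguerreFun (k - 1) y ^ 2) ?_ ?_
    ((integrableOn_laguerreFun_sq (k - 1)).const_mul _) ?_
  · filter_upwards [hpos] with x hx
    refine (((Lp.aestronglyMeasurable b).congr hb.symm).comp_quasiMeasurePreserving
      (quasiMeasurePreserving_div hx)).mul (Continuous.aestronglyMeasurable ?_)
    fun_prop
  · filter_upwards [hpos] with x hx
    filter_upwards [(quasiMeasurePreserving_div hx).ae hb,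
      (quasiMeasurePreserving_div hx).ae (ae_norm_le_norm b)] with y hy hy2
    rw [norm_mul, Complex.norm_real, Real.norm_eq_abs, abs_of_nonneg (sq_nonneg _), hy]
    gcongr
  · filter_upwards [ae_restrict_mem measurableSet_Ioi] with y hy
    exact (hc.comp (hl y hy)).mul tendsto_const_nhds

theorem exists_continuousMap_ennreal {γ : ℝ → ℂ} {c d : ℂ} (hγ : ContinuousOn γ (Ioi 0))
    (h0 : Tendsto γ (𝓝[>] 0) (𝓝 c)) (hT : Tendsto γ atTop (𝓝 d)) :
    ∃ g : C(ℝ≥0∞, ℂ), (∀ x : ℝ, 0 < x → g (ENNReal.ofReal x) = γ x) ∧ g 0 = c ∧ g ⊤ = d := by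
  classical
  refine ⟨⟨Function.update (Function.update (fun t : ℝ≥0∞ => γ t.toReal) 0 c) ⊤ d, ?_⟩, ?_, ?_, ?_⟩
  · rw [continuous_iff_continuousAt]
    intro t
    by_cases ht : t = ⊤
    · subst ht
      rw [continuousAt_update_same]
      have h1 : Tendsto (fun t : ℝ≥0∞ => γ t.toReal) (𝓝[≠] ⊤) (𝓝 d) := by
        refine hT.comp (tendsto_atTop.2 fun M => ?_)
        have : Ioi (ENNReal.ofReal M) ∈ 𝓝 (⊤ : ℝ≥0∞) := Ioi_mem_nhds ENNReal.ofReal_lt_top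
        filter_upwards [nhdsWithin_le_nhds this, self_mem_nhdsWithin] with s hs hs'
        exact (ENNReal.ofReal_le_iff_le_toReal hs').1 hs.le
      refine h1.congr' ?_
      have : Ioi (0 : ℝ≥0∞) ∈ 𝓝 (⊤ : ℝ≥0∞) := Ioi_mem_nhds (by simp)
      filter_upwards [nhdsWithin_le_nhds this] with s hs
      rw [Function.update_of_ne hs.ne']
    · refine (continuousAt_update_of_ne ht).2 ?_
      by_cases h : t = 0
      · subst h
        rw [continuousAt_update_same]
        refine h0.comp (tendsto_nhdsWithin_iff.2 ⟨?_, ?_⟩)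
        · exact (ENNReal.tendsto_toReal (by simp)).mono_left nhdsWithin_le_nhds
        · have : Iio (⊤ : ℝ≥0∞) ∈ 𝓝 (0 : ℝ≥0∞) := Iio_mem_nhds (by simp)
          filter_upwards [nhdsWithin_le_nhds this, self_mem_nhdsWithin] with s hs hs'
          exact ENNReal.toReal_pos hs' hs.ne
      · refine (continuousAt_update_of_ne h).2 ?_
        exact (hγ.continuousAt (Ioi_mem_nhds (ENNReal.toReal_pos h ht))).comp
          (ENNReal.tendsto_toReal ht)
  · intro x hx
    rw [ContinuousMap.coe_mk, Function.update_of_ne ENNReal.ofReal_ne_top,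
      Function.update_of_ne (by simpa using! hx), ENNReal.toReal_ofReal hx.le]
  · simp
  · simp

theorem exists_extension_of_hasEndLimits (k : ℕ) {b : LInfty} {b₀ bInf : ℂ}
    (h : HasEndLimits b b₀ bInf) :
    ∃ g : C(ℝ≥0∞, ℂ), (∀ x : ℝ, 0 < x → g (ENNReal.ofReal x) = spectralFun k b x) ∧
      g 0 = bInf ∧ g ⊤ = b₀ := by
  obtain ⟨b', hb, h0, hI⟩ := exists_repr_of_hasEndLimits h
  refine exists_continuousMap_ennreal (continuousOn_spectralFun k b)
    (tendsto_spectralFun k b hb hI self_mem_nhdsWithin fun y hy => ?_)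
    (tendsto_spectralFun k b hb h0 (eventually_gt_atTop 0) fun y hy => ?_)
  · have h1 : Tendsto (fun x : ℝ => x⁻¹) (𝓝[>] 0) atTop := tendsto_inv_nhdsGT_zero
    refine (h1.const_mul_atTop (show 0 < y / 2 by linarith)).congr fun x => ?_
    rw [div_mul_eq_div_div, div_eq_mul_inv (y / 2)]
  · refine tendsto_nhdsWithin_iff.2 ⟨?_, ?_⟩
    · exact tendsto_const_nhds.div_atTop (tendsto_id.const_mul_atTop (by norm_num))
    · filter_upwards [eventually_gt_atTop 0] with x hx
      have := hy.lt
      exact div_pos hy (by positivity)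

/-- The symbol `1_(0,1)`, whose spectral function is injective. -/
noncomputable def unitStep : LInfty :=
  MemLp.toLp (indicator (Iio (1 : ℝ)) fun _ => (1 : ℂ))
    ((memLp_top_const (1 : ℂ)).indicator measurableSet_Iio)

theorem hasEndLimits_unitStep : HasEndLimits unitStep 1 0 := by
  have h0 : unitStep =ᵐ[volume.restrict (Ioi 0)] indicator (Iio (1 : ℝ)) fun _ => (1 : ℂ) :=
    MemLp.coeFn_toLp _
  have h : ∀ᵐ y : ℝ, 0 < y → unitStep y = indicator (Iio (1 : ℝ)) (fun _ => (1 : ℂ)) y :=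
    (ae_restrict_iff' measurableSet_Ioi).1 h0
  constructor
  · refine tendsto_const_nhds.congr' (EventuallyEq.symm ?_)
    have h1 : ∀ᶠ y in 𝓝[>] (0 : ℝ) ⊓ ae volume, y < 1 :=
      Filter.Eventually.filter_mono (inf_le_left.trans nhdsWithin_le_nhds)
        (Iio_mem_nhds zero_lt_one)
    have h2 : ∀ᶠ y in 𝓝[>] (0 : ℝ) ⊓ ae volume, 0 < y :=
      Filter.Eventually.filter_mono inf_le_left self_mem_nhdsWithin
    filter_upwards [h1, h2, Filter.Eventually.filter_mono inf_le_right h] with y h1 h2 h3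
    rw [h3 h2, indicator_of_mem (show y ∈ Iio 1 from h1)]
  · refine tendsto_const_nhds.congr' (EventuallyEq.symm ?_)
    have h1 : ∀ᶠ y in (atTop : Filter ℝ) ⊓ ae volume, 1 ≤ y :=
      Filter.Eventually.filter_mono inf_le_left (eventually_ge_atTop 1)
    filter_upwards [h1, Filter.Eventually.filter_mono inf_le_right h] with y h1 h3
    rw [h3 (by linarith), indicator_of_notMem (by simpa using! h1)]

theorem spectralFun_unitStep (k : ℕ) {x : ℝ} (hx : 0 < x) :
    spectralFun k unitStep x = ((∫ y in (0 : ℝ)..(2 * x), laguerreFun (k - 1) y ^ 2 : ℝ) : ℂ) := by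
  have h0 : indicator (Iio (1 : ℝ)) (fun _ => (1 : ℂ)) =ᵐ[volume.restrict (Ioi 0)] unitStep :=
    (MemLp.coeFn_toLp _).symm
  rw [spectralFun_eq_of_ae_eq k unitStep h0 hx,
    intervalIntegral.integral_of_le (by positivity), ← integral_complex_ofReal,
    integral_Ioc_eq_integral_Ioo, ← Ioi_inter_Iio, ← setIntegral_indicator measurableSet_Iio]
  refine integral_congr_ae (Eventually.of_forall fun y => ?_)
  have : y / (2 * x) ∈ Iio (1 : ℝ) ↔ y ∈ Iio (2 * x) := by
    rw [mem_Iio, mem_Iio, div_lt_one (by positivity)]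
  by_cases hy : y ∈ Iio (2 * x)
  · simp only [indicator_of_mem hy, indicator_of_mem (this.2 hy), one_mul]
  · simp only [indicator_of_notMem hy, indicator_of_notMem (mt this.1 hy), zero_mul]

theorem integral_laguerreFun_sq_pos (m : ℕ) {a b : ℝ} (hab : a < b) :
    0 < ∫ y in a..b, laguerreFun m y ^ 2 := by
  refine intervalIntegral.integral_pos hab ((continuous_laguerreFun m).pow 2).continuousOn
    (fun y _ => sq_nonneg _) ?_
  by_contra! h
  refine laguerrePoly_ne_zero m (Polynomial.eq_zero_of_infinite_isRoot _
    ((Icc_infinite hab).mono fun y hy => ?_))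
  have h1 : laguerreFun m y ^ 2 = 0 := le_antisymm (h y hy) (sq_nonneg _)
  rw [sq_eq_zero_iff, laguerreFun_eq, mul_eq_zero] at h1
  exact h1.resolve_right (Real.exp_ne_zero _)

/-- For `b = 1_(0,1)` the spectral function at `x` is the integral of `ℓ_{k-1}²` over `(0, 2x)`, which
is strictly increasing in `x`. -/
theorem unitStep_extension_injective (k : ℕ) {g : C(ℝ≥0∞, ℂ)}
    (hg : ∀ x : ℝ, 0 < x → g (ENNReal.ofReal x) = spectralFun k unitStep x)
    (h0 : g 0 = 0) (hT : g ⊤ = 1) : Function.Injective g := by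
  set F : ℝ → ℝ := fun x => ∫ y in (0 : ℝ)..(2 * x), laguerreFun (k - 1) y ^ 2 with hF
  have hint : ∀ a b : ℝ, IntervalIntegrable (fun y => laguerreFun (k - 1) y ^ 2) volume a b :=
    fun a b => ((continuous_laguerreFun (k - 1)).pow 2).intervalIntegrable a b
  have hmono : StrictMono F := by
    intro x y hxy
    have := integral_laguerreFun_sq_pos (k - 1) (show 2 * x < 2 * y by linarith)
    have h2 := intervalIntegral.integral_add_adjacent_intervals (hint 0 (2 * x))
      (hint (2 * x) (2 * y))
    simp only [hF]
    linarith
  have hF0 : F 0 = 0 := by simp [hF]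
  have hF1 : ∀ x, F x < 1 := by
    have hlim : Tendsto F atTop (𝓝 1) := by
      rw [← integral_laguerreFun_sq (k - 1)]
      exact intervalIntegral_tendsto_integral_Ioi 0 (integrableOn_laguerreFun_sq (k - 1))
        (tendsto_id.const_mul_atTop (by norm_num))
    intro x
    exact (hmono (lt_add_one x)).trans_le (hmono.monotone.ge_of_tendsto hlim _)
  have hval : ∀ t : ℝ≥0∞, t ≠ ⊤ → g t = (F t.toReal : ℂ) := by
    intro t ht
    by_cases h : t = 0
    · simp [h, h0, hF0]
    · have := hg t.toReal (ENNReal.toReal_pos h ht)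
      rw [ENNReal.ofReal_toReal ht, spectralFun_unitStep k (ENNReal.toReal_pos h ht)] at this
      exact this
  intro s t hst
  by_cases hs : s = ⊤ <;> by_cases ht : t = ⊤
  · rw [hs, ht]
  · rw [hs, hT, hval t ht] at hst
    exact absurd (Complex.ofReal_eq_one.1 hst.symm) (hF1 _).ne
  · rw [ht, hT, hval s hs] at hst
    exact absurd (Complex.ofReal_eq_one.1 hst) (hF1 _).ne
  · rw [hval s hs, hval t ht] at hst
    exact (ENNReal.toReal_eq_toReal_iff' hs ht).1 (hmono.injective (Complex.ofReal_injective hst))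

/-- The continuous extensions to `[0, +∞]` of the spectral functions. -/
def extendedSpectralFunctions (k : ℕ) : Set C(ℝ≥0∞, ℂ) :=
  {g | ∃ b ∈ endLimitSymbols, ∀ x : ℝ, 0 < x → g (ENNReal.ofReal x) = spectralFun k b x}

/-- By the Stone–Weierstrass theorem, the spectral functions generate `C[0, +∞]`. -/
theorem adjoin_extendedSpectralFunctions (k : ℕ) :
    (StarAlgebra.adjoin ℂ (extendedSpectralFunctions k)).topologicalClosure = ⊤ := by
  refine ContinuousMap.starSubalgebra_topologicalClosure_eq_top_of_separatesPoints _ ?_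
  obtain ⟨g, hg, h0, hT⟩ := exists_extension_of_hasEndLimits k hasEndLimits_unitStep
  intro s t hst
  refine ⟨g, ⟨g, StarAlgebra.subset_adjoin ℂ _ ⟨unitStep, ⟨_, _, hasEndLimits_unitStep⟩, hg⟩, rfl⟩,
    fun h => hst (unitStep_extension_injective k hg h0 hT h)⟩

/-! ### The algebra generated by the spectral functions -/

/-- An injective *-homomorphism of C*-algebras is isometric, so it identifies a C*-algebra
generated by `S` with the C*-algebra generated by the image of `S`. -/
theorem exists_starAlgEquiv_of_injective {A B : Type*} [CStarAlgebra A] [CStarAlgebra B]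
    (ρ : A →⋆ₐ[ℂ] B) (hρ : Function.Injective ρ) (S : Set A)
    (hS : (StarAlgebra.adjoin ℂ S).topologicalClosure = ⊤) (T : StarSubalgebra ℂ B)
    (hT : T = (StarAlgebra.adjoin ℂ (ρ '' S)).topologicalClosure) :
    ∃ Φ : T ≃⋆ₐ[ℂ] A, (∀ t, ‖Φ t‖ = ‖(t : B)‖) ∧ ∀ t, ρ (Φ t) = t := by
  have hiso : Isometry ρ := NonUnitalStarAlgHom.isometry ρ hρ
  have hrange : T = ρ.range := by
    apply le_antisymm
    · rw [hT]
      refine StarSubalgebra.topologicalClosure_minimal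
        (StarAlgebra.adjoin_le ?_) ?_
      · rintro _ ⟨a, -, rfl⟩
        exact ⟨a, rfl⟩
      · have := hiso.isClosedEmbedding.isClosed_range
        simpa using! this
    · have h1 : (⊤ : StarSubalgebra ℂ A) ≤ T.comap ρ := by
        rw [← hS]
        refine StarSubalgebra.topologicalClosure_minimal (StarAlgebra.adjoin_le ?_) ?_
        · intro a ha
          change ρ a ∈ T
          rw [hT]
          exact StarSubalgebra.le_topologicalClosure _
            (StarAlgebra.subset_adjoin ℂ _ (mem_image_of_mem _ ha))
        · have : IsClosed (T : Set B) := by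
            rw [hT]; exact StarSubalgebra.isClosed_topologicalClosure _
          exact this.preimage hiso.continuous
      rintro _ ⟨a, rfl⟩
      exact h1 (show a ∈ ⊤ from trivial)
  subst hrange
  let e := StarAlgEquiv.ofInjective ρ hρ
  have he : ∀ t : ρ.range, ρ (e.symm t) = t := fun t => by
    conv_rhs => rw [← e.apply_symm_apply t]
    rfl
  refine ⟨e.symm, fun t => ?_, he⟩
  rw [← he t, hiso.norm_map_of_map_zero (map_zero ρ)]

/-- Restriction of functions from `[0, +∞]` to `(0, +∞)`. -/
noncomputable def restrictIoi : C(ℝ≥0∞, ℂ) →⋆ₐ[ℂ] (Ioi (0 : ℝ) →ᵇ ℂ) where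
  toFun g := (BoundedContinuousFunction.mkOfCompact g).compContinuous
    ⟨fun x : Ioi (0 : ℝ) => ENNReal.ofReal x, ENNReal.continuous_ofReal.comp continuous_subtype_val⟩
  map_one' := rfl
  map_mul' _ _ := rfl
  map_zero' := rfl
  map_add' _ _ := rfl
  commutes' _ := rfl
  map_star' _ := rfl

theorem restrictIoi_apply (g : C(ℝ≥0∞, ℂ)) (x : Ioi (0 : ℝ)) :
    restrictIoi g x = g (ENNReal.ofReal x) := rfl

theorem eq_of_eqOn_ofReal {g h : C(ℝ≥0∞, ℂ)}
    (H : ∀ x : ℝ, 0 < x → g (ENNReal.ofReal x) = h (ENNReal.ofReal x)) : g = h := by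
  have hd : Dense (({0} : Set ℝ≥0∞)ᶜ ∩ {⊤}ᶜ) :=
    (dense_compl_singleton 0).inter_of_isOpen_right (dense_compl_singleton ⊤)
      isOpen_compl_singleton
  refine DFunLike.coe_injective (g.continuous.ext_on hd h.continuous ?_)
  rintro t ⟨h0, hT⟩
  have := H t.toReal (ENNReal.toReal_pos h0 hT)
  rwa [ENNReal.ofReal_toReal hT] at this

theorem restrictIoi_injective : Function.Injective restrictIoi := by
  intro g h hgh
  exact eq_of_eqOn_ofReal fun x hx => DFunLike.congr_fun hgh (⟨x, hx⟩ : Ioi (0 : ℝ))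

theorem exists_starAlgEquiv_spectralAlgebra (k : ℕ) :
    ∃ Ψ : spectralAlgebra k ≃⋆ₐ[ℂ] C(ℝ≥0∞, ℂ),
      (∀ f, ‖Ψ f‖ = ‖(f : Ioi (0 : ℝ) →ᵇ ℂ)‖) ∧
      ∀ f, ∀ x : Ioi (0 : ℝ), Ψ f (ENNReal.ofReal x) = (f : Ioi (0 : ℝ) →ᵇ ℂ) x := by
  obtain ⟨Ψ, h1, h2⟩ := exists_starAlgEquiv_of_injective restrictIoi restrictIoi_injective
    (extendedSpectralFunctions k) (adjoin_extendedSpectralFunctions k) (spectralAlgebra k) (by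
      rw [spectralAlgebra]
      congr 2
      ext f
      constructor
      · rintro ⟨b, hb, hf⟩
        have hb' := hb
        obtain ⟨b₀, bInf, hlim⟩ := hb'
        obtain ⟨g, hg, -, -⟩ := exists_extension_of_hasEndLimits k hlim
        refine ⟨g, ⟨b, hb, hg⟩, ?_⟩
        ext x
        rw [restrictIoi_apply, hg x x.2, hf]
      · rintro ⟨g, ⟨b, hb, hg⟩, rfl⟩
        exact ⟨b, hb, fun x => hg x x.2⟩)
  exact ⟨Ψ, h1, fun f x => by rw [← restrictIoi_apply, h2]⟩

/-! ### The Fourier transform in one variable -/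

section PartialFourier

open FourierTransform

theorem eLpNorm_two_rpow {α : Type*} [MeasurableSpace α] (μ : Measure α) (g : α → ℂ) :
    eLpNorm g 2 μ ^ (2 : ℝ) = ∫⁻ x, ‖g x‖ₑ ^ (2 : ℝ) ∂μ := by
  have := eLpNorm_nnreal_pow_eq_lintegral (f := g) (μ := μ) (p := 2) (by norm_num)
  simpa using! this

/-- On `L¹ ∩ L²` the Fourier transform of `L²` is given by the Fourier integral. -/
theorem fourier_toLp_ae_eq {g : ℝ → ℂ} (h1 : Integrable g) (h2 : MemLp g 2) :
    (𝓕 (h2.toLp g) : Lp ℂ 2 (volume : Measure ℝ)) =ᵐ[volume] 𝓕 g := by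
  have hG := Lp.memLp (𝓕 (h2.toLp g) : Lp ℂ 2 (volume : Measure ℝ))
  have hcont : Continuous (𝓕 g) := by
    exact VectorFourier.fourierIntegral_continuous Real.continuous_fourierChar
      (by exact continuous_inner) h1
  have hl1 := hG.locallyIntegrable (by norm_num)
  have hl2 : LocallyIntegrable (𝓕 g) volume := hcont.locallyIntegrable
  refine ae_eq_of_integral_contDiff_smul_eq hl1 hl2 fun h hs hc => ?_
  have hg₁ : HasCompactSupport (Complex.ofRealCLM ∘ h) := hc.comp_left rfl
  have hg₂ : ContDiff ℝ ∞ (Complex.ofRealCLM ∘ h) := by fun_prop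
  set φ : SchwartzMap ℝ ℂ := hg₁.toSchwartzMap hg₂ with hφ
  have hφx : ∀ x, φ x = (h x : ℂ) := fun x => rfl
  have e1 : ∫ x, φ x • (𝓕 (h2.toLp g) : Lp ℂ 2 (volume : Measure ℝ)) x =
      ∫ x, (𝓕 φ) x • (h2.toLp g) x := by
    rw [← Lp.toTemperedDistribution_apply, ← Lp.fourier_toTemperedDistribution_eq,
      TemperedDistribution.fourier_apply, Lp.toTemperedDistribution_apply]
  have e2 : ∫ x, (𝓕 φ) x • (h2.toLp g) x = ∫ x, (𝓕 φ) x • g x := by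
    refine integral_congr_ae ?_
    filter_upwards [h2.coeFn_toLp] with x hx
    rw [hx]
  have e3 : ∫ x, (𝓕 φ) x • g x = ∫ x, φ x • 𝓕 g x := by
    have := VectorFourier.integral_fourierIntegral_smul_eq_flip (L := innerₗ ℝ)
      (μ := volume) (ν := volume) (f := φ) (g := g) Real.continuous_fourierChar
      (by exact continuous_inner) φ.integrable h1
    rw [flip_innerₗ] at this
    exact this
  have := e1.trans (e2.trans e3)
  simpa only [hφx, Complex.coe_smul] using! this

theorem eLpNorm_fourier {g : ℝ → ℂ} (h1 : Integrable g) (h2 : MemLp g 2) :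
    eLpNorm (𝓕 g) 2 volume = eLpNorm g 2 volume := by
  rw [← eLpNorm_congr_ae (fourier_toLp_ae_eq h1 h2), ← eLpNorm_congr_ae h2.coeFn_toLp]
  have h := Lp.norm_fourier_eq (h2.toLp g)
  rw [Lp.norm_def, Lp.norm_def] at h
  exact (ENNReal.toReal_eq_toReal_iff' (Lp.eLpNorm_ne_top _) (Lp.eLpNorm_ne_top _)).1 h

variable {Y : Type*}

/-- The Fourier integral in the first variable. -/
noncomputable def partialFourierFun (f : ℝ × Y → ℂ) (p : ℝ × Y) : ℂ :=
  𝓕 (fun u => f (u, p.2)) p.1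

theorem partialFourierFun_const_smul (c : ℂ) (f : ℝ × Y → ℂ) :
    partialFourierFun (c • f) = c • partialFourierFun f := by
  funext p
  exact congrFun (VectorFourier.fourierIntegral_const_smul _ _ _ _ _) p.1

/-- The inverse Fourier integral in the first variable. -/
noncomputable def partialFourierInvFun (f : ℝ × Y → ℂ) (p : ℝ × Y) : ℂ :=
  𝓕⁻ (fun u => f (u, p.2)) p.1

theorem star_partialFourierFun_star (φ : ℝ × Y → ℂ) :
    star (partialFourierFun (star φ)) = partialFourierInvFun φ := by
  funext p
  simp only [partialFourierFun, partialFourierInvFun, Pi.star_apply, Real.fourier_eq',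
    Real.fourierInv_eq']
  change (starRingEnd ℂ) _ = _
  rw [← integral_conj]
  refine integral_congr_ae (Eventually.of_forall fun u => ?_)
  simp only [smul_eq_mul, map_mul, ← Complex.exp_conj, Complex.conj_I, Complex.conj_ofReal]
  rw [RCLike.star_def, Complex.conj_conj]
  congr 2
  push_cast
  ring

variable [MeasurableSpace Y]

theorem stronglyMeasurable_partialFourierFun {f : ℝ × Y → ℂ} (hf : StronglyMeasurable f) :
    StronglyMeasurable (partialFourierFun f) := by
  have h : partialFourierFun f = fun p : ℝ × Y =>
      ∫ u, Complex.exp (↑(-2 * Real.pi * inner ℝ u p.1) * Complex.I) * f (u, p.2) := by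
    funext p
    rw [partialFourierFun, Real.fourier_eq']
    rfl
  rw [h]
  refine StronglyMeasurable.integral_prod_right
    (f := fun (p : ℝ × Y) u => Complex.exp (↑(-2 * Real.pi * inner ℝ u p.1) * Complex.I) *
      f (u, p.2)) ?_
  refine StronglyMeasurable.mul ?_ (hf.comp_measurable (g := fun x : (ℝ × Y) × ℝ => (x.2, x.1.2)) (by fun_prop))
  refine Measurable.stronglyMeasurable ?_
  have : Continuous fun x : ℝ × ℝ =>
      Complex.exp (↑(-2 * Real.pi * inner ℝ x.2 x.1) * Complex.I) := by fun_prop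
  exact this.measurable.comp (f := fun x : (ℝ × Y) × ℝ => (x.1.1, x.2)) (by fun_prop)

variable {ν : Measure Y}

variable (ν) in
/-- The subspace `L¹ ∩ L²` of `L²(ℝ × Y)`. -/
noncomputable def integrableSubmodule : Submodule ℂ (Lp ℂ 2 ((volume : Measure ℝ).prod ν)) where
  carrier := {f | Integrable f ((volume : Measure ℝ).prod ν)}
  zero_mem' := (integrable_congr (Lp.coeFn_zero ℂ 2 _)).2 (integrable_zero _ _ _)
  add_mem' := fun {f g} hf hg => (integrable_congr (Lp.coeFn_add f g)).2 (hf.add hg)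
  smul_mem' := fun c f hf => (integrable_congr (Lp.coeFn_smul c f)).2 (hf.smul c)

variable (ν) in
theorem dense_integrableSubmodule :
    Dense (integrableSubmodule ν : Set (Lp ℂ 2 ((volume : Measure ℝ).prod ν))) := by
  refine (Lp.simpleFunc.dense (E := ℂ) (p := 2)
    (μ := (volume : Measure ℝ).prod ν) (by norm_num)).mono ?_
  intro f hf
  obtain ⟨s, hs⟩ := (Lp.simpleFunc.toSimpleFunc_eq_toFun ⟨f, hf⟩ : _) |>.symm |> fun h =>
    (⟨Lp.simpleFunc.toSimpleFunc ⟨f, hf⟩, h⟩ : ∃ s : SimpleFunc (ℝ × Y) ℂ,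
      f =ᵐ[(volume : Measure ℝ).prod ν] s)
  have h2 : MemLp s 2 ((volume : Measure ℝ).prod ν) := (memLp_congr_ae hs).1 (Lp.memLp f)
  exact (integrable_congr hs).2
    ((SimpleFunc.memLp_iff_integrable (by norm_num) (by norm_num)).1 h2)

variable [SFinite ν]

theorem ae_ae_swap {p : ℝ × Y → Prop} (h : ∀ᵐ z ∂((volume : Measure ℝ).prod ν), p z) :
    ∀ᵐ y ∂ν, ∀ᵐ u : ℝ, p (u, y) := by
  have h2 : ∀ᵐ z ∂(ν.prod (volume : Measure ℝ)), p z.swap :=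
    Measure.measurePreserving_swap.quasiMeasurePreserving.ae h
  exact Measure.ae_ae_of_ae_prod h2

theorem partialFourierFun_congr_ae {f g : ℝ × Y → ℂ}
    (h : f =ᵐ[(volume : Measure ℝ).prod ν] g) :
    partialFourierFun f =ᵐ[(volume : Measure ℝ).prod ν] partialFourierFun g := by
  have h2 : ∀ᵐ y ∂ν, ∀ ξ, partialFourierFun f (ξ, y) = partialFourierFun g (ξ, y) := by
    filter_upwards [ae_ae_swap h] with y hy ξ
    simp only [partialFourierFun, Real.fourier_eq']
    refine integral_congr_ae ?_
    filter_upwards [hy] with u hu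
    rw [hu]
  filter_upwards [Measure.quasiMeasurePreserving_snd.ae h2] with p hp
  exact hp p.1

theorem ae_memLp_slice {f : ℝ × Y → ℂ} (h : MemLp f 2 ((volume : Measure ℝ).prod ν)) :
    ∀ᵐ y ∂ν, MemLp (fun u => f (u, y)) 2 := by
  have hi := (memLp_two_iff_integrable_sq_norm h.1).1 h
  have hm : AEStronglyMeasurable (fun z : Y × ℝ => f z.swap) (ν.prod volume) :=
    h.1.prod_swap
  filter_upwards [hi.prod_left_ae, hm.prodMk_left] with y hy hy2
  exact (memLp_two_iff_integrable_sq_norm hy2).2 hy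

theorem eLpNorm_two_prod_symm {f : ℝ × Y → ℂ}
    (h : AEStronglyMeasurable f ((volume : Measure ℝ).prod ν)) :
    eLpNorm f 2 ((volume : Measure ℝ).prod ν) ^ (2 : ℝ) =
      ∫⁻ y, eLpNorm (fun u => f (u, y)) 2 volume ^ (2 : ℝ) ∂ν := by
  rw [eLpNorm_two_rpow, lintegral_prod_symm _ (h.enorm.pow_const _)]
  simp_rw [eLpNorm_two_rpow]

theorem eLpNorm_partialFourierFun {f : ℝ × Y → ℂ}
    (h1 : Integrable f ((volume : Measure ℝ).prod ν)) (h2 : MemLp f 2 ((volume : Measure ℝ).prod ν))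
    (hm : StronglyMeasurable f) :
    eLpNorm (partialFourierFun f) 2 ((volume : Measure ℝ).prod ν) =
      eLpNorm f 2 ((volume : Measure ℝ).prod ν) := by
  have h : eLpNorm (partialFourierFun f) 2 ((volume : Measure ℝ).prod ν) ^ (2 : ℝ) =
      eLpNorm f 2 ((volume : Measure ℝ).prod ν) ^ (2 : ℝ) := by
    rw [eLpNorm_two_prod_symm h2.1,
      eLpNorm_two_prod_symm (stronglyMeasurable_partialFourierFun hm).aestronglyMeasurable]
    refine lintegral_congr_ae ?_
    filter_upwards [h1.prod_left_ae, ae_memLp_slice h2] with y hy1 hy2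
    rw [← eLpNorm_fourier hy1 hy2]
    rfl
  exact ENNReal.rpow_left_injective (by norm_num) h

theorem memLp_partialFourierFun {f : ℝ × Y → ℂ}
    (h1 : Integrable f ((volume : Measure ℝ).prod ν)) (h2 : MemLp f 2 ((volume : Measure ℝ).prod ν)) :
    MemLp (partialFourierFun f) 2 ((volume : Measure ℝ).prod ν) ∧
      eLpNorm (partialFourierFun f) 2 ((volume : Measure ℝ).prod ν) =
        eLpNorm f 2 ((volume : Measure ℝ).prod ν) := by
  obtain ⟨g, hg, hfg⟩ := h1.1
  have e := partialFourierFun_congr_ae hfg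
  have e2 := eLpNorm_partialFourierFun ((integrable_congr hfg).1 h1) ((memLp_congr_ae hfg).1 h2) hg
  have e3 : eLpNorm (partialFourierFun f) 2 ((volume : Measure ℝ).prod ν) =
        eLpNorm f 2 ((volume : Measure ℝ).prod ν) := by
    rw [eLpNorm_congr_ae e, e2, eLpNorm_congr_ae hfg]
  refine ⟨⟨?_, e3 ▸ h2.2⟩, e3⟩
  exact (stronglyMeasurable_partialFourierFun hg).aestronglyMeasurable.congr e.symm

variable (ν)

theorem partialFourierFun_add_ae {f g : ℝ × Y → ℂ}
    (hf : Integrable f ((volume : Measure ℝ).prod ν))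
    (hg : Integrable g ((volume : Measure ℝ).prod ν)) :
    partialFourierFun (f + g) =ᵐ[(volume : Measure ℝ).prod ν]
      partialFourierFun f + partialFourierFun g := by
  have h2 : ∀ᵐ y ∂ν, ∀ ξ, partialFourierFun (f + g) (ξ, y) =
      partialFourierFun f (ξ, y) + partialFourierFun g (ξ, y) := by
    filter_upwards [hf.prod_left_ae, hg.prod_left_ae] with y hy hy2 ξ
    exact congrFun (VectorFourier.fourierIntegral_add Real.continuous_fourierChar
      (by exact continuous_inner) hy hy2) ξ
  filter_upwards [Measure.quasiMeasurePreserving_snd.ae h2] with p hp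
  exact hp p.1

/-- The partial Fourier transform on `L¹ ∩ L²`. -/
noncomputable def partialFourierAux :
    integrableSubmodule ν →ₗ[ℂ] Lp ℂ 2 ((volume : Measure ℝ).prod ν) where
  toFun f := (memLp_partialFourierFun f.2 (Lp.memLp f.1)).1.toLp _
  map_add' f g := by
    rw [← MemLp.toLp_add, MemLp.toLp_eq_toLp_iff]
    exact (partialFourierFun_congr_ae (Lp.coeFn_add f.1 g.1)).trans
      (partialFourierFun_add_ae ν f.2 g.2)
  map_smul' c f := by
    rw [RingHom.id_apply, ← MemLp.toLp_const_smul, MemLp.toLp_eq_toLp_iff,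
      ← partialFourierFun_const_smul]
    exact partialFourierFun_congr_ae (Lp.coeFn_smul c f.1)

theorem norm_partialFourierAux (f : integrableSubmodule ν) :
    ‖partialFourierAux ν f‖ = ‖f‖ := by
  change ‖(memLp_partialFourierFun f.2 (Lp.memLp f.1)).1.toLp _‖ = ‖f.1‖
  rw [Lp.norm_toLp, Lp.norm_def, (memLp_partialFourierFun f.2 (Lp.memLp f.1)).2]

/-- The extension of the partial Fourier transform to `L²` by continuity. -/
noncomputable def partialFourierCLM :
    Lp ℂ 2 ((volume : Measure ℝ).prod ν) →L[ℂ] Lp ℂ 2 ((volume : Measure ℝ).prod ν) :=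
  (partialFourierAux ν).extendOfNorm (integrableSubmodule ν).subtype

theorem partialFourierCLM_apply (f : integrableSubmodule ν) :
    partialFourierCLM ν f = partialFourierAux ν f := by
  refine LinearMap.extendOfNorm_eq (e := (integrableSubmodule ν).subtype) ?_
    ⟨1, fun f => ?_⟩ f
  · simpa [DenseRange] using! dense_integrableSubmodule ν
  · rw [norm_partialFourierAux, one_mul]
    rfl

theorem norm_partialFourierCLM (f : Lp ℂ 2 ((volume : Measure ℝ).prod ν)) :
    ‖partialFourierCLM ν f‖ = ‖f‖ := by
  refine (dense_integrableSubmodule ν).induction (P := fun f => ‖partialFourierCLM ν f‖ = ‖f‖)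
    (fun f hf => ?_) (isClosed_eq (by fun_prop) (by fun_prop)) f
  rw [partialFourierCLM_apply ν ⟨f, hf⟩, norm_partialFourierAux]
  rfl

theorem coeFn_partialFourierCLM {φ : ℝ × Y → ℂ} (h1 : Integrable φ ((volume : Measure ℝ).prod ν))
    (h2 : MemLp φ 2 ((volume : Measure ℝ).prod ν)) :
    partialFourierCLM ν (h2.toLp φ) =ᵐ[(volume : Measure ℝ).prod ν] partialFourierFun φ := by
  have hmem : h2.toLp φ ∈ integrableSubmodule ν := (integrable_congr h2.coeFn_toLp).2 h1
  rw [partialFourierCLM_apply ν ⟨_, hmem⟩]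
  exact (MemLp.coeFn_toLp (memLp_partialFourierFun hmem (Lp.memLp (h2.toLp φ))).1).trans
    (partialFourierFun_congr_ae h2.coeFn_toLp)

/-- The reflection `u ↦ -u` in the first variable. -/
noncomputable def reflectFst :
    Lp ℂ 2 ((volume : Measure ℝ).prod ν) →ₗᵢ[ℂ] Lp ℂ 2 ((volume : Measure ℝ).prod ν) :=
  Lp.compMeasurePreservingₗᵢ ℂ (Prod.map Neg.neg id)
    ((Measure.measurePreserving_neg volume).prod (MeasurePreserving.id ν))

theorem coeFn_reflectFst (f : Lp ℂ 2 ((volume : Measure ℝ).prod ν)) :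
    reflectFst ν f =ᵐ[(volume : Measure ℝ).prod ν] fun p => f (-p.1, p.2) :=
  Lp.coeFn_compMeasurePreserving f
    ((Measure.measurePreserving_neg volume).prod (MeasurePreserving.id ν))

theorem reflectFst_reflectFst (f : Lp ℂ 2 ((volume : Measure ℝ).prod ν)) :
    reflectFst ν (reflectFst ν f) = f := by
  refine Lp.ext ?_
  have h := ((Measure.measurePreserving_neg (volume : Measure ℝ)).prod
    (MeasurePreserving.id ν)).quasiMeasurePreserving.ae (coeFn_reflectFst ν f)
  filter_upwards [coeFn_reflectFst ν (reflectFst ν f), h] with p h1 h2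
  rw [h1]
  simpa using! h2

/-- The adjoint of the partial Fourier transform is the inverse transform: the transform followed by
a reflection of the first variable. -/
theorem inner_partialFourierCLM (f g : Lp ℂ 2 ((volume : Measure ℝ).prod ν)) :
    inner ℂ (partialFourierCLM ν f) g = inner ℂ f (reflectFst ν (partialFourierCLM ν g)) := by
  refine (dense_integrableSubmodule ν).induction (P := fun f => inner ℂ (partialFourierCLM ν f) g =
    inner ℂ f (reflectFst ν (partialFourierCLM ν g))) (fun f hf => ?_)
    (isClosed_eq (by fun_prop) (by fun_prop)) f
  refine (dense_integrableSubmodule ν).induction (P := fun g => inner ℂ (partialFourierCLM ν f) g =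
    inner ℂ f (reflectFst ν (partialFourierCLM ν g))) (fun g hg => ?_)
    (isClosed_eq (by fun_prop) (by
      have := (reflectFst ν).continuous
      fun_prop)) g
  have hf1 : Integrable f ((volume : Measure ℝ).prod ν) := hf
  have hg1 : Integrable g ((volume : Measure ℝ).prod ν) := hg
  have hF := coeFn_partialFourierCLM ν hf1 (Lp.memLp f)
  have hG := coeFn_partialFourierCLM ν hg1 (Lp.memLp g)
  rw [Lp.toLp_coeFn] at hF hG
  have hG2 := ((Measure.measurePreserving_neg (volume : Measure ℝ)).prod
    (MeasurePreserving.id ν)).quasiMeasurePreserving.ae hG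
  rw [L2.inner_def, L2.inner_def, integral_prod_symm _ (L2.integrable_inner (𝕜 := ℂ) _ _),
    integral_prod_symm _ (L2.integrable_inner (𝕜 := ℂ) _ _)]
  refine integral_congr_ae ?_
  filter_upwards [hf1.prod_left_ae, hg1.prod_left_ae, ae_ae_swap hF, ae_ae_swap hG2,
    ae_ae_swap (coeFn_reflectFst ν (partialFourierCLM ν g))] with y h1 h2 h3 h4 h5
  have key := VectorFourier.integral_sesq_fourierIntegral_eq_neg_flip (innerSL ℂ (E := ℂ))
    (L := innerₗ ℝ) (μ := volume) (ν := volume) Real.continuous_fourierChar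
    (by exact continuous_inner) h1 h2
  calc ∫ x, inner ℂ (partialFourierCLM ν f (x, y)) (g (x, y)) =
      ∫ ξ, innerSL ℂ (VectorFourier.fourierIntegral Real.fourierChar volume (innerₗ ℝ)
        (fun u => f (u, y)) ξ) (g (ξ, y)) := by
        refine integral_congr_ae ?_
        filter_upwards [h3] with x hx
        rw [hx]
        rfl
    _ = _ := key
    _ = _ := by
        refine integral_congr_ae ?_
        filter_upwards [h4, h5] with x hx hx2
        rw [hx2]
        simp only [Prod.map_apply, id_eq] at hx
        rw [hx]
        change inner ℂ (f (x, y)) _ = inner ℂ (f (x, y)) _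
        congr 1
        simp only [partialFourierFun, Real.fourier_eq, VectorFourier.fourierIntegral]
        simp

/-- The partial Fourier transform as a unitary operator of `L²(ℝ × Y)`. -/
noncomputable def partialFourier :
    Lp ℂ 2 ((volume : Measure ℝ).prod ν) ≃ₗᵢ[ℂ] Lp ℂ 2 ((volume : Measure ℝ).prod ν) :=
  LinearIsometryEquiv.ofSurjective
    ⟨(partialFourierCLM ν).toLinearMap, norm_partialFourierCLM ν⟩ (by
      -- the adjoint of `F` is `R F`, so that `R F F = 1`
      have h : ∀ g, reflectFst ν (partialFourierCLM ν (partialFourierCLM ν g)) = g := by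
        intro g
        refine ext_inner_left ℂ fun f => ?_
        rw [← inner_partialFourierCLM]
        exact LinearIsometry.inner_map_map
          ⟨(partialFourierCLM ν).toLinearMap, norm_partialFourierCLM ν⟩ f g
      intro g
      refine ⟨partialFourierCLM ν (reflectFst ν g), ?_⟩
      have := congrArg (reflectFst ν) (h (reflectFst ν g))
      rwa [reflectFst_reflectFst, reflectFst_reflectFst] at this)

theorem coeFn_partialFourier {φ : ℝ × Y → ℂ} (h1 : Integrable φ ((volume : Measure ℝ).prod ν))
    (h2 : MemLp φ 2 ((volume : Measure ℝ).prod ν)) :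
    partialFourier ν (h2.toLp φ) =ᵐ[(volume : Measure ℝ).prod ν] partialFourierFun φ :=
  coeFn_partialFourierCLM ν h1 h2

theorem memLp_partialFourierInvFun {φ : ℝ × Y → ℂ}
    (h1 : Integrable φ ((volume : Measure ℝ).prod ν))
    (h2 : MemLp φ 2 ((volume : Measure ℝ).prod ν)) :
    MemLp (partialFourierInvFun φ) 2 ((volume : Measure ℝ).prod ν) := by
  rw [← star_partialFourierFun_star]
  exact (memLp_partialFourierFun ((Complex.conjLIE.integrable_comp_iff).2 h1) h2.star).1.star

/-- Parseval's identity for the partial Fourier transform, in bilinear form. -/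
theorem integral_mul_eq_integral_partialFourier_mul
    (f : Lp ℂ 2 ((volume : Measure ℝ).prod ν)) {φ : ℝ × Y → ℂ}
    (h1 : Integrable φ ((volume : Measure ℝ).prod ν))
    (h2 : MemLp φ 2 ((volume : Measure ℝ).prod ν)) :
    ∫ p, f p * φ p ∂((volume : Measure ℝ).prod ν) =
      ∫ p, partialFourier ν f p * partialFourierInvFun φ p ∂((volume : Measure ℝ).prod ν) := by
  have h := (partialFourier ν).inner_map_map (h2.star.toLp (star φ)) f
  rw [L2.inner_def, L2.inner_def] at h
  have e1 : Integrable (star φ) ((volume : Measure ℝ).prod ν) :=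
    (Complex.conjLIE.integrable_comp_iff).2 h1
  calc _ = ∫ p, inner ℂ (h2.star.toLp (star φ) p) (f p) ∂((volume : Measure ℝ).prod ν) := by
        refine integral_congr_ae ?_
        filter_upwards [h2.star.coeFn_toLp] with p hp
        rw [hp]
        simp
    _ = _ := h.symm
    _ = _ := by
        refine integral_congr_ae ?_
        filter_upwards [coeFn_partialFourier ν e1 h2.star] with p hp
        rw [hp, ← star_partialFourierFun_star]
        simp

end PartialFourier

/-! ### Test functions and first-order operators -/

/-- Smooth functions with compact support contained in `U`. -/
structure IsTestOn {E : Type*} [NormedAddCommGroup E] [NormedSpace ℝ E] (U : Set E)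
    (φ : E → ℂ) : Prop where
  smooth : ContDiff ℝ ∞ φ
  compact : HasCompactSupport φ
  support : tsupport φ ⊆ U

section TestFunctions

variable {E : Type*} [NormedAddCommGroup E] [NormedSpace ℝ E] {U : Set E}

theorem IsTestOn.of_support_subset {φ ψ : E → ℂ} (h : IsTestOn U φ) (hs : ContDiff ℝ ∞ ψ)
    (hsub : Function.support ψ ⊆ tsupport φ) : IsTestOn U ψ := by
  have hsub' : tsupport ψ ⊆ tsupport φ := closure_minimal hsub (isClosed_tsupport φ)
  exact ⟨hs, h.compact.of_isClosed_subset (isClosed_tsupport _) hsub', hsub'.trans h.support⟩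

theorem IsTestOn.zero : IsTestOn U (0 : E → ℂ) :=
  ⟨contDiff_const, HasCompactSupport.zero, by simp [tsupport]⟩

theorem IsTestOn.add {φ ψ : E → ℂ} (h : IsTestOn U φ) (h' : IsTestOn U ψ) :
    IsTestOn U (φ + ψ) := by
  refine ⟨h.smooth.add h'.smooth, h.compact.add h'.compact, ?_⟩
  exact (tsupport_add φ ψ).trans (union_subset h.support h'.support)

theorem IsTestOn.mul_left {φ g : E → ℂ} (h : IsTestOn U φ) (hg : ContDiff ℝ ∞ g) :
    IsTestOn U (fun x => g x * φ x) :=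
  h.of_support_subset (hg.mul h.smooth)
    ((Function.support_mul_subset_right g φ).trans (subset_tsupport φ))

theorem IsTestOn.fderiv_apply {φ : E → ℂ} (h : IsTestOn U φ) (v : E) :
    IsTestOn U (fun x => fderiv ℝ φ x v) := by
  have hd : ContDiff ℝ ∞ (fderiv ℝ φ) := h.smooth.fderiv_right (by simp)
  refine h.of_support_subset (by fun_prop) ?_
  intro x hx
  refine support_fderiv_subset ℝ (f := φ) fun h0 => hx ?_
  simp [h0]

theorem IsTestOn.memLp [MeasurableSpace E] [BorelSpace E] [SecondCountableTopology E]
    {φ : E → ℂ} (h : IsTestOn U φ) (μ : Measure E) [IsFiniteMeasureOnCompacts μ] (p : ℝ≥0∞) :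
    MemLp φ p μ :=
  h.smooth.continuous.memLp_of_hasCompactSupport h.compact

theorem IsTestOn.integrable [MeasurableSpace E] [BorelSpace E] [SecondCountableTopology E]
    {φ : E → ℂ} (h : IsTestOn U φ) (μ : Measure E) [IsFiniteMeasureOnCompacts μ] :
    Integrable φ μ :=
  h.smooth.continuous.integrable_of_hasCompactSupport h.compact

theorem isTestOn_ofReal {g : E → ℝ} (hs : ContDiff ℝ ∞ g) (hc : HasCompactSupport g) (hsupp : tsupport g ⊆ U) :
    IsTestOn U (fun v => (g v : ℂ)) := by
  refine ⟨Complex.ofRealCLM.contDiff.comp hs, hc.comp_left Complex.ofReal_zero, ?_⟩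
  refine (closure_mono fun v hv => ?_).trans hsupp
  exact fun h0 => hv (by simp [h0])

end TestFunctions

/-- The coefficients of a first-order operator `a ∂_{e₁} + b ∂_{e₂} + m(y) ∂_u` on `ℝ × Y`, which is
invariant under translations of `u`. -/
structure FirstOrder (Y : Type*) [NormedAddCommGroup Y] [NormedSpace ℝ Y] where
  a : ℂ
  b : ℂ
  e₁ : Y
  e₂ : Y
  m : Y → ℂ
  smooth : ContDiff ℝ ∞ m

namespace FirstOrder

variable {Y : Type*} [NormedAddCommGroup Y] [NormedSpace ℝ Y] (D : FirstOrder Y)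

/-- The operator `a ∂_{e₁} + b ∂_{e₂} + m(y) ∂_u`. -/
noncomputable def total (φ : ℝ × Y → ℂ) (p : ℝ × Y) : ℂ :=
  D.a * fderiv ℝ φ p (0, D.e₁) + D.b * fderiv ℝ φ p (0, D.e₂) + D.m p.2 * fderiv ℝ φ p (1, 0)

/-- The operator `a ∂_{e₁} + b ∂_{e₂} - 2 π i ξ m(y)`, which is the action of the total operator on
the inverse Fourier transform in `u`. -/
noncomputable def fiber (ξ : ℝ) (φ : Y → ℂ) (y : Y) : ℂ :=
  D.a * fderiv ℝ φ y D.e₁ + D.b * fderiv ℝ φ y D.e₂ +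
    ξ * ((-(2 * Real.pi * Complex.I)) * (D.m y * φ y))

theorem isTestOn_total {U : Set (ℝ × Y)} {φ : ℝ × Y → ℂ} (h : IsTestOn U φ) :
    IsTestOn U (D.total φ) := by
  have hm : ContDiff ℝ ∞ (fun p : ℝ × Y => D.m p.2) := D.smooth.comp contDiff_snd
  exact (((h.fderiv_apply _).mul_left (g := fun _ => D.a) contDiff_const).add
    ((h.fderiv_apply _).mul_left (g := fun _ => D.b) contDiff_const)).add
    ((h.fderiv_apply _).mul_left hm)

theorem isTestOn_total_iterate {U : Set (ℝ × Y)} {φ : ℝ × Y → ℂ} (h : IsTestOn U φ) (n : ℕ) :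
    IsTestOn U (D.total^[n] φ) := by
  induction n with
  | zero => exact h
  | succ n ih =>
    rw [Function.iterate_succ_apply']
    exact D.isTestOn_total ih

theorem isTestOn_fiber {U : Set Y} {φ : Y → ℂ} (h : IsTestOn U φ) (ξ : ℝ) :
    IsTestOn U (D.fiber ξ φ) :=
  (((h.fderiv_apply _).mul_left (g := fun _ => D.a) contDiff_const).add
    ((h.fderiv_apply _).mul_left (g := fun _ => D.b) contDiff_const)).add
    (((h.mul_left D.smooth).mul_left contDiff_const).mul_left contDiff_const)

theorem isTestOn_fiber_iterate {U : Set Y} {φ : Y → ℂ} (h : IsTestOn U φ) (ξ : ℝ) (n : ℕ) :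
    IsTestOn U ((D.fiber ξ)^[n] φ) := by
  induction n with
  | zero => exact h
  | succ n ih =>
    rw [Function.iterate_succ_apply']
    exact D.isTestOn_fiber ih ξ

theorem fiber_const_mul (ξ : ℝ) (c : ℂ) {φ : Y → ℂ} (h : Differentiable ℝ φ) :
    D.fiber ξ (fun y => c * φ y) = fun y => c * D.fiber ξ φ y := by
  funext y
  have : fderiv ℝ (fun y => c * φ y) y = c • fderiv ℝ φ y := fderiv_const_mul (h y) c
  simp only [fiber, this, _root_.smul_apply, smul_eq_mul]
  ring

theorem fiber_iterate_const_mul {U : Set Y} (ξ : ℝ) (c : ℂ) {φ : Y → ℂ} (h : IsTestOn U φ) (n : ℕ) :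
    (D.fiber ξ)^[n] (fun y => c * φ y) = fun y => c * (D.fiber ξ)^[n] φ y := by
  induction n with
  | zero => rfl
  | succ n ih =>
    rw [Function.iterate_succ_apply', Function.iterate_succ_apply', ih]
    exact D.fiber_const_mul ξ c
      ((D.isTestOn_fiber_iterate h ξ n).smooth.differentiable (by simp))

/-- The iterated fibre operators depend polynomially on `ξ`. -/
theorem exists_fiber_iterate_eq_sum {U : Set Y} {φ : Y → ℂ} (h : IsTestOn U φ) (n : ℕ) :
    ∃ θ : ℕ → Y → ℂ, (∀ i, IsTestOn U (θ i)) ∧ (∀ i, n < i → θ i = 0) ∧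
      ∀ ξ : ℝ, (D.fiber ξ)^[n] φ = fun y => ∑ i ∈ Finset.range (n + 1), (ξ : ℂ) ^ i * θ i y := by
  induction n with
  | zero =>
    refine ⟨fun i => if i = 0 then φ else 0, fun i => ?_, fun i hi => ?_, fun ξ => ?_⟩
    · dsimp only
      split_ifs
      exacts [h, IsTestOn.zero]
    · exact if_neg hi.ne'
    · funext y
      simp
  | succ n ih =>
    obtain ⟨θ, hθ, hθ0, hsum⟩ := ih
    set A : (Y → ℂ) → Y → ℂ := D.fiber 0 with hA
    set B : (Y → ℂ) → Y → ℂ := fun φ y => (-(2 * Real.pi * Complex.I)) * (D.m y * φ y) with hB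
    have hAt : ∀ {ψ}, IsTestOn U ψ → IsTestOn U (A ψ) := fun h => D.isTestOn_fiber h 0
    have hBt : ∀ {ψ}, IsTestOn U ψ → IsTestOn U (B ψ) := fun h =>
      (h.mul_left D.smooth).mul_left contDiff_const
    have hB0 : B 0 = 0 := by
      funext y
      simp [hB]
    have hA0 : A 0 = 0 := by
      funext y
      simp [hA, fiber]
    refine ⟨fun i => A (θ i) + (if i = 0 then 0 else B (θ (i - 1))), fun i => ?_, fun i hi => ?_,
      fun ξ => ?_⟩
    · refine (hAt (hθ i)).add ?_
      split_ifs
      exacts [IsTestOn.zero, hBt (hθ _)]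
    · dsimp only
      rw [hθ0 i (by omega), hθ0 (i - 1) (by omega), hA0, hB0]
      simp
    · rw [Function.iterate_succ_apply', hsum ξ]
      funext y
      have hd : ∀ i, DifferentiableAt ℝ (fun y => (ξ : ℂ) ^ i * θ i y) y := fun i =>
        (((hθ i).smooth.differentiable (by simp)) y).const_mul _
      have h1 : ∀ v, fderiv ℝ (fun y => ∑ i ∈ Finset.range (n + 1), (ξ : ℂ) ^ i * θ i y) y v =
          ∑ i ∈ Finset.range (n + 1), (ξ : ℂ) ^ i * fderiv ℝ (θ i) y v := by
        intro v
        rw [fderiv_fun_sum fun i _ => hd i, _root_.sum_apply]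
        refine Finset.sum_congr rfl fun i _ => ?_
        rw [fderiv_const_mul ((hθ i).smooth.differentiable (by simp) y)]
        rfl
      have h2 : D.fiber ξ (fun y => ∑ i ∈ Finset.range (n + 1), (ξ : ℂ) ^ i * θ i y) y =
          ∑ i ∈ Finset.range (n + 1), (ξ : ℂ) ^ i * A (θ i) y +
          ∑ i ∈ Finset.range (n + 1), (ξ : ℂ) ^ (i + 1) * B (θ i) y := by
        simp only [fiber, h1, hA, hB, Complex.ofReal_zero, zero_mul, add_zero, Finset.mul_sum,
          ← Finset.sum_add_distrib]
        refine Finset.sum_congr rfl fun i _ => ?_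
        ring
      rw [h2]
      simp only [Pi.add_apply, mul_add, Finset.sum_add_distrib]
      congr 1
      · rw [Finset.sum_range_succ _ (n + 1), hθ0 (n + 1) (by omega), hA0]
        simp
      · rw [Finset.sum_range_succ' _ (n + 1)]
        simp

end FirstOrder

/-! ### Fourier transform of test functions in one variable -/

theorem partialFourierInvFun_eq {Y : Type*} (φ : ℝ × Y → ℂ) (ξ : ℝ) (y : Y) :
    partialFourierInvFun φ (ξ, y) =
      ∫ u : ℝ, Complex.exp (↑(2 * Real.pi * (ξ * u)) * Complex.I) * φ (u, y) := by
  rw [partialFourierInvFun, Real.fourierInv_eq']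
  simp

section Slices

variable {Y : Type*} [NormedAddCommGroup Y] [NormedSpace ℝ Y]

theorem compact_slice {Ω : Set Y} {φ : ℝ × Y → ℂ} (h : IsTestOn (univ ×ˢ Ω) φ) (y : Y) :
    HasCompactSupport (fun u => φ (u, y)) := by
  refine HasCompactSupport.intro (h.compact.isCompact.image continuous_fst) fun u hu => ?_
  exact image_eq_zero_of_notMem_tsupport fun h' => hu ⟨_, h', rfl⟩

theorem integrable_slice {Ω : Set Y} {φ : ℝ × Y → ℂ} (h : IsTestOn (univ ×ˢ Ω) φ) (ξ : ℝ) (y : Y) :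
    Integrable (fun u : ℝ => Complex.exp (↑(2 * Real.pi * (ξ * u)) * Complex.I) * φ (u, y)) := by
  have := h.smooth.continuous
  refine Continuous.integrable_of_hasCompactSupport (by fun_prop) ?_
  exact (compact_slice h y).mul_left

theorem fderiv_partialFourierInvFun {Ω : Set Y} {φ : ℝ × Y → ℂ} (h : IsTestOn (univ ×ˢ Ω) φ)
    (ξ : ℝ) (y v : Y) :
    fderiv ℝ (fun y => partialFourierInvFun φ (ξ, y)) y v =
      partialFourierInvFun (fun p => fderiv ℝ φ p (0, v)) (ξ, y) := by
  have hd : Differentiable ℝ φ := h.smooth.differentiable (by simp)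
  have hdc : Continuous (fderiv ℝ φ) := (h.smooth.fderiv_right (m := ∞) (by simp)).continuous
  have hc := h.smooth.continuous
  obtain ⟨C, hC⟩ := (h.compact.fderiv (𝕜 := ℝ)).exists_bound_of_continuous hdc
  have hK : IsCompact (Prod.fst '' tsupport φ) := h.compact.isCompact.image continuous_fst
  set e : ℝ → ℂ := fun u => Complex.exp (↑(2 * Real.pi * (ξ * u)) * Complex.I) with he
  have hec : Continuous e := by fun_prop
  have hen : ∀ u, ‖e u‖ = 1 := fun u => Complex.norm_exp_ofReal_mul_I _
  set F' : Y → ℝ → Y →L[ℝ] ℂ := fun y u =>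
    e u • (fderiv ℝ φ (u, y)).comp (ContinuousLinearMap.inr ℝ ℝ Y) with hF'
  have hF'c : ∀ y, Continuous (F' y) := fun y => by
    have : Continuous fun u : ℝ => fderiv ℝ φ (u, y) := hdc.comp (by fun_prop)
    fun_prop
  have hF's : ∀ y, HasCompactSupport (F' y) := fun y => by
    refine HasCompactSupport.intro hK fun u hu => ?_
    have : fderiv ℝ φ (u, y) = 0 := by
      by_contra h1
      exact hu ⟨_, support_fderiv_subset ℝ (f := φ) h1, rfl⟩
    change e u • (fderiv ℝ φ (u, y)).comp _ = 0
    rw [this, ContinuousLinearMap.zero_comp]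
    ext w
    simp
  have key := hasFDerivAt_integral_of_dominated_of_fderiv_le (𝕜 := ℝ) (μ := volume)
    (F := fun y u => e u * φ (u, y)) (F' := F') (x₀ := y) (s := univ)
    (bound := (Prod.fst '' tsupport φ).indicator fun _ => C * ‖ContinuousLinearMap.inr ℝ ℝ Y‖)
    univ_mem
    (Eventually.of_forall fun y => Continuous.aestronglyMeasurable (by fun_prop))
    (integrable_slice h ξ y) (hF'c y).aestronglyMeasurable
    (Eventually.of_forall fun u y _ => ?_) ?_ (Eventually.of_forall fun u y _ => ?_)
  · have e1 : (fun y => partialFourierInvFun φ (ξ, y)) = fun y => ∫ u, e u * φ (u, y) :=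
      funext fun y => partialFourierInvFun_eq φ ξ y
    rw [e1, key.fderiv, ContinuousLinearMap.integral_apply
      ((hF'c y).integrable_of_hasCompactSupport (hF's y)), partialFourierInvFun_eq]
    rfl
  · by_cases hu : u ∈ Prod.fst '' tsupport φ
    · rw [indicator_of_mem hu, hF']
      dsimp only
      rw [norm_smul, hen, one_mul]
      refine (ContinuousLinearMap.opNorm_comp_le _ _).trans ?_
      gcongr
      exact hC _
    · have : fderiv ℝ φ (u, y) = 0 := by
        by_contra h1
        exact hu ⟨_, support_fderiv_subset ℝ (f := φ) h1, rfl⟩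
      rw [indicator_of_notMem hu]
      simp [hF', this]
  · rw [integrable_indicator_iff hK.measurableSet]
    exact integrableOn_const hK.measure_lt_top.ne
  · have h1 : HasFDerivAt (fun y => φ (u, y))
        ((fderiv ℝ φ (u, y)).comp (ContinuousLinearMap.inr ℝ ℝ Y)) y :=
      (hd (u, y)).hasFDerivAt.comp y (hasFDerivAt_prodMk_right u y)
    exact h1.const_mul (e u)

theorem partialFourierInvFun_deriv {Ω : Set Y} {φ : ℝ × Y → ℂ} (h : IsTestOn (univ ×ˢ Ω) φ)
    (ξ : ℝ) (y : Y) :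
    partialFourierInvFun (fun p => fderiv ℝ φ p (1, 0)) (ξ, y) =
      ξ * ((-(2 * Real.pi * Complex.I)) * partialFourierInvFun φ (ξ, y)) := by
  have hd : Differentiable ℝ φ := h.smooth.differentiable (by simp)
  have hder : deriv (fun u => φ (u, y)) = fun u => fderiv ℝ φ (u, y) (1, 0) := by
    funext u
    have := (hd (u, y)).hasFDerivAt.comp_hasDerivAt u
      ((hasDerivAt_id u).prodMk (hasDerivAt_const u y))
    exact this.deriv
  have h' := h.fderiv_apply (1, 0)
  have hi : ∀ {ψ : ℝ × Y → ℂ}, IsTestOn (univ ×ˢ Ω) ψ → Integrable (fun u => ψ (u, y)) :=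
    fun hψ => Continuous.integrable_of_hasCompactSupport
      (hψ.smooth.continuous.comp (by fun_prop)) (compact_slice hψ y)
  have key := Real.fourier_deriv (hi h) (hd.comp (by fun_prop)) (by rw [hder]; exact hi h')
  simp only [partialFourierInvFun, Real.fourierInv_eq_fourier_neg]
  rw [← hder, key]
  simp only [smul_eq_mul]
  push_cast
  ring

theorem isTestOn_partialFourierInvFun {Ω : Set Y} {φ : ℝ × Y → ℂ} (h : IsTestOn (univ ×ˢ Ω) φ)
    (ξ : ℝ) : IsTestOn Ω (fun y => partialFourierInvFun φ (ξ, y)) := by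
  have hK1 : IsCompact (Prod.fst '' tsupport φ) := h.compact.isCompact.image continuous_fst
  have hK2 : IsCompact (Prod.snd '' tsupport φ) := h.compact.isCompact.image continuous_snd
  have hsub : tsupport (fun y => partialFourierInvFun φ (ξ, y)) ⊆ Prod.snd '' tsupport φ := by
    refine closure_minimal (fun y hy => ?_) hK2.isClosed
    by_contra hn
    refine hy ?_
    dsimp only
    rw [partialFourierInvFun_eq]
    have : ∀ u, φ (u, y) = 0 := fun u =>
      image_eq_zero_of_notMem_tsupport fun h' => hn ⟨_, h', rfl⟩
    simp [this]
  refine ⟨?_, hK2.of_isClosed_subset (isClosed_tsupport _) hsub, hsub.trans ?_⟩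
  · -- the integral is a convolution with parameter `y`, evaluated at `0`
    have hconv := contDiffOn_convolution_right_with_param (𝕜 := ℝ) (μ := (volume : Measure ℝ))
      (f := fun u : ℝ => Complex.exp (↑(2 * Real.pi * (ξ * u)) * Complex.I))
      (n := ⊤) (ContinuousLinearMap.mul ℝ ℂ) (g := fun (y : Y) (u : ℝ) => φ (-u, y)) (s := univ)
      (k := Neg.neg '' (Prod.fst '' tsupport φ)) isOpen_univ (hK1.image continuous_neg)
      (fun y u _ hu => image_eq_zero_of_notMem_tsupport fun h' =>
        hu ⟨-u, ⟨_, h', rfl⟩, neg_neg u⟩)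
      (Continuous.locallyIntegrable (by fun_prop))
      (by
        have h1 := h.smooth
        have : ContDiff ℝ ∞ (fun p : Y × ℝ => φ (-p.2, p.1)) := h1.comp (by fun_prop)
        exact this.contDiffOn)
    rw [univ_prod_univ, contDiffOn_univ] at hconv
    have h2 : ContDiff ℝ ∞ fun y : Y => ((y, 0) : Y × ℝ) := by fun_prop
    have h3 : (fun y => partialFourierInvFun φ (ξ, y)) = (fun q : Y × ℝ => convolution
        (fun u : ℝ => Complex.exp (↑(2 * Real.pi * (ξ * u)) * Complex.I)) (fun u => φ (-u, q.1))
        (ContinuousLinearMap.mul ℝ ℂ) volume q.2) ∘ fun y => (y, 0) := by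
      funext y
      rw [partialFourierInvFun_eq]
      simp [convolution]
    rw [h3]
    exact hconv.comp h2
  · rintro _ ⟨p, hp, rfl⟩
    exact (h.support hp).2

theorem partialFourierInvFun_total (D : FirstOrder Y) {Ω : Set Y} {φ : ℝ × Y → ℂ}
    (h : IsTestOn (univ ×ˢ Ω) φ) (ξ : ℝ) :
    (fun y => partialFourierInvFun (D.total φ) (ξ, y)) =
      D.fiber ξ (fun y => partialFourierInvFun φ (ξ, y)) := by
  funext y
  have hi := fun v => integrable_slice (h.fderiv_apply v) ξ y
  rw [FirstOrder.fiber, fderiv_partialFourierInvFun h, fderiv_partialFourierInvFun h]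
  have h3 := partialFourierInvFun_deriv h ξ y
  have h4 : (ξ : ℂ) * ((-(2 * Real.pi * Complex.I)) * (D.m y * partialFourierInvFun φ (ξ, y))) =
      D.m y * partialFourierInvFun (fun p => fderiv ℝ φ p (1, 0)) (ξ, y) := by
    rw [h3]
    ring
  rw [h4]
  simp only [partialFourierInvFun_eq, ← integral_const_mul]
  have hab : Integrable (fun u : ℝ =>
      D.a * (Complex.exp (↑(2 * Real.pi * (ξ * u)) * Complex.I) * fderiv ℝ φ (u, y) (0, D.e₁)) +
      D.b * (Complex.exp (↑(2 * Real.pi * (ξ * u)) * Complex.I) * fderiv ℝ φ (u, y) (0, D.e₂))) :=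
    ((hi _).const_mul _).add ((hi _).const_mul _)
  rw [← integral_add ((hi _).const_mul _) ((hi _).const_mul _),
    ← integral_add hab ((hi _).const_mul _)]
  refine integral_congr_ae (Eventually.of_forall fun u => ?_)
  simp only [FirstOrder.total]
  ring

theorem partialFourierInvFun_total_iterate (D : FirstOrder Y) {Ω : Set Y} {φ : ℝ × Y → ℂ}
    (h : IsTestOn (univ ×ˢ Ω) φ) (ξ : ℝ) (n : ℕ) :
    (fun y => partialFourierInvFun (D.total^[n] φ) (ξ, y)) =
      (D.fiber ξ)^[n] (fun y => partialFourierInvFun φ (ξ, y)) := by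
  induction n with
  | zero => rfl
  | succ n ih =>
    rw [Function.iterate_succ_apply', Function.iterate_succ_apply', ← ih,
      partialFourierInvFun_total D (D.isTestOn_total_iterate h n)]

end Slices

/-! ### Decomposition of the differential equations over the Fourier variable -/

section Decomposition

open FourierTransform

theorem fourier_continuous {g : ℝ → ℂ} (h : Integrable g) : Continuous (𝓕 g) :=
  VectorFourier.fourierIntegral_continuous Real.continuous_fourierChar
    (by exact continuous_inner) h

/-- The Fourier transform is injective on `L¹`. -/
theorem ae_eq_zero_of_fourier_eq_zero {k : ℝ → ℂ} (hk : Integrable k) (h : ∀ t, 𝓕 k t = 0) :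
    ∀ᵐ x, k x = 0 := by
  refine ae_eq_zero_of_integral_contDiff_smul_eq_zero hk.locallyIntegrable fun g hs hc => ?_
  have hg₁ : HasCompactSupport (Complex.ofRealCLM ∘ g) := hc.comp_left rfl
  have hg₂ : ContDiff ℝ ∞ (Complex.ofRealCLM ∘ g) := by fun_prop
  set φ : SchwartzMap ℝ ℂ := hg₁.toSchwartzMap hg₂ with hφ
  set ψ : SchwartzMap ℝ ℂ := 𝓕⁻ φ with hψ
  have e3 : ∫ x, (𝓕 ψ) x • k x = ∫ x, ψ x • 𝓕 k x := by
    have := VectorFourier.integral_fourierIntegral_smul_eq_flip (L := innerₗ ℝ)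
      (μ := volume) (ν := volume) (f := ψ) (g := k) Real.continuous_fourierChar
      (by exact continuous_inner) ψ.integrable hk
    rw [flip_innerₗ] at this
    exact this
  rw [hψ, FourierTransform.fourier_fourierInv_eq] at e3
  have hφx : ∀ x, φ x = (g x : ℂ) := fun x => rfl
  simpa only [hφx, h, smul_zero, integral_zero, Complex.coe_smul] using! e3

/-- For continuous functionals, an identity that holds almost everywhere for each member of a
family with values in a separable space holds almost everywhere for all members at once. -/
theorem ae_forall_of_forall_ae {ι X Z : Type*} [TopologicalSpace Z] [SecondCountableTopology Z]
    [MeasurableSpace X] {μ : Measure X} (J : ι → Z) (Λ : X → Z → ℂ)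
    (h : ∀ i, ∀ᵐ x ∂μ, Λ x (J i) = 0) (hc : ∀ᵐ x ∂μ, Continuous (Λ x)) :
    ∀ᵐ x ∂μ, ∀ i, Λ x (J i) = 0 := by
  let _ : TopologicalSpace ι := TopologicalSpace.induced J inferInstance
  have : SecondCountableTopology ι := TopologicalSpace.secondCountableTopology_induced ι Z J
  obtain ⟨S, hS, hd⟩ := TopologicalSpace.exists_countable_dense ι
  have h1 : ∀ᵐ x ∂μ, ∀ i ∈ S, Λ x (J i) = 0 := (ae_ball_iff hS).2 fun i _ => h i
  filter_upwards [h1, hc] with x hx hcx i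
  have hJ : Continuous J := continuous_induced_dom
  exact congrFun ((hcx.comp hJ).ext_on hd continuous_const hx) i

theorem continuous_integral_mul {X : Type*} [MeasurableSpace X] {μ : Measure X} {g : X → ℂ}
    (hg : MemLp g 2 μ) : Continuous fun t : Lp ℂ 2 μ => ∫ x, g x * t x ∂μ := by
  have h : Continuous fun t : Lp ℂ 2 μ => inner ℂ (hg.star.toLp _) t := by fun_prop
  refine h.congr fun t => ?_
  rw [L2.inner_def]
  refine integral_congr_ae ?_
  filter_upwards [hg.star.coeFn_toLp] with x hx
  rw [hx]
  simp [mul_comm]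

theorem ae_memLp_slice_snd {X Y : Type*} [MeasurableSpace X] [MeasurableSpace Y] {μ : Measure X}
    {ν : Measure Y} [SFinite μ] [SFinite ν] {f : X × Y → ℂ}
    (h : MemLp f 2 (μ.prod ν)) : ∀ᵐ x ∂μ, MemLp (fun y => f (x, y)) 2 ν := by
  have hi := (memLp_two_iff_integrable_sq_norm h.1).1 h
  filter_upwards [hi.prod_right_ae, h.1.prodMk_left] with x hx hx2
  exact (memLp_two_iff_integrable_sq_norm hx2).2 hx

variable {Y : Type*} [NormedAddCommGroup Y] [NormedSpace ℝ Y]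

theorem isTestOn_tensor {Ω : Set Y} {χ : ℝ → ℂ} {φ : Y → ℂ} (hχ : IsTestOn univ χ)
    (hφ : IsTestOn Ω φ) : IsTestOn (univ ×ˢ Ω) (fun p : ℝ × Y => χ p.1 * φ p.2) := by
  have hsub : tsupport (fun p : ℝ × Y => χ p.1 * φ p.2) ⊆ tsupport χ ×ˢ tsupport φ := by
    refine closure_minimal (fun p hp => ?_)
      ((isClosed_tsupport χ).prod (isClosed_tsupport φ))
    exact ⟨subset_tsupport _ (left_ne_zero_of_mul hp), subset_tsupport _ (right_ne_zero_of_mul hp)⟩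
  refine ⟨(hχ.smooth.comp contDiff_fst).mul (hφ.smooth.comp contDiff_snd),
    (hχ.compact.isCompact.prod hφ.compact.isCompact).of_isClosed_subset (isClosed_tsupport _) hsub,
    fun p hp => ⟨trivial, hφ.support (hsub hp).2⟩⟩

theorem exists_isTestOn_fourierInv_ne_zero (ξ₀ : ℝ) : ∃ χ : ℝ → ℂ, IsTestOn univ χ ∧
    Continuous (𝓕⁻ χ) ∧ 𝓕⁻ χ ξ₀ ≠ 0 := by
  let f : ContDiffBump (0 : ℝ) := ⟨1, 2, by norm_num, by norm_num⟩
  have hf : IsTestOn univ (fun u : ℝ => ((f u : ℝ) : ℂ)) := by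
    refine ⟨Complex.ofRealCLM.contDiff.comp f.contDiff, ?_, subset_univ _⟩
    exact f.hasCompactSupport.comp_left Complex.ofReal_zero
  have hχ : IsTestOn univ (fun u : ℝ =>
      Complex.exp (↑(-(2 * Real.pi * (ξ₀ * u))) * Complex.I) * ((f u : ℝ) : ℂ)) := by
    have h : ContDiff ℝ ∞ fun u : ℝ => ((-(2 * Real.pi * (ξ₀ * u)) : ℝ) : ℂ) :=
      Complex.ofRealCLM.contDiff.comp (f := fun u : ℝ => -(2 * Real.pi * (ξ₀ * u))) (by fun_prop)
    exact hf.mul_left (h.mul contDiff_const).cexp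
  refine ⟨_, hχ, ?_, ?_⟩
  · have h := fourier_continuous (hχ.integrable volume)
    simp only [funext (Real.fourierInv_eq_fourier_neg _)]
    exact h.comp continuous_neg
  · rw [Real.fourierInv_eq']
    have h : ∀ u : ℝ, Complex.exp (↑(2 * Real.pi * inner ℝ u ξ₀) * Complex.I) •
        (Complex.exp (↑(-(2 * Real.pi * (ξ₀ * u))) * Complex.I) * ((f u : ℝ) : ℂ)) =
        ((f u : ℝ) : ℂ) := by
      intro u
      rw [smul_eq_mul, ← mul_assoc, ← Complex.exp_add]
      simp
    simp_rw [h]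
    rw [integral_complex_ofReal, Complex.ofReal_ne_zero]
    exact (f.integral_pos (μ := volume)).ne'

theorem fourierInv_comp_sub (χ : ℝ → ℂ) (t ξ : ℝ) :
    𝓕⁻ (fun u => χ (u - t)) ξ = Complex.exp (↑(2 * Real.pi * (ξ * t)) * Complex.I) * 𝓕⁻ χ ξ := by
  rw [Real.fourierInv_eq', Real.fourierInv_eq', ← integral_const_mul,
    ← integral_add_right_eq_self _ t]
  refine integral_congr_ae (Eventually.of_forall fun u => ?_)
  simp only [smul_eq_mul, add_sub_cancel_right]
  rw [← mul_assoc, ← Complex.exp_add]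
  congr 2
  simp
  ring

variable [FiniteDimensional ℝ Y] [MeasurableSpace Y] [BorelSpace Y] {ν : Measure Y} [SFinite ν]
  [IsFiniteMeasureOnCompacts ν] (D : FirstOrder Y) {Ω : Set Y}
  (f : Lp ℂ 2 ((volume : Measure ℝ).prod ν)) (n : ℕ)

theorem integrable_partialFourier_mul {φ : ℝ × Y → ℂ} (h : IsTestOn (univ ×ˢ Ω) φ) :
    Integrable (fun p => partialFourier ν f p * partialFourierInvFun φ p)
      ((volume : Measure ℝ).prod ν) :=
  (Lp.memLp (partialFourier ν f)).integrable_mul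
    (memLp_partialFourierInvFun ν (h.integrable _) (h.memLp _ 2))

theorem integral_mul_total_eq {φ : ℝ × Y → ℂ} (h : IsTestOn (univ ×ˢ Ω) φ) :
    ∫ p, f p * D.total^[n] φ p ∂((volume : Measure ℝ).prod ν) =
      ∫ ξ, ∫ y, partialFourier ν f (ξ, y) *
        (D.fiber ξ)^[n] (fun y => partialFourierInvFun φ (ξ, y)) y ∂ν := by
  have h' := D.isTestOn_total_iterate h n
  rw [integral_mul_eq_integral_partialFourier_mul ν f (h'.integrable _) (h'.memLp _ 2),
    integral_prod _ (integrable_partialFourier_mul f h')]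
  simp_rw [← partialFourierInvFun_total_iterate D h]

theorem integral_mul_total_eq_zero (hf : ∀ᵐ ξ : ℝ, ∀ φ, IsTestOn Ω φ →
      ∫ y, partialFourier ν f (ξ, y) * (D.fiber ξ)^[n] φ y ∂ν = 0)
    {φ : ℝ × Y → ℂ} (h : IsTestOn (univ ×ˢ Ω) φ) :
    ∫ p, f p * D.total^[n] φ p ∂((volume : Measure ℝ).prod ν) = 0 := by
  rw [integral_mul_total_eq D f n h]
  refine integral_eq_zero_of_ae ?_
  filter_upwards [hf] with ξ hξ
  exact hξ _ (isTestOn_partialFourierInvFun h ξ)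

/-- Testing against translates of `χ ⊗ φ` and the injectivity of the Fourier transform localize the
equation in the Fourier variable. -/
theorem ae_fiber_eq_zero
    (hf : ∀ φ : ℝ × Y → ℂ, IsTestOn (univ ×ˢ Ω) φ →
      ∫ p, f p * D.total^[n] φ p ∂((volume : Measure ℝ).prod ν) = 0)
    {φ : Y → ℂ} (hφ : IsTestOn Ω φ) :
    ∀ᵐ ξ : ℝ, ∫ y, partialFourier ν f (ξ, y) * (D.fiber ξ)^[n] φ y ∂ν = 0 := by
  set B : ℝ → ℂ := fun ξ => ∫ y, partialFourier ν f (ξ, y) * (D.fiber ξ)^[n] φ y ∂ν with hB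
  have hpI : ∀ (χ : ℝ → ℂ) ξ, IsTestOn univ χ →
      (D.fiber ξ)^[n] (fun y => partialFourierInvFun (fun p => χ p.1 * φ p.2) (ξ, y)) =
        fun y => 𝓕⁻ χ ξ * (D.fiber ξ)^[n] φ y := by
    intro χ ξ hχ
    rw [← D.fiber_iterate_const_mul ξ _ hφ]
    congr 1
    funext y
    rw [partialFourierInvFun_eq, Real.fourierInv_eq', ← integral_mul_const]
    refine integral_congr_ae (Eventually.of_forall fun u => ?_)
    simp
    ring
  have hk : ∀ χ : ℝ → ℂ, IsTestOn univ χ → ∀ᵐ ξ : ℝ, 𝓕⁻ χ ξ * B ξ = 0 := by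
    intro χ hχ
    have hk1 : Integrable (fun ξ => 𝓕⁻ χ ξ * B ξ) := by
      have h' := D.isTestOn_total_iterate (isTestOn_tensor hχ hφ) n
      have hi := (integrable_partialFourier_mul f h').integral_prod_left
      refine hi.congr (Eventually.of_forall fun ξ => ?_)
      have e := fun y => congrFun ((partialFourierInvFun_total_iterate D
        (isTestOn_tensor hχ hφ) ξ n).trans (hpI χ ξ hχ)) y
      simp only [e, hB]
      rw [← integral_const_mul]
      refine integral_congr_ae (Eventually.of_forall fun y => ?_)
      dsimp only
      ring
    refine ae_eq_zero_of_fourier_eq_zero hk1 fun t => ?_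
    have hχt : IsTestOn univ (fun u => χ (u - -t)) := by
      refine ⟨hχ.smooth.comp (by fun_prop), ?_, subset_univ _⟩
      exact hχ.compact.comp_homeomorph (Homeomorph.subRight (-t))
    have h0 := hf _ (isTestOn_tensor hχt hφ)
    rw [integral_mul_total_eq D f n (isTestOn_tensor hχt hφ)] at h0
    rw [← h0, Real.fourier_eq']
    refine integral_congr_ae (Eventually.of_forall fun ξ => ?_)
    simp only [hpI _ ξ hχt, fourierInv_comp_sub, hB]
    rw [smul_eq_mul, ← mul_assoc, ← integral_const_mul]
    refine integral_congr_ae (Eventually.of_forall fun y => ?_)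
    have e : (↑(-2 * Real.pi * inner ℝ ξ t) : ℂ) = ↑(2 * Real.pi * (ξ * -t)) := by
      congr 1
      simp
      ring
    simp only [e]
    ring
  refine measure_null_of_locally_null _ fun ξ₀ _ => ?_
  obtain ⟨χ, hχ, hcont, hne⟩ := exists_isTestOn_fourierInv_ne_zero ξ₀
  refine ⟨{ξ | 𝓕⁻ χ ξ ≠ 0} ∩ {ξ | ¬ B ξ = 0}, ?_, ?_⟩
  · rw [inter_comm]
    exact inter_mem_nhdsWithin _ (hcont.continuousAt.eventually_ne hne)
  · refine measure_mono_null ?_ (hk χ hχ)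
    rintro ξ ⟨h1, h2⟩
    exact mul_ne_zero h1 h2

/-- A weak solution of the total equation is, in almost every fibre, a weak solution of the fibre
equation. -/
theorem ae_forall_fiber_eq_zero
    (hf : ∀ φ : ℝ × Y → ℂ, IsTestOn (univ ×ˢ Ω) φ →
      ∫ p, f p * D.total^[n] φ p ∂((volume : Measure ℝ).prod ν) = 0) :
    ∀ᵐ ξ : ℝ, ∀ φ, IsTestOn Ω φ →
      ∫ y, partialFourier ν f (ξ, y) * (D.fiber ξ)^[n] φ y ∂ν = 0 := by
  have hfact : Fact ((2 : ℝ≥0∞) ≠ ⊤) := ⟨by simp⟩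
  choose θ hθ hθ0 hsum using fun φ : {φ : Y → ℂ // IsTestOn Ω φ} =>
    D.exists_fiber_iterate_eq_sum φ.2 n
  let J : {φ : Y → ℂ // IsTestOn Ω φ} → Fin (n + 1) → Lp ℂ 2 ν := fun φ i =>
    ((hθ φ i).memLp ν 2).toLp _
  let Λ : ℝ → (Fin (n + 1) → Lp ℂ 2 ν) → ℂ := fun ξ t =>
    ∑ i : Fin (n + 1), (ξ : ℂ) ^ (i : ℕ) * ∫ y, partialFourier ν f (ξ, y) * t i y ∂ν
  have hslice := ae_memLp_slice_snd (Lp.memLp (partialFourier ν f))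
  have hΛ : ∀ᵐ ξ : ℝ, ∀ φ, Λ ξ (J φ) =
      ∫ y, partialFourier ν f (ξ, y) * (D.fiber ξ)^[n] φ.1 y ∂ν := by
    filter_upwards [hslice] with ξ hξ φ
    rw [hsum φ ξ]
    simp only [Finset.mul_sum]
    rw [integral_finsetSum, Finset.sum_range]
    · refine Finset.sum_congr rfl fun i _ => ?_
      rw [← integral_const_mul]
      refine integral_congr_ae ?_
      filter_upwards [((hθ φ i).memLp ν 2).coeFn_toLp] with y hy
      rw [hy]
      ring
    · intro i _
      have := (hξ.integrable_mul ((hθ φ i).memLp ν 2)).const_mul ((ξ : ℂ) ^ i)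
      refine this.congr (Eventually.of_forall fun y => ?_)
      simp only [Pi.mul_apply]
      ring
  have hmain := ae_forall_of_forall_ae (μ := volume) J Λ (fun φ => by
    filter_upwards [hΛ, ae_fiber_eq_zero D f n hf φ.2] with ξ h1 h2
    rw [h1, h2]) (by
    filter_upwards [hslice] with ξ hξ
    exact continuous_finsetSum _ fun i _ => continuous_const.mul
      ((continuous_integral_mul hξ).comp (continuous_apply i)))
  filter_upwards [hΛ, hmain] with ξ h1 h2 φ hφ
  rw [← h1 ⟨φ, hφ⟩]
  exact h2 _

end Decomposition

/-! ### Heisenberg coordinates on the Siegel domain -/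

/-- The measure on the fibre `ℂ × ℝ₊`. -/
noncomputable abbrev fiberMeasure : Measure (ℂ × ℝ) := volume.prod (volume.restrict (Ioi 0))

/-- The fibre `ℂ × ℝ₊`, as a subset of `ℂ × ℝ`. -/
def fiberSet : Set (ℂ × ℝ) := {y | 0 < y.2}

theorem re_ofReal_add_ofReal_mul_I (a b : ℝ) : ((a : ℂ) + (b : ℂ) * Complex.I).re = a := by
  simp

theorem im_ofReal_add_ofReal_mul_I (a b : ℝ) : ((a : ℂ) + (b : ℂ) * Complex.I).im = b := by
  simp

/-- The coordinates `(u, z, v) ↦ (z, u + i (v + |z|²))` on the Siegel domain, in which `v` is the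
height. -/
noncomputable def heisenberg : ℝ × (ℂ × ℝ) ≃ₜ ℂ × ℂ where
  toFun p := (p.2.1, (p.1 : ℂ) + ((p.2.2 + ‖p.2.1‖ ^ 2 : ℝ) : ℂ) * Complex.I)
  invFun ζ := (ζ.2.re, (ζ.1, ζ.2.im - ‖ζ.1‖ ^ 2))
  left_inv p := by
    simp only [re_ofReal_add_ofReal_mul_I, im_ofReal_add_ofReal_mul_I, add_sub_cancel_right]
  right_inv ζ := by
    simp only [sub_add_cancel, Complex.re_add_im]
  continuous_toFun := by fun_prop
  continuous_invFun := by fun_prop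

theorem heisenberg_apply (p : ℝ × (ℂ × ℝ)) :
    heisenberg p = (p.2.1, (p.1 : ℂ) + ((p.2.2 + ‖p.2.1‖ ^ 2 : ℝ) : ℂ) * Complex.I) := rfl

theorem height_heisenberg (p : ℝ × (ℂ × ℝ)) : height (heisenberg p) = p.2.2 := by
  simp only [height, heisenberg_apply, im_ofReal_add_ofReal_mul_I, add_sub_cancel_right]

theorem preimage_siegel : heisenberg ⁻¹' siegel = univ ×ˢ fiberSet := by
  ext p
  simp [siegel, fiberSet, height_heisenberg]

theorem measurableSet_siegel : MeasurableSet siegel :=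
  measurableSet_lt measurable_const measurable_height

theorem measurePreserving_swap_assoc : MeasurePreserving
    (fun p : ℝ × (ℂ × ℝ) => (p.2.1, (p.1, p.2.2))) := by
  have h1 : MeasurePreserving (MeasurableEquiv.prodAssoc (α := ℝ) (β := ℂ) (γ := ℝ)).symm :=
    volume_preserving_prodAssoc.symm
  have h2 : MeasurePreserving (Prod.map Prod.swap id : (ℝ × ℂ) × ℝ → (ℂ × ℝ) × ℝ) :=
    (Measure.measurePreserving_swap (μ := (volume : Measure ℝ)) (ν := (volume : Measure ℂ))).prod
      (MeasurePreserving.id (volume : Measure ℝ))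
  have h3 : MeasurePreserving (MeasurableEquiv.prodAssoc (α := ℂ) (β := ℝ) (γ := ℝ)) :=
    volume_preserving_prodAssoc
  exact h3.comp (h2.comp h1)

theorem measurePreserving_heisenberg_volume : MeasurePreserving heisenberg := by
  have hg : ∀ z : ℂ, MeasurePreserving
      (fun q : ℝ × ℝ => (q.1 : ℂ) + ((q.2 + ‖z‖ ^ 2 : ℝ) : ℂ) * Complex.I) := by
    intro z
    have h1 : MeasurePreserving (Prod.map id (fun v : ℝ => v + ‖z‖ ^ 2) : ℝ × ℝ → ℝ × ℝ) :=
      (MeasurePreserving.id (volume : Measure ℝ)).prod (measurePreserving_add_right volume _)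
    have h2 := (Complex.volume_preserving_equiv_real_prod.symm).comp h1
    convert! h2 using 1
    funext q
    apply Complex.ext
    · rw [re_ofReal_add_ofReal_mul_I]
      rfl
    · rw [im_ofReal_add_ofReal_mul_I]
      rfl
  have h := (MeasurePreserving.id (volume : Measure ℂ)).skew_product
    (μb := (volume : Measure ℂ)) (μc := (volume : Measure (ℝ × ℝ))) (μd := (volume : Measure ℂ))
    (g := fun (z : ℂ) (q : ℝ × ℝ) => (q.1 : ℂ) + ((q.2 + ‖z‖ ^ 2 : ℝ) : ℂ) * Complex.I)
    (by
      apply Continuous.measurable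
      simp only [Function.uncurry_def]
      fun_prop) (Eventually.of_forall fun z => (hg z).map_eq)
  have h' := MeasurePreserving.comp h measurePreserving_swap_assoc
  exact h'

theorem prod_fiberMeasure_eq : (volume : Measure ℝ).prod fiberMeasure =
    (volume : Measure (ℝ × (ℂ × ℝ))).restrict (univ ×ˢ fiberSet) := by
  have h1 : fiberMeasure = (volume : Measure (ℂ × ℝ)).restrict fiberSet := by
    have := Measure.prod_restrict (μ := (volume : Measure ℂ)) (ν := (volume : Measure ℝ)) univ (Ioi 0)
    rw [Measure.restrict_univ] at this
    rw [fiberMeasure, this]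
    congr 1
    ext y
    simp [fiberSet]
  have := Measure.prod_restrict (μ := (volume : Measure ℝ)) (ν := (volume : Measure (ℂ × ℝ)))
    univ fiberSet
  rw [Measure.restrict_univ] at this
  rw [h1, this]
  rfl

theorem measurePreserving_heisenberg :
    MeasurePreserving heisenberg ((volume : Measure ℝ).prod fiberMeasure) siegelMeasure := by
  have h := measurePreserving_heisenberg_volume.restrict_preimage measurableSet_siegel
  rwa [preimage_siegel, ← prod_fiberMeasure_eq] at h

theorem measurePreserving_heisenberg_symm : MeasurePreserving heisenberg.symm siegelMeasure
    ((volume : Measure ℝ).prod fiberMeasure) :=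
  MeasurePreserving.symm heisenberg.toMeasurableEquiv measurePreserving_heisenberg

/-- Heisenberg coordinates as a unitary operator. -/
noncomputable def heisenbergUnitary :
    L2Siegel ≃ₗᵢ[ℂ] Lp ℂ 2 ((volume : Measure ℝ).prod fiberMeasure) :=
  LinearIsometryEquiv.ofSurjective
    (Lp.compMeasurePreservingₗᵢ ℂ heisenberg measurePreserving_heisenberg) (by
      intro g
      refine ⟨Lp.compMeasurePreserving heisenberg.symm measurePreserving_heisenberg_symm g, ?_⟩
      refine Lp.ext ?_
      have h1 := Lp.coeFn_compMeasurePreserving g measurePreserving_heisenberg_symm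
      have h2 := Lp.coeFn_compMeasurePreserving (Lp.compMeasurePreserving heisenberg.symm
        measurePreserving_heisenberg_symm g) measurePreserving_heisenberg
      have h3 := measurePreserving_heisenberg.quasiMeasurePreserving.ae h1
      filter_upwards [h2, h3] with p h2 h3
      refine h2.trans (h3.trans ?_)
      simp)

theorem coeFn_heisenbergUnitary (f : L2Siegel) :
    heisenbergUnitary f =ᵐ[(volume : Measure ℝ).prod fiberMeasure] f ∘ heisenberg :=
  Lp.coeFn_compMeasurePreserving f measurePreserving_heisenberg

theorem integral_siegel_eq (g : ℂ × ℂ → ℂ) : ∫ ζ in siegel, g ζ =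
    ∫ p, g (heisenberg p) ∂((volume : Measure ℝ).prod fiberMeasure) :=
  (measurePreserving_heisenberg.integral_comp heisenberg.measurableEmbedding g).symm

/-- The operator `∂/∂ζ̄₁ - 2 i ζ₁ ∂/∂ζ̄₂` in Heisenberg coordinates, `∂/∂z̄ - i z ∂/∂u`. -/
noncomputable def opOne : FirstOrder (ℂ × ℝ) where
  a := 1 / 2
  b := Complex.I / 2
  e₁ := (1, 0)
  e₂ := (Complex.I, 0)
  m y := -Complex.I * y.1
  smooth := by fun_prop

/-- The operator `∂/∂ζ̄₂` in Heisenberg coordinates, `(∂/∂u + i ∂/∂v) / 2`. -/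
noncomputable def opTwo : FirstOrder (ℂ × ℝ) where
  a := Complex.I / 2
  b := 0
  e₁ := (0, 1)
  e₂ := 0
  m _ := 1 / 2
  smooth := contDiff_const

theorem contDiff_heisenberg : ContDiff ℝ ∞ heisenberg := by
  have h1 : ContDiff ℝ ∞ fun p : ℝ × (ℂ × ℝ) => (p.1 : ℂ) :=
    Complex.ofRealCLM.contDiff.comp contDiff_fst
  have h2 : ContDiff ℝ ∞ fun p : ℝ × (ℂ × ℝ) => ((p.2.2 + ‖p.2.1‖ ^ 2 : ℝ) : ℂ) :=
    Complex.ofRealCLM.contDiff.comp (f := fun p : ℝ × (ℂ × ℝ) => p.2.2 + ‖p.2.1‖ ^ 2)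
      (contDiff_snd.snd.add (contDiff_snd.fst.norm_sq ℝ))
  exact contDiff_snd.fst.prodMk (h1.add (h2.mul contDiff_const))

theorem contDiff_heisenberg_symm : ContDiff ℝ ∞ heisenberg.symm := by
  have h1 : ContDiff ℝ ∞ fun ζ : ℂ × ℂ => ζ.2.re := Complex.reCLM.contDiff.comp contDiff_snd
  have h2 : ContDiff ℝ ∞ fun ζ : ℂ × ℂ => ζ.2.im := Complex.imCLM.contDiff.comp contDiff_snd
  exact h1.prodMk (contDiff_fst.prodMk (h2.sub (contDiff_fst.norm_sq ℝ)))

theorem isTestOn_comp_heisenberg {φ : ℂ × ℂ → ℂ} (h : IsTest φ) :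
    IsTestOn (univ ×ˢ fiberSet) (φ ∘ heisenberg) := by
  refine ⟨h.smooth.comp contDiff_heisenberg, h.compact.comp_homeomorph _, ?_⟩
  rw [← preimage_siegel, tsupport_comp_eq_preimage]
  exact preimage_mono h.support

theorem isTest_comp_heisenberg_symm {φ : ℝ × (ℂ × ℝ) → ℂ}
    (h : IsTestOn (univ ×ˢ fiberSet) φ) : IsTest (φ ∘ heisenberg.symm) := by
  refine ⟨h.smooth.comp contDiff_heisenberg_symm, h.compact.comp_homeomorph _, ?_⟩
  rw [tsupport_comp_eq_preimage]
  have := h.support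
  rw [← preimage_siegel] at this
  intro ζ hζ
  simpa using! this hζ

theorem fderiv_comp_heisenberg {φ : ℂ × ℂ → ℂ} (h : Differentiable ℝ φ) (p w : ℝ × (ℂ × ℝ)) :
    fderiv ℝ (φ ∘ heisenberg) p w = fderiv ℝ φ (heisenberg p)
      (w.2.1, (w.1 : ℂ) + ((w.2.2 + 2 * inner ℝ p.2.1 w.2.1 : ℝ) : ℂ) * Complex.I) := by
  have hd : DifferentiableAt ℝ heisenberg p := contDiff_heisenberg.differentiable (by simp) p
  rw [fderiv_comp p (h _) hd, ContinuousLinearMap.comp_apply]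
  congr 1
  have h1 : HasFDerivAt (fun p : ℝ × (ℂ × ℝ) => ‖p.2.1‖ ^ 2) _ p :=
    HasFDerivAt.comp (g := fun z : ℂ => ‖z‖ ^ 2) (f := fun p : ℝ × (ℂ × ℝ) => p.2.1) p
      (hasStrictFDerivAt_norm_sq p.2.1).hasFDerivAt (hasFDerivAt_snd (𝕜 := ℝ) (p := p)).fst
  have h2 : HasFDerivAt (fun p : ℝ × (ℂ × ℝ) => ((p.2.2 + ‖p.2.1‖ ^ 2 : ℝ) : ℂ)) _ p :=
    Complex.ofRealCLM.hasFDerivAt.comp p ((hasFDerivAt_snd (𝕜 := ℝ) (p := p)).snd.add h1)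
  have h3 : HasFDerivAt (fun p : ℝ × (ℂ × ℝ) => (p.1 : ℂ)) _ p :=
    Complex.ofRealCLM.hasFDerivAt.comp p (hasFDerivAt_fst (𝕜 := ℝ) (p := p))
  have h4 : HasFDerivAt heisenberg _ p :=
    (hasFDerivAt_snd (𝕜 := ℝ) (p := p)).fst.prodMk (h3.add (h2.mul_const Complex.I))
  rw [h4.fderiv]
  simp [mul_comm]
  ring

theorem dOne_comp_heisenberg {φ : ℂ × ℂ → ℂ} (h : Differentiable ℝ φ) :
    dOne φ ∘ heisenberg = opOne.total (φ ∘ heisenberg) := by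
  funext p
  simp only [FirstOrder.total, opOne, fderiv_comp_heisenberg h, Function.comp_apply, dOne, dbar]
  set T := fderiv ℝ φ (heisenberg p)
  have hz : (heisenberg p).1 = p.2.1 := rfl
  have e1 : ((1 : ℂ), (((0 : ℝ) : ℂ) + ((0 + 2 * inner ℝ p.2.1 1 : ℝ) : ℂ) * Complex.I)) =
      (1, 0) + (2 * p.2.1.re) • (0, Complex.I) := by
    ext <;> simp [Complex.inner]
  have e2 : (Complex.I, (((0 : ℝ) : ℂ) + ((0 + 2 * inner ℝ p.2.1 Complex.I : ℝ) : ℂ) * Complex.I)) =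
      (Complex.I, 0) + (2 * p.2.1.im) • (0, Complex.I) := by
    ext <;> simp [Complex.inner]
  have e3 : ((0 : ℂ), (((1 : ℝ) : ℂ) + ((0 + 2 * inner ℝ p.2.1 0 : ℝ) : ℂ) * Complex.I)) =
      (0, 1) := by
    ext <;> simp
  have e4 : Complex.I • ((1 : ℂ), (0 : ℂ)) = (Complex.I, 0) := by simp
  have e5 : Complex.I • ((0 : ℂ), (1 : ℂ)) = (0, Complex.I) := by simp
  simp only [Prod.fst_zero, Prod.snd_zero]
  rw [e1, e2, e3, e4, e5, map_add, map_add, map_smul, map_smul, hz]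
  simp only [Complex.real_smul]
  push_cast
  have hre : p.2.1 = (p.2.1.re : ℂ) + p.2.1.im * Complex.I := (Complex.re_add_im _).symm
  linear_combination T (0, Complex.I) * hre +
    (-(p.2.1 * T (0, Complex.I))) * Complex.I_sq

theorem dTwo_comp_heisenberg {φ : ℂ × ℂ → ℂ} (h : Differentiable ℝ φ) :
    dTwo φ ∘ heisenberg = opTwo.total (φ ∘ heisenberg) := by
  funext p
  simp only [FirstOrder.total, opTwo, fderiv_comp_heisenberg h, Function.comp_apply, dTwo, dbar]
  simp
  ring

theorem dOne_iterate_comp_heisenberg {φ : ℂ × ℂ → ℂ} (h : IsTest φ) (n : ℕ) :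
    dOne^[n] φ ∘ heisenberg = opOne.total^[n] (φ ∘ heisenberg) := by
  induction n with
  | zero => rfl
  | succ n ih =>
    rw [Function.iterate_succ_apply', Function.iterate_succ_apply', ← ih,
      dOne_comp_heisenberg ((h.dOne_iterate n).smooth.differentiable (by simp))]

theorem dTwo_iterate_comp_heisenberg {φ : ℂ × ℂ → ℂ} (h : IsTest φ) (n : ℕ) :
    dTwo^[n] φ ∘ heisenberg = opTwo.total^[n] (φ ∘ heisenberg) := by
  induction n with
  | zero => rfl
  | succ n ih =>
    rw [Function.iterate_succ_apply', Function.iterate_succ_apply', ← ih,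
      dTwo_comp_heisenberg ((h.dTwo_iterate n).smooth.differentiable (by simp))]

/-- The Fourier transform in `u` after passing to Heisenberg coordinates. -/
noncomputable def siegelFourier :
    L2Siegel ≃ₗᵢ[ℂ] Lp ℂ 2 ((volume : Measure ℝ).prod fiberMeasure) :=
  heisenbergUnitary.trans (partialFourier fiberMeasure)

/-- The weak equation `(fibre operator)^n F = 0` on `ℂ × ℝ₊`. -/
def WeakFiber (D : FirstOrder (ℂ × ℝ)) (n : ℕ) (ξ : ℝ) (F : ℂ × ℝ → ℂ) : Prop :=
  ∀ φ, IsTestOn fiberSet φ → ∫ y, F y * (D.fiber ξ)^[n] φ y ∂fiberMeasure = 0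

theorem ae_weakFiber_iff (D : FirstOrder (ℂ × ℝ)) (d : (ℂ × ℂ → ℂ) → ℂ × ℂ → ℂ) (n : ℕ)
    (hd : ∀ φ, IsTest φ → d^[n] φ ∘ heisenberg = D.total^[n] (φ ∘ heisenberg)) (f : L2Siegel) :
    (∀ φ, IsTest φ → ∫ ζ in siegel, f ζ * (d^[n] φ) ζ = 0) ↔
      ∀ᵐ ξ : ℝ, WeakFiber D n ξ (fun y => siegelFourier f (ξ, y)) := by
  have key : ∀ φ, IsTest φ → ∫ ζ in siegel, f ζ * (d^[n] φ) ζ =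
      ∫ p, heisenbergUnitary f p * D.total^[n] (φ ∘ heisenberg) p
        ∂((volume : Measure ℝ).prod fiberMeasure) := by
    intro φ hφ
    rw [integral_siegel_eq, ← hd φ hφ]
    refine integral_congr_ae ?_
    filter_upwards [coeFn_heisenbergUnitary f] with p hp
    rw [hp]
    rfl
  constructor
  · intro h
    refine ae_forall_fiber_eq_zero D (heisenbergUnitary f) n fun φ hφ => ?_
    have h1 := key _ (isTest_comp_heisenberg_symm hφ)
    rw [h _ (isTest_comp_heisenberg_symm hφ)] at h1
    have e : (φ ∘ heisenberg.symm) ∘ heisenberg = φ := by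
      funext p
      simp
    rw [e] at h1
    exact h1.symm
  · intro h φ hφ
    rw [key φ hφ]
    exact integral_mul_total_eq_zero D (heisenbergUnitary f) n h (isTestOn_comp_heisenberg hφ)

/-- The defining equations of the poly-Bergman type space hold if and only if their Fourier transforms
hold on almost every fibre. -/
theorem mem_polyBergman_iff (p q : ℕ) (f : L2Siegel) : f ∈ polyBergman p q ↔
    (∀ᵐ ξ : ℝ, WeakFiber opOne p ξ (fun y => siegelFourier f (ξ, y))) ∧
      ∀ᵐ ξ : ℝ, WeakFiber opTwo q ξ (fun y => siegelFourier f (ξ, y)) := by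
  rw [← ae_weakFiber_iff opOne dOne p (fun φ hφ => dOne_iterate_comp_heisenberg hφ p),
    ← ae_weakFiber_iff opTwo dTwo q (fun φ hφ => dTwo_iterate_comp_heisenberg hφ q)]
  exact ⟨fun h => ⟨fun φ hφ => (h φ hφ).1, fun φ hφ => (h φ hφ).2⟩,
    fun h φ hφ => ⟨h.1 φ hφ, h.2 φ hφ⟩⟩

/-! ### The ordinary differential equation on the half-line -/

/-- The operator `d/dv - c`. -/
noncomputable def expOp (c : ℝ) (η : ℝ → ℂ) (v : ℝ) : ℂ := deriv η v - c * η v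

section HalfLine

variable {U : Set ℝ}

theorem IsTestOn.deriv {θ : ℝ → ℂ} (h : IsTestOn U θ) : IsTestOn U (deriv θ) := by
  have := h.fderiv_apply 1
  simpa only [fderiv_apply_one_eq_deriv] using this

theorem IsTestOn.deriv_iterate {θ : ℝ → ℂ} (h : IsTestOn U θ) (n : ℕ) :
    IsTestOn U (_root_.deriv^[n] θ) := by
  induction n with
  | zero => exact h
  | succ n ih =>
    rw [Function.iterate_succ_apply']
    exact ih.deriv

theorem contDiff_cexp_ofReal_mul (c : ℝ) :
    ContDiff ℝ ∞ fun v : ℝ => Complex.exp ((c * v : ℝ) : ℂ) :=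
  (Complex.ofRealCLM.contDiff.comp (f := fun v : ℝ => c * v) (by fun_prop)).cexp

theorem hasDerivAt_cexp_ofReal_mul (c v : ℝ) : HasDerivAt
    (fun v : ℝ => Complex.exp ((c * v : ℝ) : ℂ)) (c * Complex.exp ((c * v : ℝ) : ℂ)) v := by
  have h1 : HasDerivAt (fun v : ℝ => ((c * v : ℝ) : ℂ)) ((c : ℝ) : ℂ) v := by
    have := ((hasDerivAt_id v).const_mul c).ofReal_comp
    simpa using this
  refine h1.cexp.congr_deriv (mul_comm _ _)

theorem expOp_iterate_exp_mul (c : ℝ) {θ : ℝ → ℂ} (h : IsTestOn U θ) (n : ℕ) :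
    (expOp c)^[n] (fun v => Complex.exp ((c * v : ℝ) : ℂ) * θ v) =
      fun v => Complex.exp ((c * v : ℝ) : ℂ) * (deriv^[n] θ) v := by
  induction n with
  | zero => rfl
  | succ n ih =>
    rw [Function.iterate_succ_apply', Function.iterate_succ_apply', ih]
    funext v
    have hd := ((h.deriv_iterate n).smooth.differentiable (by simp) v).hasDerivAt
    rw [expOp, ((hasDerivAt_cexp_ofReal_mul c v).fun_mul hd).deriv]
    ring

theorem expOp_iterate_eq (c : ℝ) {η : ℝ → ℂ} (h : IsTestOn U η) (n : ℕ) :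
    (expOp c)^[n] η = fun v => Complex.exp ((c * v : ℝ) : ℂ) *
      (deriv^[n] (fun v => Complex.exp ((-c * v : ℝ) : ℂ) * η v)) v := by
  rw [← expOp_iterate_exp_mul c (h.mul_left (contDiff_cexp_ofReal_mul (-c)))]
  congr 1
  funext v
  rw [← mul_assoc, ← Complex.exp_add]
  simp

theorem expOp_iterate_const_mul (c : ℝ) (a : ℂ) (η : ℝ → ℂ) (n : ℕ) :
    (expOp c)^[n] (fun v => a * η v) = fun v => a * ((expOp c)^[n] η) v := by
  induction n with
  | zero => rfl
  | succ n ih =>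
    rw [Function.iterate_succ_apply', Function.iterate_succ_apply', ih]
    funext v
    rw [expOp, expOp, deriv_const_mul_field]
    ring

theorem IsTestOn.expOp_iterate {η : ℝ → ℂ} (h : IsTestOn U η) (c : ℝ) (n : ℕ) :
    IsTestOn U ((expOp c)^[n] η) := by
  rw [expOp_iterate_eq c h]
  exact ((h.mul_left (contDiff_cexp_ofReal_mul (-c))).deriv_iterate n).mul_left
    (contDiff_cexp_ofReal_mul c)

theorem integral_Ioi_eq_of_isTestOn {η : ℝ → ℂ} (h : IsTestOn (Ioi 0) η) (g : ℝ → ℂ) :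
    ∫ v in Ioi (0 : ℝ), g v * η v = ∫ v, g v * η v := by
  refine setIntegral_eq_integral_of_forall_compl_eq_zero fun v hv => ?_
  rw [image_eq_zero_of_notMem_tsupport fun h' => hv (h.support h'), mul_zero]

theorem contDiff_polynomial (P : Polynomial ℂ) : ContDiff ℝ ∞ fun z : ℂ => P.eval z := by
  have : ContDiff ℂ ∞ fun z : ℂ => P.eval z := by
    simpa using! P.contDiff_aeval (𝕜 := ℂ) (n := ∞)
  exact this.restrict_scalars ℝ

theorem contDiff_polynomial_eval (P : Polynomial ℂ) :
    ContDiff ℝ ∞ fun v : ℝ => P.eval (v : ℂ) :=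
  (contDiff_polynomial P).comp Complex.ofRealCLM.contDiff

theorem hasDerivAt_polynomial_eval (P : Polynomial ℂ) (v : ℝ) : HasDerivAt
    (fun v : ℝ => P.eval (v : ℂ)) ((Polynomial.derivative P).eval (v : ℂ)) v :=
  (P.hasDerivAt (v : ℂ)).comp_ofReal

theorem integral_polynomial_mul_deriv (P : Polynomial ℂ) {θ : ℝ → ℂ} (h : IsTestOn U θ) :
    ∫ v : ℝ, P.eval (v : ℂ) * deriv θ v =
      -∫ v : ℝ, (Polynomial.derivative P).eval (v : ℂ) * θ v :=
  integral_mul_deriv_eq_deriv_mul_of_integrable (fun v _ => hasDerivAt_polynomial_eval P v)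
    (fun v _ => (h.smooth.differentiable (by simp) v).hasDerivAt)
    ((h.deriv.mul_left (contDiff_polynomial_eval P)).integrable volume)
    ((h.mul_left (contDiff_polynomial_eval _)).integrable volume)
    ((h.mul_left (contDiff_polynomial_eval P)).integrable volume)

theorem integral_polynomial_mul_deriv_iterate (P : Polynomial ℂ) {θ : ℝ → ℂ} (h : IsTestOn U θ)
    (n : ℕ) : ∫ v : ℝ, P.eval (v : ℂ) * (deriv^[n] θ) v =
      (-1) ^ n * ∫ v : ℝ, (Polynomial.derivative^[n] P).eval (v : ℂ) * θ v := by
  induction n generalizing P with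
  | zero => simp
  | succ n ih =>
    rw [Function.iterate_succ_apply', integral_polynomial_mul_deriv P (h.deriv_iterate n), ih,
      ← Function.iterate_succ_apply]
    ring

/-- Conjugation by `e^{cv}` turns `expOp c` into a plain derivative, whose `n`-th power annihilates
polynomials of degree less than `n` after integration by parts. -/
theorem integral_polynomial_exp_mul_expOp (P : Polynomial ℂ) (c : ℝ) {η : ℝ → ℂ}
    (h : IsTestOn (Ioi 0) η) {n : ℕ} (hP : P.degree < n) :
    ∫ v in Ioi (0 : ℝ), P.eval (v : ℂ) * Complex.exp ((-c * v : ℝ) : ℂ) * ((expOp c)^[n] η) v =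
      0 := by
  rw [integral_Ioi_eq_of_isTestOn (h.expOp_iterate c n), expOp_iterate_eq c h]
  have e : ∀ v : ℝ, P.eval (v : ℂ) * Complex.exp ((-c * v : ℝ) : ℂ) *
      (Complex.exp ((c * v : ℝ) : ℂ) *
        (deriv^[n] (fun v => Complex.exp ((-c * v : ℝ) : ℂ) * η v)) v) =
      P.eval (v : ℂ) * (deriv^[n] (fun v => Complex.exp ((-c * v : ℝ) : ℂ) * η v)) v := by
    intro v
    have : Complex.exp ((-c * v : ℝ) : ℂ) * Complex.exp ((c * v : ℝ) : ℂ) = 1 := by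
      rw [← Complex.exp_add]
      simp
    linear_combination (P.eval (v : ℂ) *
      (deriv^[n] (fun v => Complex.exp ((-c * v : ℝ) : ℂ) * η v)) v) * this
  simp_rw [e]
  rw [integral_polynomial_mul_deriv_iterate P (h.mul_left (contDiff_cexp_ofReal_mul (-c)))]
  have h0 : Polynomial.derivative^[n] P = 0 := by
    by_cases hP0 : P = 0
    · rw [hP0, Polynomial.iterate_derivative_zero]
    · exact Polynomial.iterate_derivative_eq_zero ((Polynomial.natDegree_lt_iff_degree_lt hP0).2 hP)
  simp [h0]

/-- A test function of integral zero has a primitive that is a test function. -/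
theorem exists_primitive {θ : ℝ → ℂ} (h : IsTestOn (Ioi 0) θ) (h0 : ∫ v, θ v = 0) :
    ∃ Θ : ℝ → ℂ, IsTestOn (Ioi 0) Θ ∧ deriv Θ = θ := by
  obtain ⟨a, ha, haK⟩ := h.compact.isCompact.exists_forall_le' (f := id) continuousOn_id
    (a := (0 : ℝ)) fun x hx => h.support hx
  obtain ⟨b, hb⟩ := h.compact.isCompact.bddAbove
  have hder : ∀ v, HasDerivAt (fun v => ∫ t in (0 : ℝ)..v, θ t) (θ v) v := fun v =>
    (h.smooth.continuous.integral_hasStrictDerivAt 0 v).hasDerivAt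
  have hd : deriv (fun v => ∫ t in (0 : ℝ)..v, θ t) = θ := funext fun v => (hder v).deriv
  have hsub : tsupport (fun v => ∫ t in (0 : ℝ)..v, θ t) ⊆ Icc a b := by
    refine closure_minimal (fun v hv => ?_) isClosed_Icc
    by_contra hn
    refine hv ?_
    rw [mem_Icc, not_and_or, not_le, not_le] at hn
    rcases hn with hn | hn
    · refine (intervalIntegral.integral_congr (g := fun _ => (0 : ℂ)) fun t ht => ?_).trans (by simp)
      refine image_eq_zero_of_notMem_tsupport fun h' => ?_
      have h1 := haK t h'
      have h2 : t ≤ max 0 v := ht.2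
      have h3 : max 0 v < a := max_lt ha hn
      exact absurd (h1.trans h2) (not_le.2 h3)
    · dsimp only
      rw [intervalIntegral.integral_eq_integral_of_support_subset, h0]
      intro t ht
      have ht' := subset_tsupport θ ht
      exact ⟨h.support ht', (hb ht').trans hn.le⟩
  refine ⟨_, ⟨?_, isCompact_Icc.of_isClosed_subset (isClosed_tsupport _) hsub, fun v hv => ?_⟩, hd⟩
  · rw [contDiff_infty_iff_deriv, hd]
    exact ⟨fun v => (hder v).differentiableAt, h.smooth⟩
  · exact ha.trans_le (hsub hv).1

/-- A test function with vanishing moments of order less than `n` is an `n`-th derivative. -/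
theorem exists_iterated_primitive (n : ℕ) {θ : ℝ → ℂ} (h : IsTestOn (Ioi 0) θ)
    (h0 : ∀ i < n, ∫ v : ℝ, (v : ℂ) ^ i * θ v = 0) :
    ∃ Θ : ℝ → ℂ, IsTestOn (Ioi 0) Θ ∧ deriv^[n] Θ = θ := by
  induction n generalizing θ with
  | zero => exact ⟨θ, h, rfl⟩
  | succ n ih =>
    obtain ⟨Θ, hΘ, hd⟩ := exists_primitive h (by simpa using h0 0 (by omega))
    obtain ⟨Ξ, hΞ, hd2⟩ := ih hΘ (fun i hi => by
      have h1 := integral_polynomial_mul_deriv (Polynomial.X ^ (i + 1)) hΘ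
      rw [hd] at h1
      simp only [Polynomial.eval_pow, Polynomial.eval_X, h0 (i + 1) (by omega),
        Polynomial.derivative_X_pow, Nat.add_sub_cancel, Polynomial.eval_mul,
        Polynomial.eval_C, mul_assoc, integral_const_mul] at h1
      have h2 : ((i + 1 : ℕ) : ℂ) ≠ 0 := by exact_mod_cast Nat.succ_ne_zero i
      have h3 := neg_eq_zero.1 h1.symm
      exact (mul_eq_zero.1 h3).resolve_left h2)
    exact ⟨Ξ, hΞ, by rw [Function.iterate_succ_apply', hd2, hd]⟩

/-- The space of test functions on the half-line. -/
def halfLineTests : Submodule ℂ (ℝ → ℂ) where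
  carrier := {θ | IsTestOn (Ioi 0) θ}
  zero_mem' := IsTestOn.zero
  add_mem' h h' := h.add h'
  smul_mem' a _ h := h.mul_left (g := fun _ => a) contDiff_const

/-- The weak solutions in `L²(ℝ₊)` of `(d/dv + c)^n G = 0` are polynomials of degree less than `n`
times `e^{-cv}`: a functional that vanishes on the common kernel of the moments of order less than
`n` is a combination of them. -/
theorem exists_polynomial_of_weak {G : ℝ → ℂ} (hG : MemLp G 2 (volume.restrict (Ioi 0))) (c : ℝ)
    (n : ℕ) (h : ∀ η, IsTestOn (Ioi 0) η → ∫ v in Ioi (0 : ℝ), G v * ((expOp c)^[n] η) v = 0) :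
    ∃ P : Polynomial ℂ, P.degree < n ∧ ∀ᵐ v ∂(volume.restrict (Ioi (0 : ℝ))),
      G v = P.eval (v : ℂ) * Complex.exp ((-c * v : ℝ) : ℂ) := by
  have hint : ∀ {η : ℝ → ℂ}, IsTestOn (Ioi 0) η →
      Integrable (fun v => G v * η v) (volume.restrict (Ioi 0)) := fun hη =>
    hG.integrable_mul (hη.memLp _ 2)
  have hintm : ∀ {η : ℝ → ℂ} (i : ℕ), IsTestOn (Ioi 0) η →
      Integrable (fun v : ℝ => (v : ℂ) ^ i * η v) (volume.restrict (Ioi 0)) := fun i hη =>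
    (hη.mul_left (by simpa using! contDiff_polynomial_eval (Polynomial.X ^ i))).integrable _
  let K : halfLineTests →ₗ[ℂ] ℂ :=
    { toFun := fun θ => ∫ v in Ioi (0 : ℝ), G v * (Complex.exp ((c * v : ℝ) : ℂ) * θ.1 v)
      map_add' := fun θ θ' => by
        rw [← integral_add (hint (θ.2.mul_left (contDiff_cexp_ofReal_mul c)))
          (hint (θ'.2.mul_left (contDiff_cexp_ofReal_mul c)))]
        refine integral_congr_ae (Eventually.of_forall fun v => ?_)
        simp only [Submodule.coe_add, Pi.add_apply]
        ring
      map_smul' := fun a θ => by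
        rw [RingHom.id_apply, smul_eq_mul, ← integral_const_mul]
        refine integral_congr_ae (Eventually.of_forall fun v => ?_)
        simp only [Submodule.coe_smul, Pi.smul_apply, smul_eq_mul]
        ring }
  let M : Fin n → halfLineTests →ₗ[ℂ] ℂ := fun i =>
    { toFun := fun θ => ∫ v in Ioi (0 : ℝ), (v : ℂ) ^ (i : ℕ) * θ.1 v
      map_add' := fun θ θ' => by
        rw [← integral_add (hintm i θ.2) (hintm i θ'.2)]
        refine integral_congr_ae (Eventually.of_forall fun v => ?_)
        simp only [Submodule.coe_add, Pi.add_apply]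
        ring
      map_smul' := fun a θ => by
        rw [RingHom.id_apply, smul_eq_mul, ← integral_const_mul]
        refine integral_congr_ae (Eventually.of_forall fun v => ?_)
        simp only [Submodule.coe_smul, Pi.smul_apply, smul_eq_mul]
        ring }
  have hK : K ∈ Submodule.span ℂ (range M) := by
    refine mem_span_of_iInf_ker_le_ker fun θ hθ => ?_
    obtain ⟨Θ, hΘ, hd⟩ := exists_iterated_primitive n θ.2 (fun i hi => by
      have h1 := (Submodule.mem_iInf _).1 hθ ⟨i, hi⟩
      rw [← integral_Ioi_eq_of_isTestOn θ.2]
      exact h1)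
    have h2 := h _ (hΘ.mul_left (contDiff_cexp_ofReal_mul c))
    rw [expOp_iterate_exp_mul c hΘ, hd] at h2
    exact h2
  obtain ⟨a, ha⟩ := (Submodule.mem_span_range_iff_exists_fun ℂ).1 hK
  set P : Polynomial ℂ := ∑ i : Fin n, Polynomial.C (a i) * Polynomial.X ^ (i : ℕ) with hPdef
  have hPe : ∀ v : ℂ, P.eval v = ∑ i : Fin n, a i * v ^ (i : ℕ) := fun v => by
    simp [hPdef, Polynomial.eval_finsetSum]
  have hcont : Continuous fun v : ℝ => P.eval (v : ℂ) * Complex.exp ((-c * v : ℝ) : ℂ) :=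
    (contDiff_polynomial_eval P).continuous.mul (contDiff_cexp_ofReal_mul (-c)).continuous
  have hL : LocallyIntegrable (fun v => G v - P.eval (v : ℂ) * Complex.exp ((-c * v : ℝ) : ℂ))
      (volume.restrict (Ioi 0)) :=
    (hG.locallyIntegrable (by norm_num)).sub hcont.locallyIntegrable
  refine ⟨P, ?_, ?_⟩
  · refine (Polynomial.degree_sum_le _ _).trans_lt ?_
    refine (Finset.sup_lt_iff (WithBot.bot_lt_coe n)).2 fun i _ => ?_
    exact (Polynomial.degree_C_mul_X_pow_le _ _).trans_lt (Nat.cast_lt.2 i.2)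
  · have key := isOpen_Ioi.ae_eq_zero_of_integral_contDiff_smul_eq_zero (U := Ioi (0 : ℝ))
      (hL.locallyIntegrableOn _) (fun g hs hc hsupp => by
        have hg := isTestOn_ofReal hs hc hsupp
        have hθ := hg.mul_left (contDiff_cexp_ofReal_mul (-c))
        have e1 := LinearMap.congr_fun ha ⟨_, hθ⟩
        rw [LinearMap.sum_apply] at e1
        have e2 : K ⟨_, hθ⟩ = ∫ v in Ioi (0 : ℝ), G v * g v := by
          refine integral_congr_ae (Eventually.of_forall fun v => ?_)
          dsimp only
          rw [← mul_assoc (Complex.exp _), ← Complex.exp_add]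
          simp
        have e3 : ∑ i : Fin n, (a i • M i) ⟨_, hθ⟩ = ∫ v in Ioi (0 : ℝ),
            P.eval (v : ℂ) * Complex.exp ((-c * v : ℝ) : ℂ) * g v := by
          have : ∀ v : ℝ, P.eval (v : ℂ) * Complex.exp ((-c * v : ℝ) : ℂ) * g v =
              ∑ i : Fin n, a i * ((v : ℂ) ^ (i : ℕ) * (Complex.exp ((-c * v : ℝ) : ℂ) * g v)) := by
            intro v
            rw [hPe, Finset.sum_mul, Finset.sum_mul]
            refine Finset.sum_congr rfl fun i _ => ?_
            ring
          simp_rw [this]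
          rw [integral_finsetSum _ fun (i : Fin n) _ => (hintm i hθ).const_mul (a i)]
          refine Finset.sum_congr rfl fun i _ => ?_
          rw [integral_const_mul]
          rfl
        rw [e3, e2] at e1
        have e4 : ∀ v, g v • (G v - P.eval (v : ℂ) * Complex.exp ((-c * v : ℝ) : ℂ)) =
            G v * g v - P.eval (v : ℂ) * Complex.exp ((-c * v : ℝ) : ℂ) * g v := fun v => by
          rw [Complex.real_smul]
          ring
        simp_rw [e4]
        have hi2 : Integrable (fun v : ℝ => P.eval (v : ℂ) * Complex.exp ((-c * v : ℝ) : ℂ) * g v)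
            (volume.restrict (Ioi 0)) :=
          (hg.mul_left ((contDiff_polynomial_eval P).mul
            (contDiff_cexp_ofReal_mul (-c)))).integrable _
        rw [integral_sub (hint hg) hi2, e1, sub_self])
    filter_upwards [key, ae_restrict_mem measurableSet_Ioi] with v h1 h2
    exact sub_eq_zero.1 (h1 h2)

/-- No polynomial times a non-decaying exponential is square integrable. -/
theorem polynomial_eq_zero_of_memLp {P : Polynomial ℂ} {c : ℝ} (hc : c ≤ 0)
    (h : MemLp (fun v : ℝ => P.eval (v : ℂ) * Complex.exp ((-c * v : ℝ) : ℂ)) 2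
      (volume.restrict (Ioi 0))) : P = 0 := by
  by_contra hP
  obtain ⟨δ, hδ, N, hN⟩ : ∃ δ > 0, ∃ N : ℝ, ∀ v : ℝ, N < v → δ ≤ ‖P.eval (v : ℂ)‖ := by
    rcases le_or_gt P.degree 0 with hd | hd
    · rw [Polynomial.eq_C_of_degree_le_zero hd] at hP ⊢
      refine ⟨‖P.coeff 0‖, norm_pos_iff.2 fun h0 => hP (by simp [h0]), 0, fun v _ => ?_⟩
      simp
    · have ht : Tendsto (fun v : ℝ => ‖(v : ℂ)‖) atTop atTop := by
        refine tendsto_abs_atTop_atTop.congr fun v => ?_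
        simp
      have := P.tendsto_norm_atTop hd ht
      obtain ⟨N, hN⟩ := eventually_atTop.1 (this.eventually_ge_atTop 1)
      exact ⟨1, one_pos, N, fun v hv => hN v hv.le⟩
  have h1 := h.meas_ge_lt_top (by norm_num) (by norm_num) (ε := ⟨δ, hδ.le⟩)
    (fun h0 => hδ.ne' (congrArg NNReal.toReal h0))
  have h2 : volume (Ioi (max 0 N)) ≤ (volume.restrict (Ioi 0)) {v : ℝ | (⟨δ, hδ.le⟩ : NNReal) ≤
      ‖P.eval (v : ℂ) * Complex.exp ((-c * v : ℝ) : ℂ)‖₊} := by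
    have e : Ioi (max 0 N) = Ioi (max 0 N) ∩ Ioi 0 :=
      (inter_eq_left.2 (Ioi_subset_Ioi (le_max_left _ _))).symm
    rw [e, ← Measure.restrict_apply measurableSet_Ioi]
    refine measure_mono fun v hv => ?_
    rw [mem_Ioi, max_lt_iff] at hv
    change δ ≤ ‖P.eval (v : ℂ) * Complex.exp ((-c * v : ℝ) : ℂ)‖
    rw [norm_mul, Complex.norm_exp, Complex.ofReal_re]
    have h3 : (1 : ℝ) ≤ Real.exp (-c * v) := Real.one_le_exp (by nlinarith [hv.1])
    have h4 := hN v hv.2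
    nlinarith
  rw [Real.volume_Ioi] at h2
  exact absurd (h2.trans_lt h1) (lt_irrefl _)

end HalfLine

/-! ### The scaled Laguerre functions -/

/-- The Laguerre function `ℓ_m` rescaled to a unit vector `√(2c) ℓ_m(2cv)` of `L²(ℝ₊)`. It is zero
for `c ≤ 0`, because the square root is. -/
noncomputable def laguerreKernel (m : ℕ) (c v : ℝ) : ℝ :=
  √(2 * c) * laguerreFun m (2 * c * v)

theorem laguerreKernel_of_nonpos (m : ℕ) {c : ℝ} (hc : c ≤ 0) (v : ℝ) :
    laguerreKernel m c v = 0 := by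
  rw [laguerreKernel, Real.sqrt_eq_zero_of_nonpos (by linarith), zero_mul]

theorem laguerreKernel_eq (m : ℕ) (c v : ℝ) : laguerreKernel m c v =
    √(2 * c) * (laguerrePoly m).eval (2 * c * v) * Real.exp (-c * v) := by
  have h : -(2 * c * v) / 2 = -c * v := by ring
  rw [laguerreKernel, laguerreFun_eq, h, ← mul_assoc]

theorem continuous_laguerreKernel (m : ℕ) :
    Continuous fun p : ℝ × ℝ => laguerreKernel m p.1 p.2 := by
  have := continuous_laguerreFun m
  unfold laguerreKernel
  fun_prop

theorem laguerreKernel_sq (m : ℕ) {c : ℝ} (hc : 0 < c) (v : ℝ) :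
    laguerreKernel m c v ^ 2 = 2 * c * laguerreFun m (2 * c * v) ^ 2 := by
  rw [laguerreKernel, mul_pow, Real.sq_sqrt (by positivity)]

theorem integral_laguerreKernel_sq (m : ℕ) {c : ℝ} (hc : 0 < c) :
    ∫ v in Ioi (0 : ℝ), laguerreKernel m c v ^ 2 = 1 := by
  have h := integral_comp_mul_left_Ioi (fun y => laguerreFun m y ^ 2) 0 (b := 2 * c) (by positivity)
  simp_rw [laguerreKernel_sq m hc]
  rw [integral_const_mul, h, mul_zero, integral_laguerreFun_sq, smul_eq_mul, mul_one]
  exact mul_inv_cancel₀ (by positivity)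

theorem integrableOn_laguerreKernel_sq (m : ℕ) (c : ℝ) :
    IntegrableOn (fun v => laguerreKernel m c v ^ 2) (Ioi 0) := by
  rcases le_or_gt c 0 with hc | hc
  · simp_rw [laguerreKernel_of_nonpos m hc]
    simp
  · refine Integrable.of_integral_ne_zero ?_
    rw [integral_laguerreKernel_sq m hc]
    exact one_ne_zero

theorem continuous_laguerreKernel_right (m : ℕ) (c : ℝ) : Continuous (laguerreKernel m c) :=
  (continuous_laguerreKernel m).comp (Continuous.prodMk_right c)

theorem memLp_laguerreKernel (m : ℕ) (c : ℝ) :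
    MemLp (fun v => (laguerreKernel m c v : ℂ)) 2 (volume.restrict (Ioi 0)) := by
  have h : MemLp (laguerreKernel m c) 2 (volume.restrict (Ioi 0)) :=
    (memLp_two_iff_integrable_sq
      (continuous_laguerreKernel_right m c).aestronglyMeasurable).2
      (integrableOn_laguerreKernel_sq m c)
  exact h.ofReal

theorem integrableOn_pow_exp_laguerreKernel (m i : ℕ) {c : ℝ} (hc : 0 < c) :
    IntegrableOn (fun v => v ^ i * Real.exp (-c * v) * laguerreKernel m c v) (Ioi 0) ∧
    (i < m → ∫ v in Ioi (0 : ℝ), v ^ i * Real.exp (-c * v) * laguerreKernel m c v = 0) := by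
  set p : Polynomial ℝ := Polynomial.C (√(2 * c) * (2 * c)⁻¹ ^ i) * Polynomial.X ^ i with hp
  have e : ∀ v, v ^ i * Real.exp (-c * v) * laguerreKernel m c v =
      (fun t => Real.exp (-t) * (p * laguerrePoly m).eval t) (2 * c * v) := by
    intro v
    have h1 : Real.exp (-(2 * c * v)) = Real.exp (-c * v) * Real.exp (-c * v) := by
      rw [← Real.exp_add]
      congr 1
      ring
    have h2 : (2 * c)⁻¹ ^ i * (2 * c * v) ^ i = v ^ i := by
      rw [← mul_pow, inv_mul_cancel_left₀ (by positivity)]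
    simp only [laguerreKernel_eq, h1, hp, Polynomial.eval_mul, Polynomial.eval_C,
      Polynomial.eval_pow, Polynomial.eval_X]
    rw [← h2]
    ring
  simp_rw [e]
  constructor
  · have := integrableOn_Ioi_comp_mul_left_iff
      (fun t => Real.exp (-t) * (p * laguerrePoly m).eval t) 0 (a := 2 * c) (by positivity)
    rw [this, mul_zero]
    exact integrableOn_exp_neg_mul_eval _
  · intro hi
    have := integral_comp_mul_left_Ioi
      (fun t => Real.exp (-t) * (p * laguerrePoly m).eval t) 0 (b := 2 * c) (by positivity)
    rw [this, mul_zero, integral_laguerrePoly_mul_eq_zero m p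
        ((Polynomial.natDegree_C_mul_X_pow_le _ _).trans_lt hi), smul_zero]

theorem integral_polynomial_exp_mul_laguerreKernel {m : ℕ} {c : ℝ} (hc : 0 < c)
    {S : Polynomial ℂ} (hS : S.degree < m) :
    ∫ v in Ioi (0 : ℝ), S.eval (v : ℂ) * Complex.exp ((-c * v : ℝ) : ℂ) * laguerreKernel m c v =
      0 := by
  have e : ∀ v : ℝ, S.eval (v : ℂ) * Complex.exp ((-c * v : ℝ) : ℂ) * laguerreKernel m c v =
      ∑ i ∈ S.support, S.coeff i *
        ((v ^ i * Real.exp (-c * v) * laguerreKernel m c v : ℝ) : ℂ) := by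
    intro v
    rw [Polynomial.eval_eq_sum, Polynomial.sum_def, Finset.sum_mul, Finset.sum_mul]
    refine Finset.sum_congr rfl fun i _ => ?_
    push_cast
    ring
  simp_rw [e]
  rw [integral_finsetSum _ fun i _ =>
    ((integrableOn_pow_exp_laguerreKernel m i hc).1.ofReal).const_mul _]
  refine Finset.sum_eq_zero fun i hi => ?_
  have him : i < m := by
    have := (Polynomial.le_degree_of_mem_supp i hi).trans_lt hS
    exact Nat.cast_lt.1 this
  rw [integral_const_mul, integral_complex_ofReal, (integrableOn_pow_exp_laguerreKernel m i hc).2 him]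
  simp

/-- The rescaled Laguerre function is a polynomial of degree `m` times `e^{-cv}`. -/
theorem exists_polynomial_laguerreKernel (m : ℕ) {c : ℝ} (hc : 0 < c) : ∃ Q : Polynomial ℂ,
    Q.degree < (m + 1 : ℕ) ∧ Q.coeff m ≠ 0 ∧
      ∀ v : ℝ, laguerreKernel m c v = Q.eval (v : ℂ) * Complex.exp ((-c * v : ℝ) : ℂ) := by
  refine ⟨Polynomial.C (√(2 * c) : ℂ) *
    ((laguerrePoly m).map Complex.ofRealHom).comp (Polynomial.C (2 * c : ℂ) * Polynomial.X),
    ?_, ?_, fun v => ?_⟩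
  · refine (Polynomial.degree_le_natDegree).trans_lt (Nat.cast_lt.2 (Nat.lt_succ_of_le ?_))
    refine (Polynomial.natDegree_C_mul_le _ _).trans (Polynomial.natDegree_comp_le.trans ?_)
    have h1 := Polynomial.natDegree_C_mul_le (2 * (c : ℂ)) Polynomial.X
    have h2 := Polynomial.natDegree_map_le (f := Complex.ofRealHom) (p := laguerrePoly m)
    have h3 := natDegree_laguerrePoly_le m
    rw [Polynomial.natDegree_X] at h1
    nlinarith
  · rw [Polynomial.coeff_C_mul, Polynomial.comp_C_mul_X_coeff, Polynomial.coeff_map,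
      coeff_laguerrePoly]
    have : (m.factorial : ℂ) ≠ 0 := by exact_mod_cast m.factorial_ne_zero
    have hc' : (c : ℂ) ≠ 0 := by exact_mod_cast hc.ne'
    have hs' : ((√(2 * c) : ℝ) : ℂ) ≠ 0 := by
      exact_mod_cast (Real.sqrt_pos.2 (by positivity : 0 < 2 * c)).ne'
    refine mul_ne_zero hs' (mul_ne_zero ?_ (pow_ne_zero _ (mul_ne_zero two_ne_zero hc')))
    simpa using this
  · have h1 : ((laguerrePoly m).map Complex.ofRealHom).eval (2 * (c : ℂ) * v) =
        (((laguerrePoly m).eval (2 * c * v) : ℝ) : ℂ) := by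
      have := Polynomial.eval_map_apply (p := laguerrePoly m) Complex.ofRealHom (2 * c * v)
      simpa using this
    rw [laguerreKernel_eq]
    simp only [Polynomial.eval_mul, Polynomial.eval_C, Polynomial.eval_comp, Polynomial.eval_X, h1]
    push_cast
    ring

/-- The Laguerre function spans the polynomials of degree `m` modulo those of lower degree. -/
theorem exists_sub_laguerreKernel {m : ℕ} {c : ℝ} (hc : 0 < c) {P : Polynomial ℂ}
    (hP : P.degree < (m + 1 : ℕ)) : ∃ (S : Polynomial ℂ) (a : ℂ), S.degree < m ∧
      ∀ v : ℝ, P.eval (v : ℂ) * Complex.exp ((-c * v : ℝ) : ℂ) =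
        S.eval (v : ℂ) * Complex.exp ((-c * v : ℝ) : ℂ) + a * laguerreKernel m c v := by
  obtain ⟨Q, hQd, hQc, hQe⟩ := exists_polynomial_laguerreKernel m hc
  refine ⟨P - Polynomial.C (P.coeff m / Q.coeff m) * Q, P.coeff m / Q.coeff m, ?_, fun v => ?_⟩
  · rw [Polynomial.degree_lt_iff_coeff_zero] at hP hQd ⊢
    intro i hi
    rw [Polynomial.coeff_sub, Polynomial.coeff_C_mul]
    rcases hi.eq_or_lt with rfl | hi
    · rw [div_mul_cancel₀ _ hQc, sub_self]
    · rw [hP i hi, hQd i hi]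
      simp
  · rw [hQe, Polynomial.eval_sub, Polynomial.eval_mul, Polynomial.eval_C]
    ring

theorem integral_laguerreKernel_mul_self (m : ℕ) {c : ℝ} (hc : 0 < c) :
    ∫ v in Ioi (0 : ℝ), (laguerreKernel m c v : ℂ) * laguerreKernel m c v = 1 := by
  have := integral_laguerreKernel_sq m hc
  simp_rw [← Complex.ofReal_mul, ← sq]
  rw [integral_complex_ofReal, this, Complex.ofReal_one]

theorem memLp_polynomial_exp (P : Polynomial ℂ) {c : ℝ} (hc : 0 < c) :
    MemLp (fun v : ℝ => P.eval (v : ℂ) * Complex.exp ((-c * v : ℝ) : ℂ)) 2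
      (volume.restrict (Ioi 0)) := by
  have e : (fun v : ℝ => P.eval (v : ℂ) * Complex.exp ((-c * v : ℝ) : ℂ)) =
      fun v : ℝ => ∑ i ∈ P.support, P.coeff i * ((v ^ i * Real.exp (-c * v) : ℝ) : ℂ) := by
    funext v
    rw [Polynomial.eval_eq_sum, Polynomial.sum_def, Finset.sum_mul]
    refine Finset.sum_congr rfl fun i _ => ?_
    push_cast
    ring
  rw [e]
  refine memLp_finsetSum _ fun i _ => MemLp.const_mul ?_ _
  have hcont : Continuous fun v : ℝ => v ^ i * Real.exp (-c * v) := by fun_prop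
  have h : MemLp (fun v : ℝ => v ^ i * Real.exp (-c * v)) 2 (volume.restrict (Ioi 0)) := by
    refine (memLp_two_iff_integrable_sq hcont.aestronglyMeasurable).2 ?_
    have h1 : ∀ v : ℝ, (v ^ i * Real.exp (-c * v)) ^ 2 = ((2 * c)⁻¹ ^ (2 * i)) *
        (fun t => Real.exp (-t) * (Polynomial.X ^ (2 * i)).eval t) (2 * c * v) := by
      intro v
      have h1 : Real.exp (-(2 * c * v)) = Real.exp (-c * v) * Real.exp (-c * v) := by
        rw [← Real.exp_add]
        congr 1
        ring
      have h2 : (2 * c)⁻¹ ^ (2 * i) * (2 * c * v) ^ (2 * i) = v ^ (2 * i) := by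
        rw [← mul_pow, inv_mul_cancel_left₀ (by positivity)]
      simp only [h1, Polynomial.eval_pow, Polynomial.eval_X]
      linear_combination (-(Real.exp (-c * v) * Real.exp (-c * v))) * h2
    simp_rw [h1]
    refine Integrable.const_mul ?_ _
    have := integrableOn_Ioi_comp_mul_left_iff
      (fun t => Real.exp (-t) * (Polynomial.X ^ (2 * i)).eval t) 0 (a := 2 * c) (by positivity)
    rw [mul_zero] at this
    exact this.2 (integrableOn_exp_neg_mul_eval _)
  exact h.ofReal

/-- Removing the component along the Laguerre function from a polynomial of degree at most `m` times
`e^{-cv}` lowers the degree of the polynomial. -/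
theorem exists_polynomial_sub_projection {m : ℕ} {c : ℝ} {G : ℝ → ℂ}
    (hG : MemLp G 2 (volume.restrict (Ioi 0)))
    (h : ∃ P : Polynomial ℂ, P.degree < (m + 1 : ℕ) ∧ ∀ᵐ v ∂(volume.restrict (Ioi (0 : ℝ))),
      G v = P.eval (v : ℂ) * Complex.exp ((-c * v : ℝ) : ℂ)) :
    ∃ S : Polynomial ℂ, S.degree < m ∧ ∀ᵐ v ∂(volume.restrict (Ioi (0 : ℝ))),
      G v - laguerreKernel m c v * ∫ w in Ioi (0 : ℝ), G w * laguerreKernel m c w =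
        S.eval (v : ℂ) * Complex.exp ((-c * v : ℝ) : ℂ) := by
  obtain ⟨P, hP, hGP⟩ := h
  rcases le_or_gt c 0 with hc | hc
  · have h0 := polynomial_eq_zero_of_memLp hc (hG.ae_eq hGP)
    refine ⟨0, by simp, ?_⟩
    filter_upwards [hGP] with v hv
    simp [hv, h0, laguerreKernel_of_nonpos m hc]
  · obtain ⟨S, a, hS, hPS⟩ := exists_sub_laguerreKernel hc hP
    refine ⟨S, hS, ?_⟩
    have h1 : ∫ w in Ioi (0 : ℝ), G w * laguerreKernel m c w = a := by
      have e : ∀ᵐ w ∂(volume.restrict (Ioi (0 : ℝ))), G w * laguerreKernel m c w =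
          S.eval (w : ℂ) * Complex.exp ((-c * w : ℝ) : ℂ) * laguerreKernel m c w +
            a * ((laguerreKernel m c w : ℂ) * laguerreKernel m c w) := by
        filter_upwards [hGP] with w hw
        rw [hw, hPS]
        ring
      rw [integral_congr_ae e, integral_add, integral_polynomial_exp_mul_laguerreKernel hc hS,
        integral_const_mul, integral_laguerreKernel_mul_self m hc, zero_add, mul_one]
      · exact (memLp_polynomial_exp S hc).integrable_mul (memLp_laguerreKernel m c)
      · exact ((memLp_laguerreKernel m c).integrable_mul (memLp_laguerreKernel m c)).const_mul a
    filter_upwards [hGP] with v hv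
    rw [h1, hv, hPS]
    ring

/-! ### Partial integration against square integrable kernels -/

section Kernels

variable {X Y : Type*} [MeasurableSpace X] [MeasurableSpace Y] {μ : Measure X} {ν : Measure Y}
  [SFinite ν]

theorem lintegral_enorm_sq_lt_top {α : Type*} [MeasurableSpace α] {ρ : Measure α} {f : α → ℂ}
    (hf : MemLp f 2 ρ) : ∫⁻ x, ‖f x‖ₑ ^ (2 : ℝ) ∂ρ < ⊤ := by
  rw [← eLpNorm_two_rpow]
  exact ENNReal.rpow_lt_top_of_nonneg (by norm_num) hf.2.ne

theorem memLp_two_of_lintegral_lt_top {α : Type*} [MeasurableSpace α] {ρ : Measure α} {f : α → ℂ}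
    (hm : AEStronglyMeasurable f ρ) (h : ∫⁻ x, ‖f x‖ₑ ^ (2 : ℝ) ∂ρ < ⊤) : MemLp f 2 ρ := by
  refine ⟨hm, ?_⟩
  rw [← eLpNorm_two_rpow] at h
  by_contra hn
  rw [not_lt, top_le_iff] at hn
  rw [hn, ENNReal.top_rpow_of_pos (by norm_num)] at h
  exact lt_irrefl _ h

/-- Partial integration against a kernel that is bounded in `L²` maps `L²` to `L²`. -/
theorem memLp_integral_mul {F E : X × Y → ℂ} (hF : MemLp F 2 (μ.prod ν))
    (hE : AEStronglyMeasurable E (μ.prod ν)) {C : ℝ≥0∞} (hC : C ≠ ⊤)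
    (hEC : ∀ x, ∫⁻ y, ‖E (x, y)‖ₑ ^ (2 : ℝ) ∂ν ≤ C) :
    MemLp (fun x => ∫ y, F (x, y) * E (x, y) ∂ν) 2 μ := by
  refine memLp_two_of_lintegral_lt_top (hF.1.mul hE).integral_prod_right' ?_
  have h1 : ∀ᵐ x ∂μ, ‖∫ y, F (x, y) * E (x, y) ∂ν‖ₑ ^ (2 : ℝ) ≤
      (∫⁻ y, ‖F (x, y)‖ₑ ^ (2 : ℝ) ∂ν) * C := by
    filter_upwards [hF.1.prodMk_left, hE.prodMk_left] with x h1 h2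
    have h3 : ‖∫ y, F (x, y) * E (x, y) ∂ν‖ₑ ≤ (∫⁻ y, ‖F (x, y)‖ₑ ^ (2 : ℝ) ∂ν) ^ (1 / 2 : ℝ) *
        C ^ (1 / 2 : ℝ) := by
      calc ‖∫ y, F (x, y) * E (x, y) ∂ν‖ₑ ≤ ∫⁻ y, ‖F (x, y) * E (x, y)‖ₑ ∂ν :=
            enorm_integral_le_lintegral_enorm _
        _ = ∫⁻ y, ((fun y => ‖F (x, y)‖ₑ) * fun y => ‖E (x, y)‖ₑ) y ∂ν := by
            simp only [enorm_mul, Pi.mul_apply]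
        _ ≤ _ := ENNReal.lintegral_mul_le_Lp_mul_Lq ν Real.HolderConjugate.two_two h1.enorm h2.enorm
        _ ≤ _ := by
            gcongr
            exact hEC x
    calc ‖∫ y, F (x, y) * E (x, y) ∂ν‖ₑ ^ (2 : ℝ) ≤ ((∫⁻ y, ‖F (x, y)‖ₑ ^ (2 : ℝ) ∂ν) ^ (1 / 2 : ℝ) *
        C ^ (1 / 2 : ℝ)) ^ (2 : ℝ) := by gcongr
      _ = _ := by
        rw [ENNReal.mul_rpow_of_nonneg _ _ (by norm_num), ← ENNReal.rpow_mul, ← ENNReal.rpow_mul]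
        norm_num
  refine (lintegral_mono_ae h1).trans_lt ?_
  rw [lintegral_mul_const' _ _ hC, ← lintegral_prod _ (hF.1.enorm.pow_const _)]
  exact ENNReal.mul_lt_top (lintegral_enorm_sq_lt_top hF) hC.lt_top

theorem memLp_mul_kernel {g : X → ℂ} {E : X × Y → ℂ} (hg : MemLp g 2 μ)
    (hE : AEStronglyMeasurable E (μ.prod ν)) {C : ℝ≥0∞} (hC : C ≠ ⊤)
    (hEC : ∀ x, ∫⁻ y, ‖E (x, y)‖ₑ ^ (2 : ℝ) ∂ν ≤ C) :
    MemLp (fun p : X × Y => g p.1 * E p) 2 (μ.prod ν) := by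
  have hm : AEStronglyMeasurable (fun p : X × Y => g p.1 * E p) (μ.prod ν) :=
    hg.1.comp_fst.mul hE
  refine memLp_two_of_lintegral_lt_top hm ?_
  rw [lintegral_prod _ (hm.enorm.pow_const _)]
  have h1 : ∀ x, ∫⁻ y, ‖g x * E (x, y)‖ₑ ^ (2 : ℝ) ∂ν ≤ ‖g x‖ₑ ^ (2 : ℝ) * C := by
    intro x
    simp_rw [enorm_mul, ENNReal.mul_rpow_of_nonneg _ _ (zero_le_two : (0 : ℝ) ≤ 2)]
    rw [lintegral_const_mul' _ _ (ENNReal.rpow_ne_top_of_nonneg (by norm_num) enorm_ne_top)]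
    gcongr
    exact hEC x
  refine (lintegral_mono h1).trans_lt ?_
  rw [lintegral_mul_const' _ _ hC]
  exact ENNReal.mul_lt_top (lintegral_enorm_sq_lt_top hg) hC.lt_top

theorem memLp_integral_mul_right {F : X × Y → ℂ} {e : Y → ℂ} (hF : MemLp F 2 (μ.prod ν))
    (he : MemLp e 2 ν) : MemLp (fun x => ∫ y, F (x, y) * e y ∂ν) 2 μ :=
  memLp_integral_mul (E := fun p => e p.2) hF he.1.comp_snd (lintegral_enorm_sq_lt_top he).ne
    fun _ => le_rfl

theorem memLp_tensor {g : X → ℂ} {e : Y → ℂ} (hg : MemLp g 2 μ) (he : MemLp e 2 ν) :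
    MemLp (fun p : X × Y => g p.1 * e p.2) 2 (μ.prod ν) :=
  memLp_mul_kernel (E := fun p => e p.2) hg he.1.comp_snd (lintegral_enorm_sq_lt_top he).ne
    fun _ => le_rfl

theorem memLp_swap [SFinite μ] {F : X × Y → ℂ} (hF : MemLp F 2 (μ.prod ν)) :
    MemLp (fun p : Y × X => F (p.2, p.1)) 2 (ν.prod μ) :=
  hF.comp_measurePreserving (Measure.measurePreserving_swap (μ := ν) (ν := μ))

end Kernels

/-! ### The operator `∂/∂z̄ - cz` in the plane -/

/-- The operator `∂/∂z̄ - c z`. -/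
noncomputable def dbarOp (c : ℝ) (ψ : ℂ → ℂ) (z : ℂ) : ℂ :=
  1 / 2 * fderiv ℝ ψ z 1 + Complex.I / 2 * fderiv ℝ ψ z Complex.I - c * z * ψ z

/-- The Gaussian `e^{-a|z|²}`. -/
noncomputable def gaussian (a : ℝ) (z : ℂ) : ℂ := Complex.exp ((-a * ‖z‖ ^ 2 : ℝ) : ℂ)

theorem norm_gaussian (a : ℝ) (z : ℂ) : ‖gaussian a z‖ = Real.exp (-a * ‖z‖ ^ 2) := by
  rw [gaussian, Complex.norm_exp, Complex.ofReal_re]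

theorem gaussian_mul_gaussian (a b : ℝ) (z : ℂ) : gaussian a z * gaussian b z =
    gaussian (a + b) z := by
  rw [gaussian, gaussian, gaussian, ← Complex.exp_add]
  congr 1
  push_cast
  ring

theorem gaussian_zero (z : ℂ) : gaussian 0 z = 1 := by simp [gaussian]

theorem contDiff_gaussian (a : ℝ) : ContDiff ℝ ∞ (gaussian a) :=
  (Complex.ofRealCLM.contDiff.comp (f := fun z : ℂ => -a * ‖z‖ ^ 2)
    (contDiff_const.mul (contDiff_id.norm_sq ℝ))).cexp

theorem fderiv_gaussian (a : ℝ) (z w : ℂ) :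
    fderiv ℝ (gaussian a) z w = -2 * a * inner ℝ z w * gaussian a z := by
  have h1 : HasFDerivAt (fun z : ℂ => ((-a * ‖z‖ ^ 2 : ℝ) : ℂ)) _ z :=
    Complex.ofRealCLM.hasFDerivAt.comp z ((hasStrictFDerivAt_norm_sq z).hasFDerivAt.const_mul (-a))
  have h2 : HasFDerivAt (gaussian a) _ z := h1.cexp
  rw [h2.fderiv]
  simp [gaussian]
  ring

theorem dbarOp_mul (c : ℝ) {g ψ : ℂ → ℂ} {z : ℂ} (hg : DifferentiableAt ℝ g z)
    (hψ : DifferentiableAt ℝ ψ z) :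
    dbarOp c (fun z => g z * ψ z) z = g z * dbarOp c ψ z + dbarOp 0 g z * ψ z := by
  simp only [dbarOp, fderiv_fun_mul hg hψ]
  simp
  ring

theorem dbarOp_gaussian (a : ℝ) (z : ℂ) : dbarOp 0 (gaussian a) z = -a * z * gaussian a z := by
  rw [dbarOp, fderiv_gaussian, fderiv_gaussian]
  have hz : z = (z.re : ℂ) + z.im * Complex.I := (Complex.re_add_im _).symm
  have h1 : (inner ℝ z 1 : ℝ) = z.re := by simp [Complex.inner]
  have h2 : (inner ℝ z Complex.I : ℝ) = z.im := by simp [Complex.inner]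
  rw [h1, h2]
  push_cast
  linear_combination (a * gaussian a z) * hz

theorem contDiff_dbarOp (c : ℝ) {ψ : ℂ → ℂ} (h : ContDiff ℝ ∞ ψ) : ContDiff ℝ ∞ (dbarOp c ψ) := by
  have hd : ContDiff ℝ ∞ (fderiv ℝ ψ) := h.fderiv_right (by simp)
  unfold dbarOp
  fun_prop

theorem contDiff_dbarOp_iterate (c : ℝ) {ψ : ℂ → ℂ} (h : ContDiff ℝ ∞ ψ) (n : ℕ) :
    ContDiff ℝ ∞ ((dbarOp c)^[n] ψ) := by
  induction n with
  | zero => exact h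
  | succ n ih =>
    rw [Function.iterate_succ_apply']
    exact contDiff_dbarOp c ih

theorem differentiable_dbarOp_iterate (c : ℝ) {ψ : ℂ → ℂ} (h : ContDiff ℝ ∞ ψ) (n : ℕ) :
    Differentiable ℝ ((dbarOp c)^[n] ψ) :=
  (contDiff_dbarOp_iterate c h n).differentiable (by simp)

theorem IsTestOn.dbarOp {U : Set ℂ} {ψ : ℂ → ℂ} (h : IsTestOn U ψ) (c : ℝ) :
    IsTestOn U (dbarOp c ψ) := by
  refine h.of_support_subset (contDiff_dbarOp c h.smooth) fun z hz => ?_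
  by_contra hn
  have h0 : fderiv ℝ ψ z = 0 := by
    by_contra h1
    exact hn (support_fderiv_subset ℝ h1)
  exact hz (by simp [_root_.dbarOp, h0, image_eq_zero_of_notMem_tsupport hn])

theorem IsTestOn.dbarOp_iterate {U : Set ℂ} {ψ : ℂ → ℂ} (h : IsTestOn U ψ) (c : ℝ) (n : ℕ) :
    IsTestOn U ((_root_.dbarOp c)^[n] ψ) := by
  induction n with
  | zero => exact h
  | succ n ih =>
    rw [Function.iterate_succ_apply']
    exact ih.dbarOp c

theorem dbarOp_iterate_const_mul (c : ℝ) (a : ℂ) {ψ : ℂ → ℂ} (h : ContDiff ℝ ∞ ψ) (n : ℕ) :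
    (dbarOp c)^[n] (fun z => a * ψ z) = fun z => a * ((dbarOp c)^[n] ψ) z := by
  induction n with
  | zero => rfl
  | succ n ih =>
    rw [Function.iterate_succ_apply', Function.iterate_succ_apply', ih]
    funext z
    rw [dbarOp_mul c (differentiableAt_const a) (differentiable_dbarOp_iterate c h n z)]
    simp [dbarOp]

/-- Conjugation with a Gaussian shifts the parameter of the operator. -/
theorem dbarOp_iterate_gaussian_mul (c a : ℝ) {ψ : ℂ → ℂ} (h : ContDiff ℝ ∞ ψ) (n : ℕ) :
    (dbarOp c)^[n] (fun z => gaussian a z * ψ z) =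
      fun z => gaussian a z * ((dbarOp (c + a))^[n] ψ) z := by
  induction n with
  | zero => rfl
  | succ n ih =>
    rw [Function.iterate_succ_apply', Function.iterate_succ_apply', ih]
    funext z
    rw [dbarOp_mul c ((contDiff_gaussian a).differentiable (by simp) z)
      (differentiable_dbarOp_iterate _ h n z), dbarOp_gaussian]
    simp only [dbarOp]
    push_cast
    ring

theorem dbarOp_conj_pow (p : ℕ) (z : ℂ) :
    dbarOp 0 (fun z => (starRingEnd ℂ) z ^ (p + 1)) z = (p + 1 : ℕ) * (starRingEnd ℂ) z ^ p := by
  have h1 : HasFDerivAt (fun z : ℂ => (starRingEnd ℂ) z) (Complex.conjCLE : ℂ →L[ℝ] ℂ) z :=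
    Complex.conjCLE.hasFDerivAt
  induction p with
  | zero =>
    simp only [zero_add, pow_one]
    rw [dbarOp, h1.fderiv]
    simp
    linear_combination (-(1 / 2 : ℂ)) * Complex.I_sq
  | succ p ih =>
    have h2 : DifferentiableAt ℝ (fun z : ℂ => (starRingEnd ℂ) z ^ (p + 1)) z :=
      h1.differentiableAt.fun_pow (p + 1)
    have h3 := dbarOp_mul 0 h2 h1.differentiableAt
    simp_rw [← pow_succ] at h3
    rw [h3, ih, dbarOp, h1.fderiv]
    push_cast
    simp
    linear_combination (-(1 / 2 : ℂ) * (starRingEnd ℂ) z ^ (p + 1)) * Complex.I_sq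

theorem contDiff_conj_pow (p : ℕ) : ContDiff ℝ ∞ fun z : ℂ => (starRingEnd ℂ) z ^ p :=
  (Complex.conjCLE.contDiff).pow p

theorem integral_mul_dbarOp {g θ : ℂ → ℂ} (hg : ContDiff ℝ ∞ g) (h : IsTestOn univ θ) :
    ∫ z, g z * dbarOp 0 θ z = -∫ z, dbarOp 0 g z * θ z := by
  have hgd : ContDiff ℝ ∞ (fderiv ℝ g) := hg.fderiv_right (by simp)
  have key : ∀ w : ℂ, ∫ z, g z * fderiv ℝ θ z w = -∫ z, fderiv ℝ g z w * θ z := fun w =>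
    integral_mul_fderiv_eq_neg_fderiv_mul_of_integrable
      ((h.mul_left (g := fun z => fderiv ℝ g z w) (by fun_prop)).integrable _)
      (((h.fderiv_apply w).mul_left hg).integrable _) ((h.mul_left hg).integrable _)
      (fun z _ => hg.differentiable (by simp) z) (fun z _ => h.smooth.differentiable (by simp) z)
  have e1 : ∀ z, g z * dbarOp 0 θ z =
      1 / 2 * (g z * fderiv ℝ θ z 1) + Complex.I / 2 * (g z * fderiv ℝ θ z Complex.I) := fun z => by
    simp only [dbarOp]
    push_cast
    ring
  have e2 : ∀ z, dbarOp 0 g z * θ z =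
      1 / 2 * (fderiv ℝ g z 1 * θ z) + Complex.I / 2 * (fderiv ℝ g z Complex.I * θ z) := fun z => by
    simp only [dbarOp]
    push_cast
    ring
  simp_rw [e1, e2]
  rw [integral_add, integral_add, integral_const_mul, integral_const_mul, integral_const_mul,
    integral_const_mul, key, key]
  · ring
  all_goals refine Integrable.const_mul ?_ _
  · exact (h.mul_left (g := fun z => fderiv ℝ g z 1) (by fun_prop)).integrable _
  · exact (h.mul_left (g := fun z => fderiv ℝ g z Complex.I) (by fun_prop)).integrable _
  · exact ((h.fderiv_apply _).mul_left hg).integrable _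
  · exact ((h.fderiv_apply _).mul_left hg).integrable _

theorem integral_conj_pow_mul_dbarOp (p : ℕ) {θ : ℂ → ℂ} (h : IsTestOn univ θ) :
    ∫ z, (starRingEnd ℂ) z ^ p * ((dbarOp 0)^[p + 1] θ) z = 0 := by
  induction p with
  | zero =>
    have := integral_mul_dbarOp (g := fun _ => 1) contDiff_const h
    simpa [dbarOp] using! this
  | succ p ih =>
    rw [Function.iterate_succ_apply',
      integral_mul_dbarOp (contDiff_conj_pow _) (h.dbarOp_iterate 0 (p + 1))]
    simp_rw [dbarOp_conj_pow, mul_assoc]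
    rw [integral_const_mul, ih]
    simp

/-- `z̄^p e^{-c|z|²}` is a weak solution of `(∂/∂z̄ + cz)^{p+1} h = 0`. -/
theorem integral_conj_pow_gaussian_mul_dbarOp (c : ℝ) (p : ℕ) {ψ : ℂ → ℂ} (h : IsTestOn univ ψ) :
    ∫ z, (starRingEnd ℂ) z ^ p * gaussian c z * ((dbarOp c)^[p + 1] ψ) z = 0 := by
  have h1 : ψ = fun z => gaussian (-c) z * (gaussian c z * ψ z) := by
    funext z
    rw [← mul_assoc, gaussian_mul_gaussian, neg_add_cancel, gaussian_zero, one_mul]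
  have hθ := h.mul_left (contDiff_gaussian c)
  rw [h1, dbarOp_iterate_gaussian_mul c (-c) hθ.smooth, add_neg_cancel,
    ← integral_conj_pow_mul_dbarOp p hθ]
  refine integral_congr_ae (Eventually.of_forall fun z => ?_)
  have h2 := gaussian_mul_gaussian c (-c) z
  rw [add_neg_cancel, gaussian_zero] at h2
  dsimp only
  linear_combination ((starRingEnd ℂ) z ^ p *
    ((dbarOp 0)^[p + 1] (fun z => gaussian c z * ψ z)) z) * h2

theorem dbarOp_polynomial (P : Polynomial ℂ) (z : ℂ) : dbarOp 0 (fun z => P.eval z) z = 0 := by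
  have h : HasFDerivAt (fun z : ℂ => P.eval z) _ z := (P.hasDerivAt z).hasFDerivAt.restrictScalars ℝ
  rw [dbarOp, h.fderiv]
  simp
  linear_combination (1 / 2 * (Polynomial.derivative P).eval z) * Complex.I_sq

theorem dbarOp_finsetSum (c : ℝ) {ι : Type*} (s : Finset ι) {f : ι → ℂ → ℂ} (z : ℂ)
    (h : ∀ i ∈ s, DifferentiableAt ℝ (f i) z) :
    dbarOp c (fun z => ∑ i ∈ s, f i z) z = ∑ i ∈ s, dbarOp c (f i) z := by
  simp only [dbarOp, fderiv_fun_sum h, _root_.sum_apply, Finset.mul_sum, Finset.sum_sub_distrib,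
    Finset.sum_add_distrib]

/-- Multiplication by `z` commutes with `∂/∂z̄`, so that `(∂/∂z̄ - cz)^p` expands like a binomial. -/
theorem exists_dbarOp_iterate_eq_sum (c : ℝ) (p : ℕ) : ∃ P : ℕ → Polynomial ℂ,
    P 0 = (Polynomial.C (-c : ℂ) * Polynomial.X) ^ p ∧ (∀ i, p < i → P i = 0) ∧
      ∀ ψ : ℂ → ℂ, ContDiff ℝ ∞ ψ → (dbarOp c)^[p] ψ = fun z =>
        ∑ i ∈ Finset.range (p + 1), (P i).eval z * ((dbarOp 0)^[i] ψ) z := by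
  induction p with
  | zero => exact ⟨fun i => if i = 0 then 1 else 0, by simp, fun i hi => if_neg hi.ne', by simp⟩
  | succ p ih =>
    obtain ⟨P, hP0, hPz, hP⟩ := ih
    refine ⟨fun i => (Polynomial.C (-c : ℂ) * Polynomial.X) * P i +
      (if i = 0 then 0 else P (i - 1)), ?_, fun i hi => ?_, fun ψ hψ => ?_⟩
    · simp [hP0, pow_succ']
    · simp [hPz i (by omega), hPz (i - 1) (by omega)]
    · rw [Function.iterate_succ_apply', hP ψ hψ]
      funext z
      have hd : ∀ i, DifferentiableAt ℝ ((dbarOp 0)^[i] ψ) z := fun i =>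
        differentiable_dbarOp_iterate 0 hψ i z
      have hdP : ∀ i, DifferentiableAt ℝ (fun z => (P i).eval z) z := fun i =>
        (contDiff_polynomial _).differentiable (by simp) z
      rw [dbarOp_finsetSum c _ z fun i _ => (hdP i).fun_mul (hd i)]
      have e : ∀ i, dbarOp c (fun z => (P i).eval z * ((dbarOp 0)^[i] ψ) z) z =
          (P i).eval z * ((dbarOp 0)^[i + 1] ψ) z + (-c * z) * (P i).eval z *
            ((dbarOp 0)^[i] ψ) z := by
        intro i
        rw [dbarOp_mul c (hdP i) (hd i), dbarOp_polynomial, Function.iterate_succ_apply']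
        simp only [dbarOp]
        push_cast
        ring
      simp_rw [e]
      simp only [Polynomial.eval_add, Polynomial.eval_mul, Polynomial.eval_C, Polynomial.eval_X,
        add_mul, Finset.sum_add_distrib]
      rw [add_comm]
      congr 1
      · rw [Finset.sum_range_succ _ (p + 1), hPz (p + 1) (by omega)]
        simp
      · rw [Finset.sum_range_succ' _ (p + 1)]
        simp

theorem dbarOp_iterate_comp_mul (r : ℝ) {χ : ℂ → ℂ} (h : ContDiff ℝ ∞ χ) (i : ℕ) :
    (dbarOp 0)^[i] (fun z => χ (r * z)) = fun z => r ^ i * ((dbarOp 0)^[i] χ) (r * z) := by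
  induction i with
  | zero => simp
  | succ i ih =>
    rw [Function.iterate_succ_apply', Function.iterate_succ_apply', ih]
    funext z
    set θ := (dbarOp 0)^[i] χ with hθ
    have h1 : HasFDerivAt (fun z : ℂ => (r : ℂ) * z) _ z :=
      (hasFDerivAt_id (𝕜 := ℝ) z).const_mul (r : ℂ)
    have h2 : HasFDerivAt (fun z => θ (r * z)) _ z :=
      ((differentiable_dbarOp_iterate 0 h i (r * z)).hasFDerivAt).comp z h1
    have h3 := h2.const_mul ((r : ℂ) ^ i)
    rw [dbarOp, h3.fderiv, dbarOp]
    simp [← hθ]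
    ring

theorem memLp_pow_mul_gaussian (n : ℕ) {c : ℝ} (hc : 0 < c) :
    MemLp (fun z : ℂ => z ^ n * gaussian c z) 2 := by
  have hcont : Continuous fun z : ℂ => z ^ n * gaussian c z :=
    (continuous_pow n).mul (contDiff_gaussian c).continuous
  refine (memLp_two_iff_integrable_sq_norm hcont.aestronglyMeasurable).2 ?_
  have h := Complex.integral_rpow_mul_exp_neg_mul_rpow (p := 2) (q := 2 * n) (b := 2 * c)
    (by norm_num) (by linarith [Nat.cast_nonneg (α := ℝ) n]) (by positivity)
  have hi : Integrable fun x : ℂ => ‖x‖ ^ (2 * n : ℝ) * Real.exp (-(2 * c) * ‖x‖ ^ (2 : ℝ)) := by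
    refine Integrable.of_integral_ne_zero ?_
    rw [h]
    have := Real.Gamma_pos_of_pos (s := (2 * n + 2 : ℝ) / 2) (by positivity)
    positivity
  refine hi.congr (Eventually.of_forall fun z => ?_)
  dsimp only
  rw [norm_mul, norm_pow, norm_gaussian, mul_pow, ← Real.exp_nat_mul, ← pow_mul]
  have e2 : ‖z‖ ^ (2 * n : ℝ) = ‖z‖ ^ (n * 2) := by
    rw [mul_comm, ← Real.rpow_natCast]
    push_cast
    rfl
  rw [e2, Real.rpow_two]
  congr 2
  push_cast
  ring

theorem memLp_polynomial_mul_gaussian (P : Polynomial ℂ) {c : ℝ} (hc : 0 < c) :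
    MemLp (fun z : ℂ => P.eval z * gaussian c z) 2 := by
  have e : (fun z : ℂ => P.eval z * gaussian c z) =
      fun z => ∑ i ∈ P.support, P.coeff i * (z ^ i * gaussian c z) := by
    funext z
    rw [Polynomial.eval_eq_sum, Polynomial.sum_def, Finset.sum_mul]
    exact Finset.sum_congr rfl fun i _ => mul_assoc _ _ _
  rw [e]
  exact memLp_finsetSum _ fun i _ => (memLp_pow_mul_gaussian i hc).const_mul _

/-- Square integrable weak solutions of `(∂/∂z̄ + cz)^p G = 0` are orthogonal to `z̄^p e^{-c|z|²}`,
which is the limit of `(∂/∂z̄ - cz)^p` applied to cut-off Gaussians, up to a conjugation and a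
factor. -/
theorem integral_mul_pow_gaussian_eq_zero {G : ℂ → ℂ} (hG : MemLp G 2) {c : ℝ} (hc : 0 < c) (p : ℕ)
    {χ : ℂ → ℂ} (hχ : IsTestOn univ χ) (hχ0 : χ 0 = 1)
    (h : ∀ n : ℕ, ∫ z, G z * ((dbarOp c)^[p]
      (fun z => gaussian c z * χ ((((n : ℝ) + 1)⁻¹ : ℝ) * z))) z = 0) :
    ∫ z, G z * (z ^ p * gaussian c z) = 0 := by
  obtain ⟨P, hP0, -, hP⟩ := exists_dbarOp_iterate_eq_sum (c + c) p
  choose C hC using fun i => (hχ.dbarOp_iterate 0 i).compact.exists_bound_of_continuous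
    (hχ.dbarOp_iterate 0 i).smooth.continuous
  have hC0 : ∀ i, 0 ≤ C i := fun i => (norm_nonneg _).trans (hC i 0)
  set r : ℕ → ℝ := fun n => ((n : ℝ) + 1)⁻¹ with hr
  have hr1 : ∀ n, |r n| ≤ 1 := fun n => by
    rw [abs_of_nonneg (by positivity)]
    exact inv_le_one_of_one_le₀ (by linarith [Nat.cast_nonneg (α := ℝ) n])
  have hr0 : Tendsto r atTop (𝓝 0) := by
    simpa [hr] using! tendsto_one_div_add_atTop_nhds_zero_nat (𝕜 := ℝ)
  have hs : ∀ n, ContDiff ℝ ∞ fun z : ℂ => χ (r n * z) := fun n =>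
    hχ.smooth.comp (by fun_prop)
  have e1 : ∀ n z, ((dbarOp c)^[p] (fun z => gaussian c z * χ (r n * z))) z =
      ∑ i ∈ Finset.range (p + 1),
        (P i).eval z * gaussian c z * ((r n : ℂ) ^ i * ((dbarOp 0)^[i] χ) (r n * z)) := by
    intro n z
    rw [dbarOp_iterate_gaussian_mul c c (hs n), hP _ (hs n)]
    dsimp only
    rw [Finset.mul_sum]
    refine Finset.sum_congr rfl fun i _ => ?_
    rw [dbarOp_iterate_comp_mul (r n) hχ.smooth]
    ring
  have hlim : Tendsto (fun n => ∫ z, G z * ((dbarOp c)^[p]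
      (fun z => gaussian c z * χ (r n * z))) z) atTop
      (𝓝 (∫ z, G z * ((P 0).eval z * gaussian c z))) := by
    refine tendsto_integral_of_dominated_convergence
      (fun z => ∑ i ∈ Finset.range (p + 1), C i * ‖G z * ((P i).eval z * gaussian c z)‖)
      (fun n => ?_) ?_ (fun n => Eventually.of_forall fun z => ?_)
      (Eventually.of_forall fun z => ?_)
    · exact hG.1.mul (contDiff_dbarOp_iterate c
        ((contDiff_gaussian c).mul (hs n)) p).continuous.aestronglyMeasurable
    · refine integrable_finsetSum _ fun i _ => Integrable.const_mul (Integrable.norm ?_) _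
      exact hG.integrable_mul (memLp_polynomial_mul_gaussian (P i) hc)
    · rw [e1, Finset.mul_sum]
      refine norm_sum_le_of_le _ fun i _ => ?_
      rw [← mul_assoc, norm_mul, mul_comm]
      refine mul_le_mul_of_nonneg_right ?_ (norm_nonneg _)
      rw [norm_mul, norm_pow, Complex.norm_real, Real.norm_eq_abs]
      calc |r n| ^ i * ‖((dbarOp 0)^[i] χ) (r n * z)‖ ≤ 1 * C i :=
            mul_le_mul (pow_le_one₀ (abs_nonneg _) (hr1 n)) (hC i _) (norm_nonneg _) zero_le_one
        _ = C i := one_mul _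
    · refine Tendsto.const_mul _ ?_
      simp_rw [e1]
      have hterm : ∀ i, Tendsto (fun n => (P i).eval z * gaussian c z *
          ((r n : ℂ) ^ i * ((dbarOp 0)^[i] χ) (r n * z))) atTop
          (𝓝 ((P i).eval z * gaussian c z * (((0 : ℝ) : ℂ) ^ i *
            ((dbarOp 0)^[i] χ) (((0 : ℝ) : ℂ) * z)))) := by
        intro i
        have hcont := (hχ.dbarOp_iterate 0 i).smooth.continuous
        have : Continuous fun t : ℝ => (P i).eval z * gaussian c z *
            ((t : ℂ) ^ i * ((dbarOp 0)^[i] χ) (t * z)) := by fun_prop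
        exact (this.tendsto 0).comp hr0
      have := tendsto_finsetSum (Finset.range (p + 1)) fun i _ => hterm i
      convert! this using 2
      rw [Finset.sum_range_succ']
      simp [hχ0]
  have h0 := tendsto_nhds_unique hlim (by simp_rw [hr, h]; exact tendsto_const_nhds)
  have e2 : ∀ z, G z * ((P 0).eval z * gaussian c z) =
      (-(c + c) : ℂ) ^ p * (G z * (z ^ p * gaussian c z)) := fun z => by
    rw [hP0]
    simp only [Polynomial.eval_pow, Polynomial.eval_mul, Polynomial.eval_C, Polynomial.eval_X]
    push_cast
    ring
  simp_rw [e2] at h0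
  rw [integral_const_mul] at h0
  refine (mul_eq_zero.1 h0).resolve_left (pow_ne_zero _ ?_)
  have : (c : ℂ) ≠ 0 := by exact_mod_cast hc.ne'
  intro h1
  exact this (by linear_combination (-1 / 2 : ℂ) * h1)

/-! ### The fibre equations in separated variables -/

section FiberEquations

theorem IsTestOn.slice_snd {φ : ℂ × ℝ → ℂ} (h : IsTestOn fiberSet φ) (z : ℂ) :
    IsTestOn (Ioi 0) (fun v => φ (z, v)) := by
  have hsub : tsupport (fun v => φ (z, v)) ⊆ (fun v => (z, v)) ⁻¹' tsupport φ :=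
    closure_minimal (fun v hv => subset_tsupport φ hv)
      ((isClosed_tsupport φ).preimage (by fun_prop))
  refine ⟨h.smooth.comp (by fun_prop), ?_, fun v hv => h.support (hsub hv)⟩
  refine HasCompactSupport.intro (h.compact.isCompact.image continuous_snd) fun v hv => ?_
  exact image_eq_zero_of_notMem_tsupport fun h' => hv ⟨_, h', rfl⟩

theorem IsTestOn.slice_fst {φ : ℂ × ℝ → ℂ} (h : IsTestOn fiberSet φ) (v : ℝ) :
    IsTestOn univ (fun z => φ (z, v)) := by
  refine ⟨h.smooth.comp (by fun_prop), ?_, subset_univ _⟩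
  refine HasCompactSupport.intro (h.compact.isCompact.image continuous_fst) fun z hz => ?_
  exact image_eq_zero_of_notMem_tsupport fun h' => hz ⟨_, h', rfl⟩

theorem isTestOn_fiberSet_tensor {ψ : ℂ → ℂ} {η : ℝ → ℂ} (hψ : IsTestOn univ ψ)
    (hη : IsTestOn (Ioi 0) η) : IsTestOn fiberSet (fun p : ℂ × ℝ => ψ p.1 * η p.2) := by
  have hsub : tsupport (fun p : ℂ × ℝ => ψ p.1 * η p.2) ⊆ tsupport ψ ×ˢ tsupport η := by
    refine closure_minimal (fun p hp => ?_)
      ((isClosed_tsupport ψ).prod (isClosed_tsupport η))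
    exact ⟨subset_tsupport _ (left_ne_zero_of_mul hp), subset_tsupport _ (right_ne_zero_of_mul hp)⟩
  exact ⟨(hψ.smooth.comp contDiff_fst).mul (hη.smooth.comp contDiff_snd),
    (hψ.compact.isCompact.prod hη.compact.isCompact).of_isClosed_subset (isClosed_tsupport _) hsub,
    fun p hp => hη.support (hsub hp).2⟩

theorem fderiv_slice_fst {φ : ℂ × ℝ → ℂ} (h : Differentiable ℝ φ) (z w : ℂ) (v : ℝ) :
    fderiv ℝ (fun z => φ (z, v)) z w = fderiv ℝ φ (z, v) (w, 0) := by
  have h1 : HasFDerivAt (fun z => φ (z, v))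
      ((fderiv ℝ φ (z, v)).comp (ContinuousLinearMap.inl ℝ ℂ ℝ)) z :=
    (h (z, v)).hasFDerivAt.comp z (hasFDerivAt_prodMk_left z v)
  rw [h1.fderiv]
  rfl

theorem deriv_slice_snd {φ : ℂ × ℝ → ℂ} (h : Differentiable ℝ φ) (z : ℂ) (v : ℝ) :
    deriv (fun v => φ (z, v)) v = fderiv ℝ φ (z, v) (0, 1) := by
  have h1 : HasFDerivAt (fun v => φ (z, v))
      ((fderiv ℝ φ (z, v)).comp (ContinuousLinearMap.inr ℝ ℂ ℝ)) v :=
    (h (z, v)).hasFDerivAt.comp v (hasFDerivAt_prodMk_right z v)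
  rw [← fderiv_apply_one_eq_deriv, h1.fderiv]
  rfl

theorem fiber_opOne (ξ : ℝ) (φ : ℂ × ℝ → ℂ) (y : ℂ × ℝ) : opOne.fiber ξ φ y =
    1 / 2 * fderiv ℝ φ y (1, 0) + Complex.I / 2 * fderiv ℝ φ y (Complex.I, 0) -
      2 * Real.pi * ξ * y.1 * φ y := by
  simp only [FirstOrder.fiber, opOne]
  linear_combination (2 * ξ * Real.pi * y.1 * φ y) * Complex.I_sq

theorem fiber_opTwo (ξ : ℝ) (φ : ℂ × ℝ → ℂ) (y : ℂ × ℝ) : opTwo.fiber ξ φ y =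
    Complex.I / 2 * (fderiv ℝ φ y (0, 1) - 2 * Real.pi * ξ * φ y) := by
  simp only [FirstOrder.fiber, opTwo]
  ring

theorem fiber_opOne_iterate {φ : ℂ × ℝ → ℂ} (h : IsTestOn fiberSet φ) (ξ : ℝ) (n : ℕ) (z : ℂ)
    (v : ℝ) : (opOne.fiber ξ)^[n] φ (z, v) =
      ((dbarOp (2 * Real.pi * ξ))^[n] (fun z => φ (z, v))) z := by
  induction n generalizing z with
  | zero => rfl
  | succ n ih =>
    rw [Function.iterate_succ_apply', Function.iterate_succ_apply', ← funext ih, dbarOp,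
      fderiv_slice_fst ((opOne.isTestOn_fiber_iterate h ξ n).smooth.differentiable (by simp)),
      fderiv_slice_fst ((opOne.isTestOn_fiber_iterate h ξ n).smooth.differentiable (by simp))]
    rw [fiber_opOne]
    push_cast
    ring

theorem fiber_opTwo_iterate {φ : ℂ × ℝ → ℂ} (h : IsTestOn fiberSet φ) (ξ : ℝ) (n : ℕ) (z : ℂ)
    (v : ℝ) : (opTwo.fiber ξ)^[n] φ (z, v) =
      (Complex.I / 2) ^ n * ((expOp (2 * Real.pi * ξ))^[n] (fun v => φ (z, v))) v := by
  induction n generalizing v with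
  | zero => simp
  | succ n ih =>
    have e : ((expOp (2 * Real.pi * ξ))^[n] (fun v => φ (z, v))) =
        fun v => (Complex.I / 2)⁻¹ ^ n * (opTwo.fiber ξ)^[n] φ (z, v) := by
      funext v
      rw [ih, ← mul_assoc, ← mul_pow, inv_mul_cancel₀, one_pow, one_mul]
      simp
    have hI : (Complex.I / 2) ^ n * (Complex.I / 2)⁻¹ ^ n = 1 := by
      rw [← mul_pow, mul_inv_cancel₀, one_pow]
      simp
    rw [Function.iterate_succ_apply', Function.iterate_succ_apply', e, expOp, deriv_const_mul_field,
      deriv_slice_snd ((opTwo.isTestOn_fiber_iterate h ξ n).smooth.differentiable (by simp))]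
    rw [fiber_opTwo]
    push_cast
    linear_combination (-(Complex.I / 2) * (fderiv ℝ ((opTwo.fiber ξ)^[n] φ) (z, v) (0, 1) -
      2 * Real.pi * ξ * (opTwo.fiber ξ)^[n] φ (z, v))) * hI

variable {ξ : ℝ} {F : ℂ × ℝ → ℂ}

theorem integrable_mul_fiber_iterate (hF : MemLp F 2 fiberMeasure) (D : FirstOrder (ℂ × ℝ)) (n : ℕ)
    {φ : ℂ × ℝ → ℂ} (h : IsTestOn fiberSet φ) :
    Integrable (fun y => F y * (D.fiber ξ)^[n] φ y) fiberMeasure :=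
  hF.integrable_mul ((D.isTestOn_fiber_iterate h ξ n).memLp _ 2)

theorem WeakFiber.congr {D : FirstOrder (ℂ × ℝ)} {n : ℕ} {F' : ℂ × ℝ → ℂ}
    (h : WeakFiber D n ξ F) (hF : F =ᵐ[fiberMeasure] F') : WeakFiber D n ξ F' := by
  intro φ hφ
  rw [← h φ hφ]
  refine integral_congr_ae ?_
  filter_upwards [hF] with y hy
  rw [hy]

theorem WeakFiber.const_mul {D : FirstOrder (ℂ × ℝ)} {n : ℕ} (h : WeakFiber D n ξ F) (a : ℂ) :
    WeakFiber D n ξ (fun y => a * F y) := by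
  intro φ hφ
  simp_rw [mul_assoc]
  rw [integral_const_mul, h φ hφ, mul_zero]

theorem WeakFiber.sub {D : FirstOrder (ℂ × ℝ)} {n : ℕ} {F' : ℂ × ℝ → ℂ}
    (hF : MemLp F 2 fiberMeasure) (hF' : MemLp F' 2 fiberMeasure) (h : WeakFiber D n ξ F)
    (h' : WeakFiber D n ξ F') : WeakFiber D n ξ (fun y => F y - F' y) := by
  intro φ hφ
  simp_rw [sub_mul]
  rw [integral_sub (integrable_mul_fiber_iterate hF D n hφ)
    (integrable_mul_fiber_iterate hF' D n hφ), h φ hφ, h' φ hφ, sub_zero]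

/-- The weak form of the second equation holds on almost every half-line. -/
theorem WeakFiber.ae_exists_polynomial (hF : MemLp F 2 fiberMeasure) {q : ℕ}
    (h : WeakFiber opTwo q ξ F) : ∀ᵐ z : ℂ, ∃ P : Polynomial ℂ, P.degree < q ∧
      ∀ᵐ v ∂(volume.restrict (Ioi (0 : ℝ))),
        F (z, v) = P.eval (v : ℂ) * Complex.exp ((-(2 * Real.pi * ξ) * v : ℝ) : ℂ) := by
  have hfact : Fact ((2 : ℝ≥0∞) ≠ ⊤) := ⟨by simp⟩
  set ν : Measure ℝ := volume.restrict (Ioi 0) with hν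
  set c := 2 * Real.pi * ξ with hc
  have hslice := ae_memLp_slice_snd hF
  let J : {η : ℝ → ℂ // IsTestOn (Ioi 0) η} → Lp ℂ 2 ν := fun η =>
    ((η.2.expOp_iterate c q).memLp ν 2).toLp _
  let Λ : ℂ → Lp ℂ 2 ν → ℂ := fun z t => ∫ v, F (z, v) * t v ∂ν
  have hJ : ∀ z η, Λ z (J η) = ∫ v, F (z, v) * ((expOp c)^[q] η.1) v ∂ν := fun z η => by
    refine integral_congr_ae ?_
    filter_upwards [((η.2.expOp_iterate c q).memLp ν 2).coeFn_toLp] with v hv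
    rw [hv]
  have hmain := ae_forall_of_forall_ae (μ := (volume : Measure ℂ)) J Λ (fun η => by
    have hg := memLp_integral_mul_right hF ((η.2.expOp_iterate c q).memLp ν 2)
    have h0 := ae_eq_zero_of_integral_contDiff_smul_eq_zero
      (hg.locallyIntegrable (by norm_num)) (fun g hs hcs => by
        have hψ := isTestOn_ofReal hs hcs (subset_univ _)
        have ht := isTestOn_fiberSet_tensor hψ η.2
        have h1 := h _ ht
        rw [integral_prod _ (integrable_mul_fiber_iterate hF opTwo q ht)] at h1
        have e : ∀ z, ∫ v, F (z, v) *
            (opTwo.fiber ξ)^[q] (fun p : ℂ × ℝ => (g p.1 : ℂ) * η.1 p.2) (z, v) ∂ν =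
            (Complex.I / 2) ^ q * (g z • ∫ v, F (z, v) * ((expOp c)^[q] η.1) v ∂ν) := by
          intro z
          rw [Complex.real_smul, ← integral_const_mul, ← integral_const_mul]
          refine integral_congr_ae (Eventually.of_forall fun v => ?_)
          dsimp only
          rw [fiber_opTwo_iterate ht]
          dsimp only
          rw [expOp_iterate_const_mul]
          ring
        have h2 := (integral_congr_ae (Eventually.of_forall e)).symm.trans h1
        rw [integral_const_mul] at h2
        exact (mul_eq_zero.1 h2).resolve_left (pow_ne_zero _ (by simp)))
    filter_upwards [h0] with z hz
    rw [hJ, hz]) (by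
    filter_upwards [hslice] with z hz
    exact continuous_integral_mul hz)
  filter_upwards [hslice, hmain] with z h1 h2
  exact exists_polynomial_of_weak h1 c q fun η hη => (hJ z ⟨η, hη⟩).symm.trans (h2 _)

theorem weakFiber_opTwo_of_ae_exists_polynomial (hF : MemLp F 2 fiberMeasure) {q : ℕ}
    (h : ∀ᵐ z : ℂ, ∃ P : Polynomial ℂ, P.degree < q ∧ ∀ᵐ v ∂(volume.restrict (Ioi (0 : ℝ))),
      F (z, v) = P.eval (v : ℂ) * Complex.exp ((-(2 * Real.pi * ξ) * v : ℝ) : ℂ)) :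
    WeakFiber opTwo q ξ F := by
  intro φ hφ
  rw [integral_prod _ (integrable_mul_fiber_iterate hF opTwo q hφ)]
  refine integral_eq_zero_of_ae ?_
  filter_upwards [h] with z ⟨P, hP, hz⟩
  have e : ∀ᵐ v ∂(volume.restrict (Ioi (0 : ℝ))), F (z, v) * (opTwo.fiber ξ)^[q] φ (z, v) =
      (Complex.I / 2) ^ q * (P.eval (v : ℂ) * Complex.exp ((-(2 * Real.pi * ξ) * v : ℝ) : ℂ) *
        ((expOp (2 * Real.pi * ξ))^[q] (fun v => φ (z, v))) v) := by
    filter_upwards [hz] with v hv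
    rw [hv, fiber_opTwo_iterate hφ]
    ring
  rw [integral_congr_ae e, integral_const_mul,
    integral_polynomial_exp_mul_expOp P _ (hφ.slice_snd z) hP, mul_zero]
  rfl

/-- The weak form of the first equation holds in almost every plane. -/
theorem WeakFiber.ae_integral_eq_zero (hF : MemLp F 2 fiberMeasure) {p : ℕ}
    (h : WeakFiber opOne p ξ F) {ψ : ℂ → ℂ} (hψ : IsTestOn univ ψ) :
    ∀ᵐ v ∂(volume.restrict (Ioi (0 : ℝ))),
      ∫ z, F (z, v) * ((dbarOp (2 * Real.pi * ξ))^[p] ψ) z = 0 := by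
  set ν : Measure ℝ := volume.restrict (Ioi 0) with hν
  set c := 2 * Real.pi * ξ with hc
  have hg : MemLp (fun v => ∫ z, F (z, v) * ((dbarOp c)^[p] ψ) z) 2 ν :=
    memLp_integral_mul_right (memLp_swap hF) ((hψ.dbarOp_iterate c p).memLp volume 2)
  have h0 := isOpen_Ioi.ae_eq_zero_of_integral_contDiff_smul_eq_zero (U := Ioi (0 : ℝ))
    ((hg.locallyIntegrable (by norm_num)).locallyIntegrableOn _) (fun g hs hcs hsupp => by
      have hη := isTestOn_ofReal hs hcs hsupp
      have ht := isTestOn_fiberSet_tensor hψ hη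
      have h1 := h _ ht
      rw [integral_prod_symm _ (integrable_mul_fiber_iterate hF opOne p ht)] at h1
      rw [← h1]
      refine integral_congr_ae (Eventually.of_forall fun v => ?_)
      dsimp only
      rw [Complex.real_smul, ← integral_const_mul]
      refine integral_congr_ae (Eventually.of_forall fun z => ?_)
      dsimp only
      rw [fiber_opOne_iterate ht]
      dsimp only
      simp_rw [mul_comm (ψ _)]
      rw [dbarOp_iterate_const_mul _ _ hψ.smooth]
      ring)
  filter_upwards [h0, ae_restrict_mem measurableSet_Ioi] with v h1 h2
  exact h1 h2

/-- The first equation is preserved by operators acting in the variable `v`. -/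
theorem WeakFiber.mul_integral (hF : MemLp F 2 fiberMeasure) {p : ℕ} (h : WeakFiber opOne p ξ F)
    {e e' : ℝ → ℂ} (he : MemLp e 2 (volume.restrict (Ioi 0)))
    (he' : MemLp e' 2 (volume.restrict (Ioi 0))) :
    WeakFiber opOne p ξ (fun y => (∫ w in Ioi (0 : ℝ), F (y.1, w) * e' w) * e y.2) := by
  intro φ hφ
  rw [integral_prod_symm _ (integrable_mul_fiber_iterate
    (memLp_tensor (memLp_integral_mul_right hF he') he) opOne p hφ)]
  refine integral_eq_zero_of_ae (Eventually.of_forall fun v => ?_)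
  have hψ := hφ.slice_fst v
  set ψ := (dbarOp (2 * Real.pi * ξ))^[p] (fun z => φ (z, v)) with hψdef
  have hψ2 : MemLp ψ 2 := (hψ.dbarOp_iterate _ p).memLp _ 2
  have hi : Integrable (fun y : ℂ × ℝ => F y * (ψ y.1 * e' y.2)) fiberMeasure :=
    hF.integrable_mul (memLp_tensor hψ2 he')
  have e1 : ∫ z, (∫ w in Ioi (0 : ℝ), F (z, w) * e' w) * e v * (opOne.fiber ξ)^[p] φ (z, v) =
      e v * ∫ z, ∫ w in Ioi (0 : ℝ), F (z, w) * (ψ z * e' w) := by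
    rw [← integral_const_mul]
    refine integral_congr_ae (Eventually.of_forall fun z => ?_)
    dsimp only
    rw [fiber_opOne_iterate hφ, ← hψdef, mul_right_comm, mul_comm, ← integral_mul_const]
    congr 1
    refine integral_congr_ae (Eventually.of_forall fun w => ?_)
    dsimp only
    ring
  have e2 : ∫ y, F y * (ψ y.1 * e' y.2) ∂fiberMeasure = 0 := by
    rw [integral_prod_symm _ hi]
    refine integral_eq_zero_of_ae ?_
    filter_upwards [h.ae_integral_eq_zero hF hψ] with w hw
    simp_rw [← mul_assoc]
    rw [integral_mul_const, hw, zero_mul]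
    rfl
  rw [integral_prod _ hi] at e2
  dsimp only
  rw [e1]
  simp only at e2
  rw [e2, mul_zero]
  rfl

/-- Weak solutions of the first equation of order `p` are orthogonal to `z̄^p e^{-c|z|²} e(v)`. -/
theorem WeakFiber.integral_pow_gaussian_eq_zero (hF : MemLp F 2 fiberMeasure) {p : ℕ}
    (h : WeakFiber opOne p ξ F) (hξ : 0 < ξ) {e : ℝ → ℂ}
    (he : MemLp e 2 (volume.restrict (Ioi 0))) :
    ∫ y, F y * (y.1 ^ p * gaussian (2 * Real.pi * ξ) y.1 * e y.2) ∂fiberMeasure = 0 := by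
  have hc : 0 < 2 * Real.pi * ξ := by positivity
  have hi : Integrable (fun y : ℂ × ℝ =>
      F y * (y.1 ^ p * gaussian (2 * Real.pi * ξ) y.1 * e y.2)) fiberMeasure :=
    hF.integrable_mul (memLp_tensor (memLp_pow_mul_gaussian p hc) he)
  let f : ContDiffBump (0 : ℂ) := ⟨1, 2, by norm_num, by norm_num⟩
  have hχ : IsTestOn univ (fun z : ℂ => ((f z : ℝ) : ℂ)) :=
    isTestOn_ofReal f.contDiff f.hasCompactSupport (subset_univ _)
  have hχ0 : ((f 0 : ℝ) : ℂ) = 1 := by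
    rw [f.one_of_mem_closedBall (by simp [f])]
    simp
  have hψ : ∀ n : ℕ, IsTestOn univ (fun z : ℂ => gaussian (2 * Real.pi * ξ) z *
      ((f ((((n : ℝ) + 1)⁻¹ : ℝ) * z) : ℝ) : ℂ)) := by
    intro n
    have h0 : (((n : ℝ) + 1)⁻¹ : ℝ) ≠ 0 := by positivity
    refine IsTestOn.mul_left ⟨hχ.smooth.comp (by fun_prop), ?_, subset_univ _⟩ (contDiff_gaussian _)
    exact hχ.compact.comp_homeomorph (Homeomorph.mulLeft₀ _ (Complex.ofReal_ne_zero.2 h0))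
  rw [integral_prod_symm _ hi]
  refine integral_eq_zero_of_ae ?_
  filter_upwards [ae_all_iff.2 fun n => h.ae_integral_eq_zero hF (hψ n),
    ae_memLp_slice_snd (memLp_swap hF)] with v hv hv2
  simp_rw [← mul_assoc]
  rw [integral_mul_const]
  have := integral_mul_pow_gaussian_eq_zero hv2 hc p hχ hχ0 hv
  simp_rw [← mul_assoc] at this
  rw [this, zero_mul]
  rfl

/-- The operator `∂/∂z̄ + cz` lowers the degree in `z̄` of `z̄^p e^{-c|z|²}` by one, so its power of
order `p + 1` annihilates this function. -/
theorem weakFiber_conj_pow_gaussian (hξ : 0 < ξ) (p : ℕ) {e : ℝ → ℂ}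
    (he : MemLp e 2 (volume.restrict (Ioi 0))) : WeakFiber opOne (p + 1) ξ (fun y =>
      (starRingEnd ℂ) y.1 ^ p * gaussian (2 * Real.pi * ξ) y.1 * e y.2) := by
  have hc : 0 < 2 * Real.pi * ξ := by positivity
  have hm : MemLp (fun z : ℂ => (starRingEnd ℂ) z ^ p * gaussian (2 * Real.pi * ξ) z) 2 := by
    refine (memLp_congr_norm ?_ ?_ ?_).2 (memLp_pow_mul_gaussian p hc)
    · exact ((contDiff_conj_pow p).mul (contDiff_gaussian _)).continuous.aestronglyMeasurable
    · exact (memLp_pow_mul_gaussian p hc).1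
    · exact Eventually.of_forall fun z => by simp
  intro φ hφ
  rw [integral_prod_symm _ (integrable_mul_fiber_iterate (memLp_tensor hm he) opOne _ hφ)]
  refine integral_eq_zero_of_ae (Eventually.of_forall fun v => ?_)
  have e1 := integral_conj_pow_gaussian_mul_dbarOp (2 * Real.pi * ξ) p (hφ.slice_fst v)
  dsimp only
  simp_rw [fiber_opOne_iterate hφ, mul_right_comm _ (e v)]
  rw [integral_mul_const, e1, zero_mul]
  rfl

end FiberEquations

/-! ### Multiplication operators -/

section Multiplication

variable {α : Type*} [MeasurableSpace α] {ρ : Measure α}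

/-- The operator of multiplication by `c ∈ L^∞` on `L²`. -/
noncomputable def mulL2 (c : Lp ℂ ∞ ρ) : Lp ℂ 2 ρ →L[ℂ] Lp ℂ 2 ρ :=
  (ContinuousLinearMap.mul ℂ ℂ).holderL ρ ∞ 2 2 c

theorem coeFn_mulL2 {c : α → ℂ} (hc : MemLp c ∞ ρ) (f : Lp ℂ 2 ρ) :
    mulL2 (hc.toLp c) f =ᵐ[ρ] fun x => c x * f x := by
  filter_upwards [(ContinuousLinearMap.mul ℂ ℂ).coeFn_holder (r := 2) (hc.toLp c) f,
    hc.coeFn_toLp] with x h1 h2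
  rw [← h2]
  exact h1

theorem memLp_top_comp {β : Type*} [MeasurableSpace β] {σ : Measure β} {c : β → ℂ}
    (hc : MemLp c ∞ σ) {φ : α → β} (hφ : Measure.QuasiMeasurePreserving φ ρ σ) :
    MemLp (c ∘ φ) ∞ ρ := by
  refine ⟨hc.1.comp_quasiMeasurePreserving hφ, ?_⟩
  have h2 := hc.2
  rw [eLpNorm_exponent_top] at h2 ⊢
  refine lt_of_le_of_lt ?_ h2
  refine eLpNormEssSup_le_of_ae_enorm_bound ?_
  exact hφ.tendsto_ae.eventually ae_le_eLpNormEssSup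

end Multiplication

/-- The partial Fourier transform commutes with multiplication by functions of the other
variables. -/
theorem partialFourier_mulL2 {Y : Type*} [MeasurableSpace Y] (ν : Measure Y) [SFinite ν]
    {c : Y → ℂ} (hc : MemLp (fun p : ℝ × Y => c p.2) ∞ ((volume : Measure ℝ).prod ν))
    (f : Lp ℂ 2 ((volume : Measure ℝ).prod ν)) :
    partialFourier ν (mulL2 (hc.toLp _) f) = mulL2 (hc.toLp _) (partialFourier ν f) := by
  have hcont : Continuous fun f => partialFourier ν (mulL2 (hc.toLp _) f) :=
    (partialFourier ν).continuous.comp (mulL2 _).continuous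
  have hcont' : Continuous fun f => mulL2 (hc.toLp _) (partialFourier ν f) :=
    (mulL2 _).continuous.comp (partialFourier ν).continuous
  refine congrFun (hcont.ext_on (dense_integrableSubmodule ν) hcont' fun f hf => ?_) f
  have hf1 : Integrable f ((volume : Measure ℝ).prod ν) := hf
  have hcf := coeFn_mulL2 hc f
  have hcf1 : Integrable (mulL2 (hc.toLp _) f) ((volume : Measure ℝ).prod ν) := by
    rw [integrable_congr hcf]
    refine (memLp_one_iff_integrable.1 ?_)
    exact (memLp_one_iff_integrable.2 hf1).mul hc
  have h1 := coeFn_partialFourier ν hf1 (Lp.memLp f)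
  have h2 := coeFn_partialFourier ν hcf1 (Lp.memLp _)
  rw [Lp.toLp_coeFn] at h1 h2
  refine Lp.ext ?_
  filter_upwards [h1, h2, partialFourierFun_congr_ae (ν := ν) hcf,
    coeFn_mulL2 hc (partialFourier ν f)] with p h1 h2 h3 h4
  rw [h2, h3, h4, h1]
  exact congrFun (VectorFourier.fourierIntegral_const_smul _ _ _ (fun u => f (u, p.2)) (c p.2)) p.1

/-! ### The Fourier side -/

/-- The measure on `ℝ × (ℂ × ℝ₊)`, the Fourier variable `ξ` coming first. -/
noncomputable abbrev fourierMeasure : Measure (ℝ × (ℂ × ℝ)) :=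
  (volume : Measure ℝ).prod fiberMeasure

theorem memLp_top_snd_snd (b : LInfty) :
    MemLp (fun p : ℝ × (ℂ × ℝ) => b p.2.2) ∞ fourierMeasure := by
  have h := memLp_top_comp (Lp.memLp b)
    (Measure.quasiMeasurePreserving_snd (μ := (volume : Measure ℂ)))
  exact memLp_top_comp h (Measure.quasiMeasurePreserving_snd (μ := (volume : Measure ℝ)))

/-- The transform diagonalizes the nilpotent symbols: they become multiplication by `b(v)`. -/
theorem coeFn_siegelFourier_mulOp (b : LInfty) (f : L2Siegel) :
    siegelFourier (mulOp (nilpotentSymbol b) f) =ᵐ[fourierMeasure]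
      fun p => b p.2.2 * siegelFourier f p := by
  have e : heisenbergUnitary (mulOp (nilpotentSymbol b) f) =
      mulL2 ((memLp_top_snd_snd b).toLp _) (heisenbergUnitary f) := by
    refine Lp.ext ?_
    have h1 := coeFn_mulL2 (memLp_comp_height b) f
    filter_upwards [coeFn_mulL2 (memLp_top_snd_snd b) (heisenbergUnitary f),
      coeFn_heisenbergUnitary f, coeFn_heisenbergUnitary (mulOp (nilpotentSymbol b) f),
      measurePreserving_heisenberg.quasiMeasurePreserving.ae h1] with p h2 h3 h4 h5
    rw [h2, h3, h4]
    refine h5.trans ?_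
    simp only [Function.comp_apply, height_heisenberg]
  have e2 : siegelFourier (mulOp (nilpotentSymbol b) f) =
      mulL2 ((memLp_top_snd_snd b).toLp _) (siegelFourier f) := by
    change partialFourier fiberMeasure (heisenbergUnitary _) = _
    rw [e]
    exact partialFourier_mulL2 fiberMeasure (c := fun y : ℂ × ℝ => b y.2) (memLp_top_snd_snd b) _
  rw [e2]
  exact coeFn_mulL2 (memLp_top_snd_snd b) _

theorem ae_ae_ae_of_ae {p : ℝ × (ℂ × ℝ) → Prop} (h : ∀ᵐ x ∂fourierMeasure, p x) :
    ∀ᵐ ξ : ℝ, ∀ᵐ z : ℂ, ∀ᵐ v ∂(volume.restrict (Ioi (0 : ℝ))), p (ξ, (z, v)) := by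
  filter_upwards [Measure.ae_ae_of_ae_prod h] with ξ hξ
  exact Measure.ae_ae_of_ae_prod hξ

theorem integral_fourierMeasure {g : ℝ × (ℂ × ℝ) → ℂ} (h : Integrable g fourierMeasure) :
    ∫ p, g p ∂fourierMeasure = ∫ ξ : ℝ, ∫ z : ℂ, ∫ v in Ioi (0 : ℝ), g (ξ, (z, v)) := by
  rw [integral_prod _ h]
  refine integral_congr_ae ?_
  filter_upwards [h.prod_right_ae] with ξ hξ
  exact integral_prod _ hξ

theorem measurePreserving_assoc : MeasurePreserving
    (fun q : (ℝ × ℂ) × ℝ => ((q.1.1, (q.1.2, q.2)) : ℝ × (ℂ × ℝ)))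
    (((volume : Measure ℝ).prod (volume : Measure ℂ)).prod (volume.restrict (Ioi 0)))
    fourierMeasure :=
  measurePreserving_prodAssoc _ _ _

theorem measurePreserving_assoc_symm : MeasurePreserving
    (fun p : ℝ × (ℂ × ℝ) => (((p.1, p.2.1), p.2.2) : (ℝ × ℂ) × ℝ)) fourierMeasure
    (((volume : Measure ℝ).prod (volume : Measure ℂ)).prod (volume.restrict (Ioi 0))) :=
  (measurePreserving_prodAssoc _ _ _).symm

theorem lintegral_laguerreKernel_le (m : ℕ) (c : ℝ) :
    ∫⁻ v in Ioi (0 : ℝ), ‖(laguerreKernel m c v : ℂ)‖ₑ ^ (2 : ℝ) ≤ 1 := by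
  have e : ∀ v, ‖(laguerreKernel m c v : ℂ)‖ₑ ^ (2 : ℝ) =
      ENNReal.ofReal (laguerreKernel m c v ^ 2) := by
    intro v
    rw [← ofReal_norm, Complex.norm_real, Real.norm_eq_abs,
      ENNReal.ofReal_rpow_of_nonneg (abs_nonneg _) (by norm_num), Real.rpow_two, sq_abs]
  simp_rw [e]
  rw [← ofReal_integral_eq_lintegral_ofReal (integrableOn_laguerreKernel_sq m c)
    (Eventually.of_forall fun v => sq_nonneg _)]
  refine ENNReal.ofReal_le_one.2 ?_
  rcases le_or_gt c 0 with hc | hc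
  · simp [laguerreKernel_of_nonpos m hc]
  · exact (integral_laguerreKernel_sq m hc).le

theorem aestronglyMeasurable_laguerreKernel (m : ℕ) : AEStronglyMeasurable
    (fun q : (ℝ × ℂ) × ℝ => (laguerreKernel m (2 * Real.pi * q.1.1) q.2 : ℂ))
    (((volume : Measure ℝ).prod (volume : Measure ℂ)).prod (volume.restrict (Ioi 0))) := by
  have := continuous_laguerreKernel m
  exact (Complex.continuous_ofReal.comp (this.comp (by fun_prop :
    Continuous fun q : (ℝ × ℂ) × ℝ => (2 * Real.pi * q.1.1, q.2)))).aestronglyMeasurable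

theorem memLp_mul_laguerreKernel (m : ℕ) {a : ℝ × ℂ → ℂ}
    (ha : MemLp a 2 ((volume : Measure ℝ).prod (volume : Measure ℂ))) :
    MemLp (fun p : ℝ × (ℂ × ℝ) => a (p.1, p.2.1) * laguerreKernel m (2 * Real.pi * p.1) p.2.2) 2
      fourierMeasure :=
  (memLp_mul_kernel ha (aestronglyMeasurable_laguerreKernel m) ENNReal.one_ne_top
    fun x => lintegral_laguerreKernel_le m (2 * Real.pi * x.1)).comp_measurePreserving
      measurePreserving_assoc_symm

theorem memLp_laguerreCoeff (m : ℕ) {G : ℝ × (ℂ × ℝ) → ℂ} (hG : MemLp G 2 fourierMeasure) :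
    MemLp (fun x : ℝ × ℂ => ∫ v in Ioi (0 : ℝ),
      G (x.1, (x.2, v)) * laguerreKernel m (2 * Real.pi * x.1) v) 2
        ((volume : Measure ℝ).prod (volume : Measure ℂ)) :=
  memLp_integral_mul (hG.comp_measurePreserving measurePreserving_assoc)
    (aestronglyMeasurable_laguerreKernel m) ENNReal.one_ne_top
    fun x => lintegral_laguerreKernel_le m (2 * Real.pi * x.1)

/-- The projection onto the functions `a(ξ, z) e_ξ(v)`, where `e_ξ` is the Laguerre function of
order `m` and scale `2πξ`. -/
noncomputable def laguerreProj (m : ℕ) (G : ℝ × (ℂ × ℝ) → ℂ) (p : ℝ × (ℂ × ℝ)) : ℂ :=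
  (∫ v in Ioi (0 : ℝ), G (p.1, (p.2.1, v)) * laguerreKernel m (2 * Real.pi * p.1) v) *
    laguerreKernel m (2 * Real.pi * p.1) p.2.2

theorem memLp_laguerreProj (m : ℕ) {G : ℝ × (ℂ × ℝ) → ℂ} (hG : MemLp G 2 fourierMeasure) :
    MemLp (laguerreProj m G) 2 fourierMeasure :=
  memLp_mul_laguerreKernel m (memLp_laguerreCoeff m hG)

/-- The remainder of the projection is orthogonal to its range. -/
theorem integral_conj_sub_laguerreProj_mul (m : ℕ) {G : ℝ × (ℂ × ℝ) → ℂ}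
    (hG : MemLp G 2 fourierMeasure) :
    ∫ p, (starRingEnd ℂ) (G p - laguerreProj m G p) * laguerreProj m G p ∂fourierMeasure = 0 := by
  have hQ := memLp_laguerreProj m hG
  have hslice : ∀ᵐ ξ : ℝ, ∀ᵐ z : ℂ,
      MemLp (fun v => G (ξ, (z, v))) 2 (volume.restrict (Ioi (0 : ℝ))) := by
    filter_upwards [ae_memLp_slice_snd hG] with ξ hξ
    exact ae_memLp_slice_snd hξ
  have hi : Integrable (fun p => (starRingEnd ℂ) (G p - laguerreProj m G p) * laguerreProj m G p)
    fourierMeasure := (hG.sub hQ).star.integrable_mul hQ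
  rw [integral_fourierMeasure hi]
  refine integral_eq_zero_of_ae ?_
  filter_upwards [hslice] with ξ hξ
  refine integral_eq_zero_of_ae ?_
  filter_upwards [hξ] with z hz
  set c := 2 * Real.pi * ξ with hc
  have hk := memLp_laguerreKernel m c
  set a := ∫ v in Ioi (0 : ℝ), G (ξ, (z, v)) * laguerreKernel m c v with ha
  have e : ∀ v, (starRingEnd ℂ) (G (ξ, (z, v)) - laguerreProj m G (ξ, (z, v))) *
      laguerreProj m G (ξ, (z, v)) =
      a * (starRingEnd ℂ) (G (ξ, (z, v)) * laguerreKernel m c v) -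
        a * (starRingEnd ℂ) a * ((laguerreKernel m c v : ℂ) * laguerreKernel m c v) := by
    intro v
    simp only [laguerreProj, ← hc, ← ha, map_sub, map_mul, Complex.conj_ofReal]
    ring
  simp_rw [e]
  have hi1 : Integrable (fun v => G (ξ, (z, v)) * laguerreKernel m c v)
      (volume.restrict (Ioi (0 : ℝ))) := hz.integrable_mul hk
  have hi2 : Integrable (fun v => (laguerreKernel m c v : ℂ) * laguerreKernel m c v)
      (volume.restrict (Ioi (0 : ℝ))) := hk.integrable_mul hk
  have hi1' : Integrable (fun v => (starRingEnd ℂ) (G (ξ, (z, v)) * laguerreKernel m c v))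
      (volume.restrict (Ioi (0 : ℝ))) := (Complex.conjLIE.integrable_comp_iff).2 hi1
  rw [integral_sub (hi1'.const_mul a) (hi2.const_mul _), integral_const_mul, integral_const_mul,
    integral_conj, ← ha]
  rcases le_or_gt c 0 with hc0 | hc0
  · have : a = 0 := by simp [ha, laguerreKernel_of_nonpos m hc0]
    simp [this]
  · rw [integral_laguerreKernel_mul_self m hc0]
    simp

theorem inner_siegelFourier (f g : L2Siegel) : inner ℂ f g =
    ∫ p, (starRingEnd ℂ) (siegelFourier f p) * siegelFourier g p ∂fourierMeasure := by
  rw [← siegelFourier.inner_map_map, L2.inner_def]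
  refine integral_congr_ae (Eventually.of_forall fun p => ?_)
  simp [mul_comm]

/-- After the transform, the functions of the true-poly-Bergman type space are of the form
`a(ξ, z) e_ξ(v)`: the remainder of the projection solves the second equation with a lower order. -/
theorem siegelFourier_eq_laguerreProj {j k : ℕ} (hk : 1 ≤ k) {f : L2Siegel}
    (hf : f ∈ truePolyBergman j k) :
    siegelFourier f =ᵐ[fourierMeasure] laguerreProj (k - 1) (siegelFourier f) := by
  set G : ℝ × (ℂ × ℝ) → ℂ := ⇑(siegelFourier f)
  have hG : MemLp G 2 fourierMeasure := Lp.memLp _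
  have hQ := memLp_laguerreProj (k - 1) hG
  have hH : MemLp (fun p => G p - laguerreProj (k - 1) G p) 2 fourierMeasure := hG.sub hQ
  set h : L2Siegel := siegelFourier.symm (hH.toLp _) with hh
  have hhH : siegelFourier h =ᵐ[fourierMeasure] fun p => G p - laguerreProj (k - 1) G p := by
    rw [hh, LinearIsometryEquiv.apply_symm_apply]
    exact hH.coeFn_toLp
  have hmem : h ∈ polyBergman j (k - 1) := by
    obtain ⟨h1, h2⟩ := (mem_polyBergman_iff j k f).1 hf.1
    rw [mem_polyBergman_iff]
    refine ⟨?_, ?_⟩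
    · filter_upwards [h1, ae_memLp_slice_snd hG, ae_memLp_slice_snd hQ,
        Measure.ae_ae_of_ae_prod hhH] with ξ h1 h3 h4 h5
      have hk := memLp_laguerreKernel (k - 1) (2 * Real.pi * ξ)
      exact (WeakFiber.sub h3 h4 h1 (h1.mul_integral h3 hk hk)).congr
        (h5.mono fun y hy => hy.symm)
    · filter_upwards [h2, ae_memLp_slice_snd hG, ae_memLp_slice_snd hH,
        Measure.ae_ae_of_ae_prod hhH] with ξ h2 h3 h4 h5
      refine WeakFiber.congr (weakFiber_opTwo_of_ae_exists_polynomial h4 ?_)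
        (h5.mono fun y hy => hy.symm)
      filter_upwards [h2.ae_exists_polynomial h3, ae_memLp_slice_snd h3] with z h6 h7
      have hk1 : k - 1 + 1 = k := by omega
      obtain ⟨S, hS, hSe⟩ := exists_polynomial_sub_projection (m := k - 1) h7 (by rwa [hk1])
      refine ⟨S, hS, ?_⟩
      filter_upwards [hSe] with v hv
      rw [← hv, laguerreProj, mul_comm]
  have horth : inner ℂ h f = 0 :=
    (Submodule.mem_orthogonal _ _).1 hf.2 h (Submodule.mem_sup_right hmem)
  rw [inner_siegelFourier] at horth
  have e1 : ∫ p, (starRingEnd ℂ) (G p - laguerreProj (k - 1) G p) * G p ∂fourierMeasure = 0 := by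
    rw [← horth]
    refine integral_congr_ae ?_
    filter_upwards [hhH] with p hp
    rw [hp]
  have e2 := integral_conj_sub_laguerreProj_mul (k - 1) hG
  have hi1 : Integrable (fun p => (starRingEnd ℂ) (G p - laguerreProj (k - 1) G p) * G p)
    fourierMeasure := hH.star.integrable_mul hG
  have hi2 : Integrable (fun p => (starRingEnd ℂ) (G p - laguerreProj (k - 1) G p) *
    laguerreProj (k - 1) G p) fourierMeasure := hH.star.integrable_mul hQ
  have e3 := (integral_sub hi1 hi2).trans (by rw [e1, e2, sub_zero])
  have e4 : inner ℂ h h = (0 : ℂ) := by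
    rw [inner_siegelFourier, ← e3]
    refine integral_congr_ae ?_
    filter_upwards [hhH] with p hp
    rw [hp]
    ring
  have h0 : h = 0 := inner_self_eq_zero.1 e4
  rw [h0, map_zero] at hhH
  filter_upwards [hhH, Lp.coeFn_zero ℂ 2 fourierMeasure] with p h1 h2
  rw [h2] at h1
  exact (sub_eq_zero.1 h1.symm)

/-! ### Functions of the Fourier variable acting on the true-poly-Bergman type space -/

theorem memLp_top_fourierVariable (g : C(ℝ≥0∞, ℂ)) :
    MemLp (fun p : ℝ × (ℂ × ℝ) => g (ENNReal.ofReal (2 * Real.pi * p.1))) ∞ fourierMeasure :=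
  memLp_top_of_bound (g.continuous.comp (ENNReal.continuous_ofReal.comp
    (by fun_prop))).aestronglyMeasurable ‖g‖ (Eventually.of_forall fun _ => g.norm_coe_le_norm _)

/-- The operator on `L²(D₂)` which the transform turns into multiplication by `g(2πξ)`. -/
noncomputable def multiplierOp (g : C(ℝ≥0∞, ℂ)) : L2Siegel →L[ℂ] L2Siegel :=
  (siegelFourier.symm.toContinuousLinearEquiv : _ →L[ℂ] L2Siegel) ∘L
    mulL2 ((memLp_top_fourierVariable g).toLp _) ∘L
      (siegelFourier.toContinuousLinearEquiv : L2Siegel →L[ℂ] _)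

theorem coeFn_siegelFourier_multiplierOp (g : C(ℝ≥0∞, ℂ)) (f : L2Siegel) :
    siegelFourier (multiplierOp g f) =ᵐ[fourierMeasure]
      fun p => g (ENNReal.ofReal (2 * Real.pi * p.1)) * siegelFourier f p := by
  have e : siegelFourier (multiplierOp g f) =
      mulL2 ((memLp_top_fourierVariable g).toLp _) (siegelFourier f) :=
    siegelFourier.apply_symm_apply _
  rw [e]
  exact coeFn_mulL2 (memLp_top_fourierVariable g) _

theorem eq_of_siegelFourier_ae_eq {f f' : L2Siegel}
    (h : siegelFourier f =ᵐ[fourierMeasure] siegelFourier f') : f = f' :=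
  siegelFourier.injective (Lp.ext h)

theorem multiplierOp_mul (g h : C(ℝ≥0∞, ℂ)) (f : L2Siegel) :
    multiplierOp (g * h) f = multiplierOp g (multiplierOp h f) := by
  refine eq_of_siegelFourier_ae_eq ?_
  filter_upwards [coeFn_siegelFourier_multiplierOp (g * h) f, coeFn_siegelFourier_multiplierOp h f,
    coeFn_siegelFourier_multiplierOp g (multiplierOp h f)] with p h1 h2 h3
  rw [h1, h3, h2, ContinuousMap.mul_apply, mul_assoc]

theorem multiplierOp_add (g h : C(ℝ≥0∞, ℂ)) (f : L2Siegel) :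
    multiplierOp (g + h) f = multiplierOp g f + multiplierOp h f := by
  refine eq_of_siegelFourier_ae_eq ?_
  rw [map_add]
  filter_upwards [coeFn_siegelFourier_multiplierOp (g + h) f, coeFn_siegelFourier_multiplierOp h f,
    coeFn_siegelFourier_multiplierOp g f, Lp.coeFn_add (siegelFourier (multiplierOp g f))
      (siegelFourier (multiplierOp h f))] with p h1 h2 h3 h4
  rw [h1, h4, Pi.add_apply, h3, h2, ContinuousMap.add_apply, add_mul]

theorem multiplierOp_algebraMap (a : ℂ) (f : L2Siegel) :
    multiplierOp (algebraMap ℂ C(ℝ≥0∞, ℂ) a) f = a • f := by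
  refine eq_of_siegelFourier_ae_eq ?_
  rw [map_smul]
  filter_upwards [coeFn_siegelFourier_multiplierOp (algebraMap ℂ C(ℝ≥0∞, ℂ) a) f,
    Lp.coeFn_smul a (siegelFourier f)] with p h1 h2
  rw [h1, h2, Pi.smul_apply, smul_eq_mul]
  simp [algebraMap_apply]

/-- On the Fourier side both operators are pointwise multiplications, by `g(2πξ)` and its conjugate. -/
theorem inner_multiplierOp_left (g : C(ℝ≥0∞, ℂ)) (f f' : L2Siegel) :
    inner ℂ (multiplierOp g f) f' = inner ℂ f (multiplierOp (star g) f') := by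
  rw [inner_siegelFourier, inner_siegelFourier]
  refine integral_congr_ae ?_
  filter_upwards [coeFn_siegelFourier_multiplierOp g f,
    coeFn_siegelFourier_multiplierOp (star g) f'] with p h1 h2
  rw [h1, h2, ContinuousMap.star_apply, map_mul, RCLike.star_def]
  ring

theorem multiplierOp_mem_polyBergman (g : C(ℝ≥0∞, ℂ)) {p q : ℕ} {f : L2Siegel}
    (hf : f ∈ polyBergman p q) : multiplierOp g f ∈ polyBergman p q := by
  rw [mem_polyBergman_iff] at hf ⊢
  have h := Measure.ae_ae_of_ae_prod (coeFn_siegelFourier_multiplierOp g f)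
  constructor
  · filter_upwards [hf.1, h] with ξ h1 h2
    exact (h1.const_mul _).congr (h2.mono fun y hy => hy.symm)
  · filter_upwards [hf.2, h] with ξ h1 h2
    exact (h1.const_mul _).congr (h2.mono fun y hy => hy.symm)

/-- The fibre equations hold for each `ξ` separately, so multipliers in `ξ` and their adjoints
preserve the poly-Bergman type spaces, hence also the orthogonal complements. -/
theorem multiplierOp_mem_truePolyBergman (g : C(ℝ≥0∞, ℂ)) {j k : ℕ} {f : L2Siegel}
    (hf : f ∈ truePolyBergman j k) : multiplierOp g f ∈ truePolyBergman j k := by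
  refine ⟨multiplierOp_mem_polyBergman g hf.1, ?_⟩
  refine (Submodule.mem_orthogonal' _ _).2 fun u hu => ?_
  rw [inner_multiplierOp_left]
  refine (Submodule.mem_orthogonal' _ _).1 hf.2 _ ?_
  obtain ⟨a, ha, b, hb, rfl⟩ := Submodule.mem_sup.1 hu
  rw [map_add]
  exact Submodule.add_mem_sup (multiplierOp_mem_polyBergman _ ha)
    (multiplierOp_mem_polyBergman _ hb)

variable {j k : ℕ}

theorem incl_mem (x : TrueSpace j k) : incl j k x ∈ truePolyBergman j k := Subtype.property x

theorem incl_injective : Function.Injective (incl j k) := Subtype.val_injective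

theorem incl_proj_of_mem {f : L2Siegel} (hf : f ∈ truePolyBergman j k) :
    incl j k (proj j k f) = f :=
  Submodule.starProjection_eq_self_iff.2 hf

theorem inner_proj_right (x : TrueSpace j k) (f : L2Siegel) :
    inner ℂ x (proj j k f) = inner ℂ (incl j k x) f :=
  Submodule.inner_orthogonalProjectionOnto_eq_of_mem_left (K := truePolyBergman j k) x f

/-- The representation of `C[0, +∞]` on the true-poly-Bergman type space by multiplication by
`g(2πξ)` after the transform. -/
noncomputable def multiplierRep (j k : ℕ) :
    C(ℝ≥0∞, ℂ) →⋆ₐ[ℂ] (TrueSpace j k →L[ℂ] TrueSpace j k) :=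
  have key : ∀ g x, incl j k ((proj j k ∘L multiplierOp g ∘L incl j k) x) =
      multiplierOp g (incl j k x) := fun g x =>
    incl_proj_of_mem (multiplierOp_mem_truePolyBergman g (incl_mem x))
  have hcomm : ∀ a : ℂ, proj j k ∘L multiplierOp (algebraMap ℂ C(ℝ≥0∞, ℂ) a) ∘L incl j k =
      algebraMap ℂ (TrueSpace j k →L[ℂ] TrueSpace j k) a := fun a => by
    ext1 x
    refine incl_injective ?_
    rw [key, multiplierOp_algebraMap, Algebra.algebraMap_eq_smul_one]
    simp
  { toFun := fun g => proj j k ∘L multiplierOp g ∘L incl j k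
    map_one' := by simpa using hcomm 1
    map_zero' := by simpa using hcomm 0
    map_mul' := fun g h => by
      ext1 x
      refine incl_injective ?_
      rw [key, multiplierOp_mul, mul_apply_eq_comp, key, key]
    map_add' := fun g h => by
      ext1 x
      refine incl_injective ?_
      rw [key, multiplierOp_add, _root_.add_apply, map_add, key, key]
    commutes' := hcomm
    map_star' := fun g => by
      refine (ContinuousLinearMap.eq_adjoint_iff _ _).2 fun x y => ?_
      have h1 : inner ℂ ((proj j k ∘L multiplierOp (star g) ∘L incl j k) x) y =
          inner ℂ (multiplierOp (star g) (incl j k x)) (incl j k y) := by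
        rw [← key]
        rfl
      have h2 : inner ℂ x ((proj j k ∘L multiplierOp g ∘L incl j k) y) =
          inner ℂ (incl j k x) (multiplierOp g (incl j k y)) := by
        rw [← key]
        rfl
      refine h1.trans (Eq.trans ?_ h2.symm)
      rw [inner_multiplierOp_left, star_star] }

theorem incl_multiplierRep (g : C(ℝ≥0∞, ℂ)) (x : TrueSpace j k) :
    incl j k (multiplierRep j k g x) = multiplierOp g (incl j k x) :=
  incl_proj_of_mem (multiplierOp_mem_truePolyBergman g (incl_mem x))

/-- On functions of the form `a(ξ, z) e_ξ(v)`, multiplication by `b(v)` has the same matrix elements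
as multiplication by the average of `b` against `e_ξ²`, which is the spectral function at `2πξ`. -/
theorem toeplitz_eq_multiplierRep (hk : 1 ≤ k) {b : LInfty} {g : C(ℝ≥0∞, ℂ)}
    (hg : ∀ x : ℝ, 0 < x → g (ENNReal.ofReal x) = spectralFun k b x) :
    toeplitz j k b = multiplierRep j k g := by
  ext1 x
  refine ext_inner_left ℂ fun y => ?_
  have h1 : inner ℂ y (toeplitz j k b x) =
      inner ℂ (incl j k y) (mulOp (nilpotentSymbol b) (incl j k x)) := inner_proj_right y _
  have h2 : inner ℂ y (multiplierRep j k g x) =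
      inner ℂ (incl j k y) (multiplierOp g (incl j k x)) := inner_proj_right y _
  rw [h1, h2, inner_siegelFourier, inner_siegelFourier]
  have hb := coeFn_siegelFourier_mulOp b (incl j k x)
  have hm := coeFn_siegelFourier_multiplierOp g (incl j k x)
  have hx := siegelFourier_eq_laguerreProj hk (incl_mem x)
  have hy := siegelFourier_eq_laguerreProj hk (incl_mem y)
  have hib : Integrable (fun p => (starRingEnd ℂ) (siegelFourier (incl j k y) p) *
      siegelFourier (mulOp (nilpotentSymbol b) (incl j k x)) p) fourierMeasure :=
    (Lp.memLp _).star.integrable_mul (Lp.memLp _)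
  have him : Integrable (fun p => (starRingEnd ℂ) (siegelFourier (incl j k y) p) *
      siegelFourier (multiplierOp g (incl j k x)) p) fourierMeasure :=
    (Lp.memLp _).star.integrable_mul (Lp.memLp _)
  rw [integral_fourierMeasure hib, integral_fourierMeasure him]
  refine integral_congr_ae ?_
  filter_upwards [ae_ae_ae_of_ae hb, ae_ae_ae_of_ae hm, ae_ae_ae_of_ae hx, ae_ae_ae_of_ae hy]
    with ξ hb hm hx hy
  refine integral_congr_ae ?_
  filter_upwards [hb, hm, hx, hy] with z hb hm hx hy
  set X : ℝ × (ℂ × ℝ) → ℂ := ⇑(siegelFourier (incl j k x))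
  set Y : ℝ × (ℂ × ℝ) → ℂ := ⇑(siegelFourier (incl j k y))
  set c := 2 * Real.pi * ξ with hc
  set α := ∫ v in Ioi (0 : ℝ), X (ξ, (z, v)) * laguerreKernel (k - 1) c v with hα
  set β := ∫ v in Ioi (0 : ℝ), Y (ξ, (z, v)) * laguerreKernel (k - 1) c v with hβ
  have e1 : ∫ v in Ioi (0 : ℝ), (starRingEnd ℂ) (Y (ξ, (z, v))) *
      siegelFourier (mulOp (nilpotentSymbol b) (incl j k x)) (ξ, (z, v)) =
      (starRingEnd ℂ) β * α * ∫ v in Ioi (0 : ℝ), b v *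
        ((laguerreKernel (k - 1) c v ^ 2 : ℝ) : ℂ) := by
    rw [← integral_const_mul]
    refine integral_congr_ae ?_
    filter_upwards [hb, hx, hy] with v hb hx hy
    rw [hb, hx, hy]
    simp only [laguerreProj, ← hc, ← hα, ← hβ, map_mul, Complex.conj_ofReal]
    push_cast
    ring
  have e2 : ∫ v in Ioi (0 : ℝ), (starRingEnd ℂ) (Y (ξ, (z, v))) *
      siegelFourier (multiplierOp g (incl j k x)) (ξ, (z, v)) =
      (starRingEnd ℂ) β * α * g (ENNReal.ofReal c) *
        ∫ v in Ioi (0 : ℝ), (laguerreKernel (k - 1) c v : ℂ) * laguerreKernel (k - 1) c v := by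
    rw [← integral_const_mul]
    refine integral_congr_ae ?_
    filter_upwards [hm, hx, hy] with v hm hx hy
    rw [hm, hx, hy]
    simp only [laguerreProj, ← hc, ← hα, ← hβ, map_mul, Complex.conj_ofReal]
    ring
  rw [e1, e2]
  rcases le_or_gt c 0 with hc0 | hc0
  · have : α = 0 := by simp [hα, laguerreKernel_of_nonpos (k - 1) hc0]
    simp [this]
  · rw [integral_laguerreKernel_mul_self _ hc0, mul_one, hg c hc0,
      spectralFun_eq_integral_mul k b hc0]
    simp_rw [laguerreKernel_sq (k - 1) hc0]

/-! ### The representation is faithful -/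

/-- The function `1_{(s, t)}(ξ) z̄^p e^{-2πξ|z|²} e_ξ(v)`, where `e_ξ` is the Laguerre function of
order `m` and scale `2πξ`. -/
noncomputable def packet (p m : ℕ) (s t : ℝ) (q : ℝ × (ℂ × ℝ)) : ℂ :=
  (Ioo s t).indicator (fun _ => (1 : ℂ)) q.1 *
    ((starRingEnd ℂ) q.2.1 ^ p * gaussian (2 * Real.pi * q.1) q.2.1) *
      laguerreKernel m (2 * Real.pi * q.1) q.2.2

theorem memLp_packet (p m : ℕ) {s : ℝ} (hs : 0 < s) (t : ℝ) :
    MemLp (packet p m s t) 2 fourierMeasure := by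
  refine memLp_mul_laguerreKernel m (a := fun x : ℝ × ℂ =>
    (Ioo s t).indicator (fun _ => (1 : ℂ)) x.1 *
      ((starRingEnd ℂ) x.2 ^ p * gaussian (2 * Real.pi * x.1) x.2)) ?_
  have h1 : MemLp ((Ioo s t).indicator (fun _ => (1 : ℂ))) 2 (volume : Measure ℝ) :=
    memLp_indicator_const 2 measurableSet_Ioo 1 (Or.inr (by simp))
  have h2 := memLp_tensor h1
    (memLp_pow_mul_gaussian p (c := 2 * Real.pi * s) (by positivity))
  have hg : Continuous fun x : ℝ × ℂ => gaussian (2 * Real.pi * x.1) x.2 := by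
    unfold gaussian
    fun_prop
  have hc : Continuous fun x : ℝ × ℂ =>
      (starRingEnd ℂ) x.2 ^ p * gaussian (2 * Real.pi * x.1) x.2 :=
    ((contDiff_conj_pow p).continuous.comp continuous_snd).mul hg
  refine h2.mono (h1.1.comp_fst.mul hc.aestronglyMeasurable) (Eventually.of_forall fun x => ?_)
  by_cases hx : x.1 ∈ Ioo s t
  · simp only [indicator_of_mem hx, one_mul, norm_mul, norm_pow, RCLike.norm_conj, norm_gaussian]
    gcongr
    exact hx.1.le
  · simp [indicator_of_notMem hx]

theorem integral_conj_packet_mul_eq_zero {p m : ℕ} {s : ℝ} (hs : 0 < s) (t : ℝ)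
    {G : ℝ × (ℂ × ℝ) → ℂ} (hG : MemLp G 2 fourierMeasure)
    (h : ∀ᵐ ξ : ℝ, 0 < ξ → ∫ y, G (ξ, y) * (y.1 ^ p * gaussian (2 * Real.pi * ξ) y.1 *
      laguerreKernel m (2 * Real.pi * ξ) y.2) ∂fiberMeasure = 0) :
    ∫ q, (starRingEnd ℂ) (packet p m s t q) * G q ∂fourierMeasure = 0 := by
  have hi : Integrable (fun q => (starRingEnd ℂ) (packet p m s t q) * G q) fourierMeasure :=
    (memLp_packet p m hs t).star.integrable_mul hG
  rw [integral_prod _ hi]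
  refine integral_eq_zero_of_ae ?_
  filter_upwards [h] with ξ hξ
  by_cases hx : ξ ∈ Ioo s t
  · refine Eq.trans ?_ (hξ (hs.trans hx.1))
    refine integral_congr_ae (Eventually.of_forall fun y => ?_)
    have hgc : (starRingEnd ℂ) (gaussian (2 * Real.pi * ξ) y.1) = gaussian (2 * Real.pi * ξ) y.1 := by
      rw [gaussian, ← Complex.exp_conj, Complex.conj_ofReal]
    simp only [packet, indicator_of_mem hx, map_mul, map_pow, map_one, Complex.conj_conj, hgc,
      Complex.conj_ofReal]
    ring
  · simp [packet, indicator_of_notMem hx]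

/-- The inverse transforms of the packets lie in the true-poly-Bergman type space. -/
theorem siegelFourier_symm_packet_mem {j k : ℕ} (hj : 1 ≤ j) (hk : 1 ≤ k) {s : ℝ} (hs : 0 < s)
    (t : ℝ) : siegelFourier.symm ((memLp_packet (j - 1) (k - 1) hs t).toLp _) ∈
      truePolyBergman j k := by
  set f := siegelFourier.symm ((memLp_packet (j - 1) (k - 1) hs t).toLp _) with hf
  have hfe : siegelFourier f =ᵐ[fourierMeasure] packet (j - 1) (k - 1) s t := by
    rw [hf, LinearIsometryEquiv.apply_symm_apply]
    exact (memLp_packet (j - 1) (k - 1) hs t).coeFn_toLp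
  have hj1 : j - 1 + 1 = j := by omega
  have hk1 : k - 1 + 1 = k := by omega
  have hzero : ∀ (D : FirstOrder (ℂ × ℝ)) (n : ℕ) {ξ : ℝ}, ξ ∉ Ioo s t →
      WeakFiber D n ξ (fun y => packet (j - 1) (k - 1) s t (ξ, y)) := by
    intro D n ξ hξ φ _
    simp [packet, indicator_of_notMem hξ]
  refine ⟨(mem_polyBergman_iff j k f).2 ⟨?_, ?_⟩, ?_⟩
  · filter_upwards [Measure.ae_ae_of_ae_prod hfe] with ξ hξ
    refine WeakFiber.congr (F := fun y => packet (j - 1) (k - 1) s t (ξ, y)) ?_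
      (hξ.mono fun y hy => hy.symm)
    by_cases hx : ξ ∈ Ioo s t
    · have := weakFiber_conj_pow_gaussian (hs.trans hx.1) (j - 1)
        (memLp_laguerreKernel (k - 1) (2 * Real.pi * ξ))
      rw [hj1] at this
      simpa only [packet, indicator_of_mem hx, one_mul] using this
    · exact hzero _ _ hx
  · filter_upwards [Measure.ae_ae_of_ae_prod hfe,
      ae_memLp_slice_snd (memLp_packet (j - 1) (k - 1) hs t)] with ξ hξ hm
    refine WeakFiber.congr (F := fun y => packet (j - 1) (k - 1) s t (ξ, y)) ?_
      (hξ.mono fun y hy => hy.symm)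
    by_cases hx : ξ ∈ Ioo s t
    · refine weakFiber_opTwo_of_ae_exists_polynomial hm (Eventually.of_forall fun z => ?_)
      have hξ0 := hs.trans hx.1
      obtain ⟨Q, hQ, -, hQe⟩ := exists_polynomial_laguerreKernel (k - 1)
        (c := 2 * Real.pi * ξ) (by positivity)
      rw [hk1] at hQ
      refine ⟨Polynomial.C ((starRingEnd ℂ) z ^ (j - 1) * gaussian (2 * Real.pi * ξ) z) * Q, ?_,
        Eventually.of_forall fun v => ?_⟩
      · rw [← Polynomial.smul_eq_C_mul]
        exact (Polynomial.degree_smul_le _ _).trans_lt hQ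
      · simp only [packet, indicator_of_mem hx, one_mul, hQe, Polynomial.eval_mul,
          Polynomial.eval_C]
        ring
    · exact hzero _ _ hx
  · refine (Submodule.mem_orthogonal' _ _).2 fun u hu => ?_
    obtain ⟨a, ha, b, hb, rfl⟩ := Submodule.mem_sup.1 hu
    have hred : ∀ a : L2Siegel, (∀ᵐ ξ : ℝ, 0 < ξ → ∫ y, siegelFourier a (ξ, y) *
        (y.1 ^ (j - 1) * gaussian (2 * Real.pi * ξ) y.1 *
          laguerreKernel (k - 1) (2 * Real.pi * ξ) y.2) ∂fiberMeasure = 0) → inner ℂ f a = 0 := by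
      intro a h
      rw [inner_siegelFourier, ← integral_conj_packet_mul_eq_zero hs t (Lp.memLp _) h]
      refine integral_congr_ae ?_
      filter_upwards [hfe] with q hq
      rw [hq]
    rw [inner_add_right, hred a, hred b, add_zero]
    · filter_upwards [((mem_polyBergman_iff _ _ b).1 hb).2,
        ae_memLp_slice_snd (Lp.memLp (siegelFourier b))] with ξ h1 h2 hξ
      have hc : 0 < 2 * Real.pi * ξ := by positivity
      have hi : Integrable (fun y : ℂ × ℝ => siegelFourier b (ξ, y) *
          (y.1 ^ (j - 1) * gaussian (2 * Real.pi * ξ) y.1 *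
            laguerreKernel (k - 1) (2 * Real.pi * ξ) y.2)) fiberMeasure :=
        h2.integrable_mul (memLp_tensor (memLp_pow_mul_gaussian (j - 1) hc)
          (memLp_laguerreKernel (k - 1) (2 * Real.pi * ξ)))
      rw [integral_prod _ hi]
      refine integral_eq_zero_of_ae ?_
      filter_upwards [h1.ae_exists_polynomial h2] with z ⟨S, hS, hz⟩
      have e : ∀ᵐ v ∂(volume.restrict (Ioi (0 : ℝ))), siegelFourier b (ξ, (z, v)) *
          (z ^ (j - 1) * gaussian (2 * Real.pi * ξ) z *
            laguerreKernel (k - 1) (2 * Real.pi * ξ) v) =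
          z ^ (j - 1) * gaussian (2 * Real.pi * ξ) z * (S.eval (v : ℂ) *
            Complex.exp ((-(2 * Real.pi * ξ) * v : ℝ) : ℂ) *
              laguerreKernel (k - 1) (2 * Real.pi * ξ) v) := by
        filter_upwards [hz] with v hv
        rw [hv]
        ring
      refine (integral_congr_ae e).trans ?_
      rw [integral_const_mul, integral_polynomial_exp_mul_laguerreKernel hc hS, mul_zero]
      rfl
    · filter_upwards [((mem_polyBergman_iff _ _ a).1 ha).1,
        ae_memLp_slice_snd (Lp.memLp (siegelFourier a))] with ξ h1 h2 hξ
      exact h1.integral_pow_gaussian_eq_zero h2 hξ (memLp_laguerreKernel (k - 1) _)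

/-- A multiplier whose symbol does not vanish near a point acts non-trivially on packets
concentrated near that point. -/
theorem multiplierRep_injective {j k : ℕ} (hj : 1 ≤ j) (hk : 1 ≤ k) :
    Function.Injective (multiplierRep j k) := by
  refine (injective_iff_map_eq_zero _).2 fun g hg => eq_of_eqOn_ofReal fun x hx => ?_
  by_contra hne
  rw [ContinuousMap.zero_apply] at hne
  have hcont : Continuous fun ξ : ℝ => g (ENNReal.ofReal (2 * Real.pi * ξ)) :=
    g.continuous.comp (ENNReal.continuous_ofReal.comp (by fun_prop))
  have hξ₀ : 0 < x / (2 * Real.pi) := by positivity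
  have hne' : g (ENNReal.ofReal (2 * Real.pi * (x / (2 * Real.pi)))) ≠ 0 := by
    rwa [mul_div_cancel₀ _ (by positivity)]
  obtain ⟨r, t, hrt, hsub⟩ := mem_nhds_iff_exists_Ioo_subset.1
    ((hcont.continuousAt.eventually_ne hne').and (lt_mem_nhds hξ₀))
  set s := (r + x / (2 * Real.pi)) / 2 with hs_def
  have hrs : r < s := by linarith [hrt.1]
  have hsx : s < x / (2 * Real.pi) := by linarith [hrt.1]
  have hs : 0 < s := (hsub ⟨hrs, hsx.trans hrt.2⟩).2
  have hmem := siegelFourier_symm_packet_mem hj hk hs t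
  set f := siegelFourier.symm ((memLp_packet (j - 1) (k - 1) hs t).toLp _) with hf
  have hfe : siegelFourier f =ᵐ[fourierMeasure] packet (j - 1) (k - 1) s t := by
    rw [hf, LinearIsometryEquiv.apply_symm_apply]
    exact (memLp_packet (j - 1) (k - 1) hs t).coeFn_toLp
  have h0 : multiplierOp g f = 0 := by
    have := incl_multiplierRep g (proj j k f)
    rw [hg, incl_proj_of_mem hmem] at this
    rw [← this]
    simp
  have h1 : ∀ᵐ q ∂fourierMeasure,
      g (ENNReal.ofReal (2 * Real.pi * q.1)) * packet (j - 1) (k - 1) s t q = 0 := by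
    have hm := coeFn_siegelFourier_multiplierOp g f
    rw [h0, map_zero] at hm
    filter_upwards [hm, hfe, Lp.coeFn_zero ℂ 2 fourierMeasure] with q h2 h3 h4
    rw [← h3, ← h2, h4]
    rfl
  have h2 : ∀ᵐ ξ : ℝ, ξ ∉ Ioo s t := by
    filter_upwards [ae_ae_ae_of_ae h1] with ξ hξ hmemξ
    obtain ⟨hgξ, hξ0⟩ := hsub ⟨hrs.trans hmemξ.1, hmemξ.2⟩
    have hc : 0 < 2 * Real.pi * ξ := by
      have : 0 < ξ := hξ0
      positivity
    obtain ⟨z, hz, hz0⟩ := (hξ.and (Measure.ae_ne volume (0 : ℂ))).exists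
    have h3 := integral_laguerreKernel_mul_self (k - 1) hc
    refine one_ne_zero (α := ℂ) (h3.symm.trans (integral_eq_zero_of_ae ?_))
    filter_upwards [hz] with v hv
    have hgz : gaussian (2 * Real.pi * ξ) z ≠ 0 := Complex.exp_ne_zero _
    have hzp : (starRingEnd ℂ) z ^ (j - 1) ≠ 0 :=
      pow_ne_zero _ ((map_ne_zero (starRingEnd ℂ)).2 hz0)
    have h4 := (mul_eq_zero.1 hv).resolve_left hgξ
    simp only [packet, indicator_of_mem hmemξ, one_mul] at h4
    rw [(mul_eq_zero.1 h4).resolve_left (mul_ne_zero hzp hgz)]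
    simp
  have h3 : volume (Ioo s t) = 0 := measure_eq_zero_iff_ae_notMem.2 h2
  rw [Real.volume_Ioo, ENNReal.ofReal_eq_zero] at h3
  linarith [hrt.2]

/-- The representation carries the generators of `C[0, +∞]` to the generators of the Toeplitz algebra. -/
theorem image_multiplierRep {j k : ℕ} (hk : 1 ≤ k) :
    multiplierRep j k '' extendedSpectralFunctions k = toeplitz j k '' endLimitSymbols := by
  ext T
  constructor
  · rintro ⟨g, ⟨b, hb, hg⟩, rfl⟩
    exact ⟨b, hb, toeplitz_eq_multiplierRep hk hg⟩
  · rintro ⟨b, hb, rfl⟩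
    obtain ⟨b₀, bInf, h⟩ := hb
    obtain ⟨g, hg, -, -⟩ := exists_extension_of_hasEndLimits k h
    exact ⟨g, ⟨b, ⟨b₀, bInf, h⟩, hg⟩, (toeplitz_eq_multiplierRep hk hg).symm⟩

theorem mainTheorem6 (j k : ℕ) (hj : 1 ≤ j) (hk : 1 ≤ k) :
    -- each spectral function extends continuously to `[0, +∞]`, with the stated end values
    (∀ (b : LInfty) (b₀ bInf : ℂ), HasEndLimits b b₀ bInf →
      (∀ x : ℝ, 0 < x → IntegrableOn
        (fun y : ℝ => b (y / (2 * x)) * ((laguerreFun (k - 1) y ^ 2 : ℝ) : ℂ)) (Ioi 0)) ∧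
      ∃ g : C(ℝ≥0∞, ℂ), (∀ x : ℝ, 0 < x → g (ENNReal.ofReal x) = spectralFun k b x) ∧
        g 0 = bInf ∧ g ⊤ = b₀) ∧
    -- the C*-algebra generated by the spectral functions is `C[0, +∞]`
    (∃ Ψ : spectralAlgebra k ≃⋆ₐ[ℂ] C(ℝ≥0∞, ℂ),
      (∀ f, ‖Ψ f‖ = ‖(f : Ioi (0 : ℝ) →ᵇ ℂ)‖) ∧
      ∀ f, ∀ x : Ioi (0 : ℝ), Ψ f (ENNReal.ofReal x) = (f : Ioi (0 : ℝ) →ᵇ ℂ) x) ∧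
    -- the C*-algebra generated by the Toeplitz operators is `C[0, +∞]`, by `T_b ↦ γ^b`
    (∃ Φ : toeplitzAlgebra j k ≃⋆ₐ[ℂ] C(ℝ≥0∞, ℂ),
      (∀ t, ‖Φ t‖ = ‖(t : TrueSpace j k →L[ℂ] TrueSpace j k)‖) ∧
      ∀ (b : LInfty) (hb : b ∈ endLimitSymbols), ∀ x : ℝ, 0 < x →
        Φ ⟨toeplitz j k b, toeplitz_mem j k hb⟩ (ENNReal.ofReal x) = spectralFun k b x) := by
  refine ⟨fun b b₀ bInf h => ⟨fun x hx => integrableOn_spectralFun k b hx,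
    exists_extension_of_hasEndLimits k h⟩, exists_starAlgEquiv_spectralAlgebra k, ?_⟩
  have hinj := multiplierRep_injective hj hk
  obtain ⟨Φ, hΦ, hρ⟩ := exists_starAlgEquiv_of_injective (multiplierRep j k) hinj
    (extendedSpectralFunctions k) (adjoin_extendedSpectralFunctions k) (toeplitzAlgebra j k)
    (by rw [image_multiplierRep hk]; rfl)
  refine ⟨Φ, hΦ, fun b hb x hx => ?_⟩
  obtain ⟨b₀, bInf, h⟩ := id hb
  obtain ⟨g, hg, -, -⟩ := exists_extension_of_hasEndLimits k h
  have e : Φ ⟨toeplitz j k b, toeplitz_mem j k hb⟩ = g :=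
    hinj ((hρ _).trans (toeplitz_eq_multiplierRep hk hg))
  rw [e, hg x hx]
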